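/- Let $n\in\mathbb N$, $b>0$, $T>0$, $A\in\mathbb R^{n\times n}$, $g\in L^2(0,T;\mathbb R^n)$, $\varphi\in H^1(-b,0;\mathbb R^n)$, $x_d\in L^2(0,T;\mathbb R^n)$, and let $f\in C^2(\mathbb R^n,\mathbb R^n)$ be such that, for some constant $\lambda>0$, $Df(y)+\lambda I$ is positive semi-definite for all $y\in\mathbb R^n$, i.e. $\langle (Df(y)+\lambda I)v,v\rangle\ge 0$ for all $y,v\in\mathbb R^n$. All differential equations below are understood almost everywhere in $(0,T)$. For each $\tau\in[0,b)$ the delay equation $$\dot x(t)+f(x(t))=A\,x(t-\tau)+g(t)\ \text{ in }(0,T),\qquad x=\varphi\ \text{ on }[-b,0],$$ has a unique solution $x=x[\tau]\in H^1(-b,T;\mathbb R^n)$, and the adjoint equation $$-\dot p(t)+Df(x[\tau](t))^\top p(t)=A^\top p(t+\tau)+x[\tau](t)-x_d(t)\ \text{ in }(0,T),\qquad p=0\ \text{ on }[T,T+b],$$ has a unique solution $p=p[\tau]\in H^1(0,T+b;\mathbb R^n)$. The mapping $\tau\mapsto x[\tau]$ is differentiable from $[0,b)$ to $H^1(-b,T;\mathbb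 R^n)$ (with a one-sided derivative at $\tau=0$); denote its derivative by $x'[\tau]$. The mapping $\tau\mapsto p[\tau]$ is continuously differentiable from $[0,b)$ to $H^1(0,T+b;\mathbb R^n)$ (one-sided at $\tau=0$), and for every $\tau\in[0,b)$ its derivative $w=p'[\tau]$ is the unique solution $w\in H^1(0,T+b;\mathbb R^n)$ of $$-\dot w(t)+Df(x[\tau](t))^\top w(t)-A^\top w(t+\tau)=-x'[\tau](t)\,D\big(Df(x[\tau](t))^\top\big)\,p[\tau](t)+A^\top\dot p[\tau](t+\tau)+x'[\tau](t)\ \text{ in }(0,T),$$ $$w=0\ \text{ on }[T,T+b],$$ where, for $y,q,p\in\mathbb R^n$, $$\big(q\,D(Df(y)^\top)\,p\big)_i=\sum_{j,k=1}^n\frac{\partial^2 f_j}{\partial x_i\,\partial x_k}(y)\,p_j\,q_k ,\qquad i=1,\dots,n .$$ -/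

import Mathlib

noncomputable section

namespace DelayAdjoint

open MeasureTheory Set

/-- `ℝⁿ` with the Euclidean norm. -/
abbrev Vec (n : ℕ) : Type := EuclideanSpace ℝ (Fin n)

/-- `L²(a, b; ℝⁿ)`. -/
abbrev L2 (a b : ℝ) (n : ℕ) : Type :=
  Lp (Vec n) 2 (volume.restrict (Ioo a b))

/-- `v` is the weak derivative of `u` on `(a, b)`, tested with `C_c^∞(a, b)`. -/
def IsWeakDeriv {a b : ℝ} {n : ℕ} (u v : L2 a b n) : Prop :=
  ∀ η : ℝ → ℝ, ContDiff ℝ (⊤ : ℕ∞) η → HasCompactSupport η → tsupport η ⊆ Ioo a b →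
    ∫ t in Ioo a b, deriv η t • u t = - ∫ t in Ioo a b, η t • v t

theorem integrable_smul_L2 {a b : ℝ} {n : ℕ} (u : L2 a b n) {η : ℝ → ℝ}
    (hc : Continuous η) (hs : HasCompactSupport η) :
    Integrable (fun t => η t • u t) (volume.restrict (Ioo a b)) := by
  obtain ⟨C, hC⟩ := hc.bounded_above_of_compact_support hs
  exact ((Lp.memLp u).integrable (by norm_num)).bdd_smul C hc.aestronglyMeasurable
    (Filter.Eventually.of_forall hC)

/-- The Sobolev space `H¹(a, b; ℝⁿ)`: the pairs `(u, u̇)` in `L² × L²` for which `u̇` is the weak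
derivative of `u`, with the norm `(‖u‖² + ‖u̇‖²)^(1/2)` inherited from the Hilbert space
product. -/
def H1 (a b : ℝ) (n : ℕ) : Submodule ℝ (WithLp 2 (L2 a b n × L2 a b n)) where
  carrier := {w | IsWeakDeriv w.fst w.snd}
  zero_mem' := by
    intro η _ _ _
    have h : ∀ θ : ℝ → ℝ, ∫ t in Ioo a b, θ t • (0 : L2 a b n) t = 0 := fun θ => by
      rw [← integral_zero ℝ (Vec n)]
      refine integral_congr_ae ?_
      filter_upwards [Lp.coeFn_zero (Vec n) 2 (volume.restrict (Ioo a b))] with t ht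
      rw [ht, Pi.zero_apply, smul_zero]
    simp only [WithLp.zero_fst, WithLp.zero_snd]
    rw [h, h, neg_zero]
  add_mem' := by
    intro w z hw hz η h1 h2 h3
    have key : ∀ (u v : L2 a b n) (θ : ℝ → ℝ), Continuous θ → HasCompactSupport θ →
        ∫ t in Ioo a b, θ t • (u + v : L2 a b n) t =
          (∫ t in Ioo a b, θ t • u t) + ∫ t in Ioo a b, θ t • v t := by
      intro u v θ hc hs
      rw [← integral_add (integrable_smul_L2 u hc hs) (integrable_smul_L2 v hc hs)]
      refine integral_congr_ae ?_
      filter_upwards [Lp.coeFn_add u v] with t ht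
      rw [ht, Pi.add_apply, smul_add]
    simp only [WithLp.add_fst, WithLp.add_snd]
    rw [key _ _ _ (h1.continuous_deriv (by simp)) h2.deriv, key _ _ _ h1.continuous h2,
      hw η h1 h2 h3, hz η h1 h2 h3, neg_add]
  smul_mem' := by
    intro c w hw η h1 h2 h3
    have key : ∀ (u : L2 a b n) (θ : ℝ → ℝ),
        ∫ t in Ioo a b, θ t • (c • u : L2 a b n) t = c • ∫ t in Ioo a b, θ t • u t := by
      intro u θ
      rw [← integral_smul]
      refine integral_congr_ae ?_
      filter_upwards [Lp.coeFn_smul c u] with t ht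
      rw [ht, Pi.smul_apply, smul_comm]
    simp only [WithLp.smul_fst, WithLp.smul_snd]
    rw [key, key, hw η h1 h2 h3, smul_neg]

/-- A representative of `u ∈ H¹(a, b; ℝⁿ)`; it is meaningful almost everywhere in `(a, b)`. -/
def H1.val {a b : ℝ} {n : ℕ} (u : H1 a b n) : ℝ → Vec n := u.1.fst

/-- A representative of the time derivative `u̇` of `u ∈ H¹(a, b; ℝⁿ)`; it is meaningful almost
everywhere in `(a, b)`. -/
def H1.dot {a b : ℝ} {n : ℕ} (u : H1 a b n) : ℝ → Vec n := u.1.snd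

/-- A matrix acting on `ℝⁿ`. -/
def act {n : ℕ} (A : Matrix (Fin n) (Fin n) ℝ) (v : Vec n) : Vec n :=
  Matrix.toEuclideanLin A v

/-- The partial derivative `∂h/∂xᵢ` of a scalar function on `ℝⁿ`. -/
def partialD {n : ℕ} (i : Fin n) (h : Vec n → ℝ) (y : Vec n) : ℝ :=
  fderiv ℝ h y (EuclideanSpace.single i 1)

/-- The Jacobian matrix of `f` at `y`. -/
def jacobian {n : ℕ} (f : Vec n → Vec n) (y : Vec n) : Matrix (Fin n) (Fin n) ℝ :=
  Matrix.of fun i j => partialD j (fun z => f z i) y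

/-- The vector with components `∑_{j,k} (∂²f_j / ∂xᵢ∂x_k)(y) p_j q_k`. -/
def secondTerm {n : ℕ} (f : Vec n → Vec n) (y q p : Vec n) : Vec n :=
  WithLp.toLp 2 fun i =>
    ∑ j, ∑ k, partialD k (partialD i (fun z => f z j)) y * p j * q k

/-- `x ∈ H¹(-b, T; ℝⁿ)` solves `ẋ(t) + f(x(t)) = A x(t - τ) + g(t)` in `(0, T)` and `x = φ` on
`[-b, 0]`. Since `x` and `φ` have continuous representatives and `b > 0`, equality almost
everywhere in `(-b, 0)` is equality on `[-b, 0]`; in particular `x(0) = φ(0)`. -/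
def IsState {n : ℕ} {b T : ℝ} (f : Vec n → Vec n) (A : Matrix (Fin n) (Fin n) ℝ)
    (g : L2 0 T n) (φ : H1 (-b) 0 n) (τ : ℝ) (x : H1 (-b) T n) : Prop :=
  (∀ᵐ t ∂volume.restrict (Ioo 0 T),
    H1.dot x t + f (H1.val x t) = act A (H1.val x (t - τ)) + g t) ∧
  ∀ᵐ t ∂volume.restrict (Ioo (-b) 0), H1.val x t = H1.val φ t

/-- `p ∈ H¹(0, T + b; ℝⁿ)` solves the adjoint equation
`-ṗ(t) + Df(x(t))ᵀ p(t) = Aᵀ p(t + τ) + x(t) - x_d(t)` in `(0, T)` and `p = 0` on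
`[T, T + b]`. -/
def IsAdjoint {n : ℕ} {b T : ℝ} (f : Vec n → Vec n) (A : Matrix (Fin n) (Fin n) ℝ)
    (xd : L2 0 T n) (τ : ℝ) (x : H1 (-b) T n) (p : H1 0 (T + b) n) : Prop :=
  (∀ᵐ t ∂volume.restrict (Ioo 0 T),
    -H1.dot p t + act (jacobian f (H1.val x t)).transpose (H1.val p t) =
      act A.transpose (H1.val p (t + τ)) + H1.val x t - xd t) ∧
  ∀ᵐ t ∂volume.restrict (Ioo T (T + b)), H1.val p t = 0

/-- `w ∈ H¹(0, T + b; ℝⁿ)` solves the differentiated adjoint equation in `(0, T)`, where `x'` is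
the derivative of the state with respect to the delay, and `w = 0` on `[T, T + b]`. -/
def IsAdjointDeriv {n : ℕ} {b T : ℝ} (f : Vec n → Vec n) (A : Matrix (Fin n) (Fin n) ℝ)
    (τ : ℝ) (x x' : H1 (-b) T n) (p w : H1 0 (T + b) n) : Prop :=
  (∀ᵐ t ∂volume.restrict (Ioo 0 T),
    -H1.dot w t + act (jacobian f (H1.val x t)).transpose (H1.val w t)
        - act A.transpose (H1.val w (t + τ)) =
      -secondTerm f (H1.val x t) (H1.val x' t) (H1.val p t)
        + act A.transpose (H1.dot p (t + τ)) + H1.val x' t) ∧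
  ∀ᵐ t ∂volume.restrict (Ioo T (T + b)), H1.val w t = 0

end DelayAdjoint

end

open DelayAdjoint

/-!
# Differentiability of state and adjoint with respect to a delay

A Sobolev function on an interval is the primitive of its weak derivative
(`exists_eq_primH1`). A function with prescribed history is therefore determined by its derivative
`v ∈ L²(0, T)`, and a delay equation becomes a fixed point equation `Φ(v) = v` in `L²(0, T)`
(`DelayProblem.rhs_eq_iff`).

*Causality.* If the nonlinearity is globally Lipschitz, the difference of `Φ(v)` and `Φ(w)` at time
`t` is bounded by the primitive of `v - w` at times up to `t`; `IsCausalLip` records the consequence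
that exponential bounds are preserved up to a constant. In an `L²` norm with an exponential weight
such maps are contractions, which yields existence, uniqueness and a bound
`‖v - w‖ ≤ C ‖(v - Φ v) - (w - Φ w)‖` with a constant that does not depend on the delay `τ`
(`exists_causal_bound`).

*Differentiability in the delay.* Translation `x ↦ x(· - τ)` is not differentiable in `τ` on `L²`,
but it is on `H¹`, with derivative `-ẋ(· - τ)`, and the difference quotients of translates of `x`
are bounded by the `H¹` norm of `x` (`hasDerivWithinAt_delayL`, `norm_delayL_sub_le`). The
trajectories belonging to `v ∈ L²` lie in `H¹`, so the fixed point equation is differentiable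
jointly in `τ` and `v`, and the argument of the implicit function theorem applies
(`DelayProblem.exists_solution`). The superposition operator is differentiable on continuous
functions, into which trajectories embed.

*State equation.* Semidefiniteness of `Df + λ I` gives `⟨f(y), y⟩ ≥ -λ ‖y‖² - ‖f(0)‖ ‖y‖`, and an
energy estimate bounds every solution uniformly in `τ` (`exists_apriori_bound`). Multiplying `f`
by a cutoff with values in `[0, 1]` preserves this bound, so that the truncated equation, which has
a globally Lipschitz nonlinearity, has the same solutions as the original one (`exists_state`).

*Adjoint equation.* The time reversal `t ↦ T - t` turns the adjoint equation into a delay equation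
with vanishing history and nonlinearity `(y, q) ↦ Df(y)ᵀ q - y`, in which the state enters as a
parameter that depends differentiably on `τ`. The linearization of this nonlinearity is the
right-hand side of the differentiated adjoint equation (`fderiv_adjointField`, `exists_adjoint`).
-/

noncomputable section

namespace DelayAdjoint

open MeasureTheory Set Filter Topology

/-- `L²(ℝ; ℝⁿ)`. -/
abbrev LR (n : ℕ) : Type := Lp (Vec n) 2 (volume : Measure ℝ)

variable {n : ℕ}

/-! ### Null sets and changes of variable on intervals -/

theorem ae_Ioo_shift {a b c d s : ℝ} {P : ℝ → Prop}
    (h : ∀ᵐ t ∂volume.restrict (Ioo a b), P t) (hc : a ≤ c + s) (hd : d + s ≤ b) :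
    ∀ᵐ t ∂volume.restrict (Ioo c d), P (t + s) := by
  rw [ae_restrict_iff' measurableSet_Ioo] at h ⊢
  filter_upwards [(measurePreserving_add_right (volume : Measure ℝ) s).quasiMeasurePreserving.ae h]
    with t ht htc
  exact ht ⟨by linarith [htc.1], by linarith [htc.2]⟩

theorem ae_Ioo_reflect {a b c d s : ℝ} {P : ℝ → Prop}
    (h : ∀ᵐ t ∂volume.restrict (Ioo a b), P t) (hc : a ≤ s - d) (hd : s - c ≤ b) :
    ∀ᵐ t ∂volume.restrict (Ioo c d), P (s - t) := by
  rw [ae_restrict_iff' measurableSet_Ioo] at h ⊢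
  filter_upwards [(Measure.measurePreserving_sub_left (volume : Measure ℝ)
    s).quasiMeasurePreserving.ae h] with t ht htc
  exact ht ⟨by linarith [htc.2], by linarith [htc.1]⟩

theorem ae_Ioo_mono {a b c d : ℝ} {P : ℝ → Prop}
    (h : ∀ᵐ t ∂volume.restrict (Ioo a b), P t) (hc : a ≤ c) (hd : d ≤ b) :
    ∀ᵐ t ∂volume.restrict (Ioo c d), P t :=
  ae_restrict_of_ae_restrict_of_subset (Ioo_subset_Ioo hc hd) h

/-! ### Extension by zero and primitives of square integrable functions -/

theorem memLp_indicator (a b : ℝ) (u : L2 a b n) : MemLp ((Ioo a b).indicator u) 2 volume :=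
  (memLp_indicator_iff_restrict measurableSet_Ioo).2 (Lp.memLp u)

theorem indicator_congr_ae {a b : ℝ} {u v : ℝ → Vec n} (h : u =ᵐ[volume.restrict (Ioo a b)] v) :
    (Ioo a b).indicator u =ᵐ[volume] (Ioo a b).indicator v := by
  filter_upwards [(ae_restrict_iff' measurableSet_Ioo).1 h] with t ht
  by_cases htt : t ∈ Ioo a b
  · simp [indicator_of_mem htt, ht htt]
  · simp [indicator_of_notMem htt]

/-- Extension by zero, as a linear map. -/
def extZeroLin (a b : ℝ) : L2 a b n →ₗ[ℝ] LR n where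
  toFun u := MemLp.toLp _ (memLp_indicator a b u)
  map_add' u v := by
    rw [← MemLp.toLp_add, MemLp.toLp_eq_toLp_iff, ← indicator_add']
    exact indicator_congr_ae (Lp.coeFn_add u v)
  map_smul' c u := by
    rw [← MemLp.toLp_const_smul, MemLp.toLp_eq_toLp_iff, RingHom.id_apply]
    refine (indicator_congr_ae (Lp.coeFn_smul c u)).trans (Eventually.of_forall fun t => ?_)
    rw [Pi.smul_def, Pi.smul_apply, ← indicator_const_smul_apply]

/-- Extension by zero, as a linear isometry `L²(a, b; ℝⁿ) → L²(ℝ; ℝⁿ)`. -/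
def extZero (a b : ℝ) : L2 a b n →ₗᵢ[ℝ] LR n where
  toLinearMap := extZeroLin a b
  norm_map' u := by
    simp only [extZeroLin, LinearMap.coe_mk, AddHom.coe_mk]
    rw [Lp.norm_toLp, eLpNorm_indicator_eq_eLpNorm_restrict measurableSet_Ioo, Lp.norm_def]

theorem extZero_ae (a b : ℝ) (u : L2 a b n) : extZero a b u =ᵐ[volume] (Ioo a b).indicator u :=
  MemLp.coeFn_toLp (memLp_indicator a b u)

/-- Restriction `L²(ℝ; ℝⁿ) → L²(a, b; ℝⁿ)`. -/
def resL (a b : ℝ) : LR n →L[ℝ] L2 a b n :=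
  LpToLpRestrictCLM ℝ (Vec n) ℝ volume 2 (Ioo a b)

theorem resL_ae (a b : ℝ) (w : LR n) : resL a b w =ᵐ[volume.restrict (Ioo a b)] w :=
  LpToLpRestrictCLM_coeFn ℝ _ w

theorem norm_resL_le (a b : ℝ) (w : LR n) : ‖resL a b w‖ ≤ ‖w‖ := by
  rw [Lp.norm_def, Lp.norm_def, eLpNorm_congr_ae (resL_ae a b w)]
  exact ENNReal.toReal_mono (Lp.eLpNorm_ne_top w)
    (eLpNorm_mono_measure _ Measure.restrict_le_self)

theorem extZero_ae_restrict (a b : ℝ) (u : L2 a b n) :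
    extZero a b u =ᵐ[volume.restrict (Ioo a b)] u := by
  filter_upwards [ae_restrict_of_ae (extZero_ae a b u), ae_restrict_mem measurableSet_Ioo]
    with t ht htt
  rw [ht, indicator_of_mem htt]

theorem LR_locallyIntegrable (w : LR n) : LocallyIntegrable w volume :=
  (Lp.memLp w).locallyIntegrable (by norm_num)

theorem LR_intervalIntegrable (w : LR n) (s t : ℝ) : IntervalIntegrable w volume s t :=
  ((LR_locallyIntegrable w).integrableOn_isCompact isCompact_uIcc).intervalIntegrable

theorem norm_sq_eq_integral {μ : Measure ℝ} (w : Lp (Vec n) 2 μ) :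
    ‖w‖ ^ 2 = ∫ t, ‖w t‖ ^ 2 ∂μ := by
  rw [← real_inner_self_eq_norm_sq, L2.inner_def]
  simp

theorem integrable_norm_sq {μ : Measure ℝ} (w : Lp (Vec n) 2 μ) :
    Integrable (fun t => ‖w t‖ ^ 2) μ :=
  (Lp.memLp w).integrable_norm_pow (by norm_num)

/-- The Cauchy–Schwarz inequality for `∫ ρ u` with a continuous scalar weight `ρ`. -/
theorem norm_integral_smul_le (w : LR n) {ρ : ℝ → ℝ} (hρ : Continuous ρ) {s t : ℝ} (hst : s ≤ t) :
    ‖∫ r in s..t, ρ r • w r‖ ≤ √(∫ r in s..t, ρ r ^ 2) * ‖w‖ := by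
  have hm : MemLp (fun r => |ρ r|) 2 (volume.restrict (Ioc s t)) := by
    obtain ⟨C, hC⟩ := isCompact_Icc.exists_bound_of_continuousOn (hρ.abs.continuousOn (s := Icc s t))
    refine MemLp.of_bound hρ.abs.aestronglyMeasurable C ?_
    filter_upwards [ae_restrict_mem measurableSet_Ioc] with r hr
    exact hC r (Ioc_subset_Icc_self hr)
  have hw : MemLp (fun r => ‖w r‖) 2 (volume.restrict (Ioc s t)) :=
    ((Lp.memLp w).restrict _).norm
  have h1 := integral_mul_le_Lp_mul_Lq_of_nonneg (μ := volume.restrict (Ioc s t))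
    (p := 2) (q := 2) (by constructor <;> norm_num) (f := fun r => |ρ r|) (g := fun r => ‖w r‖)
    (Eventually.of_forall fun r => abs_nonneg _) (Eventually.of_forall fun r => norm_nonneg _)
    (by simpa using hm) (by simpa using hw)
  rw [← Real.sqrt_eq_rpow, ← Real.sqrt_eq_rpow] at h1
  calc ‖∫ r in s..t, ρ r • w r‖ ≤ ∫ r in s..t, ‖ρ r • w r‖ :=
        intervalIntegral.norm_integral_le_integral_norm hst
    _ = ∫ r in Ioc s t, |ρ r| * ‖w r‖ := by
        rw [intervalIntegral.integral_of_le hst]; simp [norm_smul]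
    _ ≤ _ := h1
    _ ≤ √(∫ r in s..t, ρ r ^ 2) * ‖w‖ := by
        rw [intervalIntegral.integral_of_le hst]
        simp only [Real.rpow_ofNat, sq_abs]
        gcongr
        refine Real.sqrt_le_iff.2 ⟨norm_nonneg _, ?_⟩
        rw [norm_sq_eq_integral]
        exact setIntegral_le_integral (integrable_norm_sq w)
          (Eventually.of_forall fun r => by positivity)

theorem norm_integral_le (w : LR n) (s t : ℝ) :
    ‖∫ r in s..t, w r‖ ≤ √|t - s| * ‖w‖ := by
  wlog hst : s ≤ t generalizing s t
  · rw [intervalIntegral.integral_symm, norm_neg, abs_sub_comm]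
    exact this t s (le_of_not_ge hst)
  have h := norm_integral_smul_le w (ρ := fun _ => 1) continuous_const hst
  simpa [abs_of_nonneg (sub_nonneg.2 hst)] using h

theorem continuous_primitive (w : LR n) (c : ℝ) : Continuous fun t => ∫ s in c..t, w s :=
  intervalIntegral.continuous_primitive (fun _ _ => LR_intervalIntegrable w _ _) c

theorem norm_integral_le_of_mem (w : LR n) {a b t : ℝ} (c : ℝ) (ht : t ∈ Ioo a b) :
    ‖∫ s in c..t, w s‖ ≤ √(|a - c| + |b - c|) * ‖w‖ := by
  refine (norm_integral_le w c t).trans ?_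
  gcongr
  rw [abs_le]
  constructor
  · linarith [neg_abs_le (a - c), abs_nonneg (b - c), ht.1]
  · linarith [le_abs_self (b - c), abs_nonneg (a - c), ht.2]

theorem memLp_primitive (a b c : ℝ) (w : LR n) :
    MemLp (fun t => ∫ s in c..t, w s) 2 (volume.restrict (Ioo a b)) :=
  MemLp.of_bound (continuous_primitive w c).aestronglyMeasurable
    (√(|a - c| + |b - c|) * ‖w‖) (by
      filter_upwards [ae_restrict_mem measurableSet_Ioo] with t ht
      exact norm_integral_le_of_mem w c ht)

theorem integral_LR_add (w z : LR n) (s t : ℝ) :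
    ∫ r in s..t, (w + z : LR n) r = (∫ r in s..t, w r) + ∫ r in s..t, z r := by
  rw [← intervalIntegral.integral_add (LR_intervalIntegrable w _ _)
    (LR_intervalIntegrable z _ _)]
  refine intervalIntegral.integral_congr_ae ?_
  filter_upwards [Lp.coeFn_add w z] with s hs _
  rw [hs, Pi.add_apply]

theorem integral_LR_smul (k : ℝ) (w : LR n) (s t : ℝ) :
    ∫ r in s..t, (k • w : LR n) r = k • ∫ r in s..t, w r := by
  rw [← intervalIntegral.integral_smul]
  refine intervalIntegral.integral_congr_ae ?_
  filter_upwards [Lp.coeFn_smul k w] with s hs _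
  rw [hs, Pi.smul_apply]

/-- The primitive `t ↦ ∫_c^t w` as an element of `L²(a, b; ℝⁿ)`, linear in `w`. -/
def primLin (a b c : ℝ) : LR n →ₗ[ℝ] L2 a b n where
  toFun w := MemLp.toLp _ (memLp_primitive a b c w)
  map_add' w z := by
    rw [← MemLp.toLp_add, MemLp.toLp_eq_toLp_iff]
    exact Eventually.of_forall fun t => integral_LR_add w z c t
  map_smul' k w := by
    rw [← MemLp.toLp_const_smul, MemLp.toLp_eq_toLp_iff, RingHom.id_apply]
    exact Eventually.of_forall fun t => integral_LR_smul k w c t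

/-- The primitive `t ↦ ∫_c^t w` as an element of `L²(a, b; ℝⁿ)`. -/
def primL (a b c : ℝ) : LR n →L[ℝ] L2 a b n :=
  (primLin a b c).mkContinuousOfExistsBound ⟨_, fun w => by
    refine (Lp.norm_le_of_ae_bound (C := √(|a - c| + |b - c|) * ‖w‖) (by positivity) ?_).trans
      (le_of_eq (mul_assoc _ _ _).symm)
    filter_upwards [ae_restrict_mem measurableSet_Ioo,
      MemLp.coeFn_toLp (memLp_primitive a b c w)] with t ht h
    exact (congrArg norm h).trans_le (norm_integral_le_of_mem w c ht)⟩

theorem primL_ae (a b c : ℝ) (w : LR n) :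
    primL a b c w =ᵐ[volume.restrict (Ioo a b)] fun t => ∫ s in c..t, w s :=
  MemLp.coeFn_toLp (memLp_primitive a b c w)

/-! ### Sobolev functions on an interval are primitives -/

theorem setIntegral_Ioo_eq_of_tsupport {F : Type*} [NormedAddCommGroup F] [NormedSpace ℝ F]
    {a b : ℝ} {η : ℝ → ℝ} (hs : tsupport η ⊆ Ioo a b) (u : ℝ → F) :
    ∫ t in Ioo a b, η t • u t = ∫ t, η t • u t := by
  refine setIntegral_eq_integral_of_forall_compl_eq_zero fun t ht => ?_
  rw [image_eq_zero_of_notMem_tsupport fun h => ht (hs h), zero_smul]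

theorem integral_mul_primitive_scalar {w : ℝ → ℝ} (hw : ∀ s t, IntervalIntegrable w volume s t)
    {a b c : ℝ} {η : ℝ → ℝ} (hη : ContDiff ℝ 1 η) (ha : η a = 0) (hb : η b = 0) (x0 : ℝ) :
    ∫ t in a..b, deriv η t * (x0 + ∫ s in c..t, w s) = - ∫ t in a..b, η t * w t := by
  have hAη : AbsolutelyContinuousOnInterval η a b :=
    hη.contDiffOn.absolutelyContinuousOnInterval
  have hAc : AbsolutelyContinuousOnInterval (fun _ : ℝ => x0 + ∫ s in c..a, w s) a b :=
    contDiff_const.contDiffOn.absolutelyContinuousOnInterval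
  have hAp := (hw a b).absolutelyContinuousOnInterval_intervalIntegral (c := a) left_mem_uIcc
  have hsplit : ∀ t, x0 + ∫ s in c..t, w s = (x0 + ∫ s in c..a, w s) + ∫ s in a..t, w s := by
    intro t
    rw [add_assoc, intervalIntegral.integral_add_adjacent_intervals (hw _ _) (hw _ _)]
  have hA := hAc.fun_add hAp
  have h := hAη.integral_mul_deriv_eq_deriv_mul hA
  have hfun : (fun x => (x0 + ∫ s in c..a, w s) + ∫ s in a..x, w s) =
      fun t => x0 + ∫ s in c..t, w s := funext fun t => (hsplit t).symm
  rw [hfun, ha, hb, zero_mul, zero_mul, sub_zero, zero_sub] at h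
  simp only [← hsplit] at h
  rw [← neg_eq_iff_eq_neg, ← h]
  refine intervalIntegral.integral_congr_ae ?_
  filter_upwards [(hw a b).ae_hasDerivAt_integral] with t ht htt
  have h1 := ht (uIoc_subset_uIcc htt) a left_mem_uIcc
  have h2 : HasDerivAt (fun t => x0 + ∫ s in c..t, w s) (w t) t := by
    rw [← hfun]
    exact h1.const_add _
  rw [h2.deriv]

/-- `∫ s in c..t, w s` has weak derivative `w`. -/
theorem integral_smul_primitive (w : LR n) {a b c : ℝ} {η : ℝ → ℝ} (hη : ContDiff ℝ 1 η)
    (hs : tsupport η ⊆ Ioo a b) (x0 : Vec n) :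
    ∫ t in Ioo a b, deriv η t • (x0 + ∫ s in c..t, w s) = - ∫ t in Ioo a b, η t • w t := by
  by_cases hab : a < b
  swap
  · simp [Ioo_eq_empty hab]
  have hea : η a = 0 := image_eq_zero_of_notMem_tsupport fun h => lt_irrefl _ (hs h).1
  have heb : η b = 0 := image_eq_zero_of_notMem_tsupport fun h => lt_irrefl _ (hs h).2
  have hint1 : IntervalIntegrable (fun t => deriv η t • (x0 + ∫ s in c..t, w s)) volume a b :=
    ((hη.continuous_deriv le_rfl).smul
      (continuous_const.add (continuous_primitive w c))).intervalIntegrable _ _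
  have hint2 : IntervalIntegrable (fun t => η t • w t) volume a b :=
    (LR_intervalIntegrable w a b).continuousOn_smul hη.continuous.continuousOn
  rw [← integral_Ioc_eq_integral_Ioo, ← integral_Ioc_eq_integral_Ioo,
    ← intervalIntegral.integral_of_le hab.le, ← intervalIntegral.integral_of_le hab.le]
  ext i
  have hw : ∀ s t, IntervalIntegrable (fun r => w r i) volume s t := fun s t =>
    ⟨(EuclideanSpace.proj (𝕜 := ℝ) i).integrable_comp (LR_intervalIntegrable w s t).1,
      (EuclideanSpace.proj (𝕜 := ℝ) i).integrable_comp (LR_intervalIntegrable w s t).2⟩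
  have e1 := (EuclideanSpace.proj (𝕜 := ℝ) i).intervalIntegral_comp_comm hint1
  have e2 := (EuclideanSpace.proj (𝕜 := ℝ) i).intervalIntegral_comp_comm hint2
  have e3 : ∀ t, (∫ s in c..t, w s) i = ∫ s in c..t, w s i := fun t =>
    ((EuclideanSpace.proj (𝕜 := ℝ) i).intervalIntegral_comp_comm
      (LR_intervalIntegrable w c t)).symm
  simp only [PiLp.proj_apply, PiLp.smul_apply, PiLp.add_apply, smul_eq_mul, e3]
    at e1 e2
  rw [PiLp.neg_apply, ← e1, ← e2]
  exact integral_mul_primitive_scalar hw hη hea heb (x0 i)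

/-- The map sending `(x₀, w)` to the function `t ↦ x₀ + ∫_c^t w` with weak derivative `w`,
without the proof that it lies in the Sobolev space. -/
def primPair (a b c : ℝ) : Vec n × LR n →L[ℝ] WithLp 2 (L2 a b n × L2 a b n) :=
  ((WithLp.prodContinuousLinearEquiv 2 ℝ (L2 a b n) (L2 a b n)).symm :
      L2 a b n × L2 a b n →L[ℝ] WithLp 2 (L2 a b n × L2 a b n)) ∘L
    (((Lp.constL 2 (volume.restrict (Ioo a b)) ℝ) ∘L ContinuousLinearMap.fst ℝ (Vec n) (LR n) +
      primL a b c ∘L ContinuousLinearMap.snd ℝ (Vec n) (LR n)).prod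
      (resL a b ∘L ContinuousLinearMap.snd ℝ (Vec n) (LR n)))

theorem primPair_fst_ae (a b c : ℝ) (z : Vec n × LR n) :
    (primPair a b c z).fst =ᵐ[volume.restrict (Ioo a b)] fun t => z.1 + ∫ s in c..t, z.2 s := by
  have h : (primPair a b c z).fst =
      Lp.const 2 (volume.restrict (Ioo a b)) z.1 + primL a b c z.2 := rfl
  rw [h]
  filter_upwards [Lp.coeFn_add (Lp.const 2 (volume.restrict (Ioo a b)) z.1) (primL a b c z.2),
    Lp.coeFn_const (p := 2) (μ := volume.restrict (Ioo a b)) z.1, primL_ae a b c z.2]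
    with t h1 h2 h3
  rw [h1, Pi.add_apply, h2, h3]
  rfl

theorem primPair_snd_ae (a b c : ℝ) (z : Vec n × LR n) :
    (primPair a b c z).snd =ᵐ[volume.restrict (Ioo a b)] z.2 :=
  resL_ae a b z.2

/-- The element `t ↦ x₀ + ∫_c^t w` of the Sobolev space `H¹(a, b; ℝⁿ)`, as a continuous linear
function of `(x₀, w) ∈ ℝⁿ × L²(ℝ; ℝⁿ)`. -/
def primH1 (a b c : ℝ) : Vec n × LR n →L[ℝ] H1 a b n :=
  (primPair a b c).codRestrict (H1 a b n) fun z η h1 _ h3 => by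
    rw [integral_congr_ae (g := fun t => deriv η t • (z.1 + ∫ s in c..t, z.2 s)),
      integral_smul_primitive z.2 (h1.of_le (by exact_mod_cast le_top)) h3]
    · congr 1
      refine integral_congr_ae ?_
      filter_upwards [primPair_snd_ae a b c z] with t ht
      rw [ht]
    · filter_upwards [primPair_fst_ae a b c z] with t ht
      rw [ht]

theorem primH1_val_ae (a b c : ℝ) (z : Vec n × LR n) :
    H1.val (primH1 a b c z) =ᵐ[volume.restrict (Ioo a b)] fun t => z.1 + ∫ s in c..t, z.2 s :=
  primPair_fst_ae a b c z

theorem primH1_dot_ae (a b c : ℝ) (z : Vec n × LR n) :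
    H1.dot (primH1 a b c z) =ᵐ[volume.restrict (Ioo a b)] z.2 :=
  primPair_snd_ae a b c z

theorem H1.ext_ae {a b : ℝ} {x y : H1 a b n}
    (h0 : H1.val x =ᵐ[volume.restrict (Ioo a b)] H1.val y)
    (h1 : H1.dot x =ᵐ[volume.restrict (Ioo a b)] H1.dot y) : x = y := by
  apply Subtype.ext
  apply (WithLp.equiv 2 _).injective
  exact Prod.ext (Lp.ext h0) (Lp.ext h1)

theorem L2_integrable {a b : ℝ} (u : L2 a b n) : Integrable u (volume.restrict (Ioo a b)) :=
  (Lp.memLp u).integrable (by norm_num)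

theorem exists_Icc_of_isCompact {a b : ℝ} (hab : a < b) {K : Set ℝ} (hK : IsCompact K)
    (hs : K ⊆ Ioo a b) : ∃ a' b', a < a' ∧ b' < b ∧ K ⊆ Icc a' b' := by
  rcases K.eq_empty_or_nonempty with rfl | hne
  · exact ⟨(a + b) / 2, (a + b) / 2, by linarith, by linarith, empty_subset _⟩
  · obtain ⟨l, hl⟩ := hK.exists_isLeast hne
    obtain ⟨u, hu⟩ := hK.exists_isGreatest hne
    exact ⟨l, u, (hs hl.1).1, (hs hu.1).2, fun x hx => ⟨hl.2 hx, hu.2 hx⟩⟩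

/-- A test function on `(a, b)` with vanishing integral is the derivative of a test function. -/
theorem exists_test_antiderivative {a b : ℝ} (hab : a < b) {ψ : ℝ → ℝ}
    (h1 : ContDiff ℝ (⊤ : ℕ∞) ψ) (h2 : HasCompactSupport ψ) (h3 : tsupport ψ ⊆ Ioo a b)
    (h0 : ∫ t in a..b, ψ t = 0) :
    ∃ η : ℝ → ℝ, ContDiff ℝ (⊤ : ℕ∞) η ∧ HasCompactSupport η ∧ tsupport η ⊆ Ioo a b ∧
      deriv η = ψ := by
  obtain ⟨a', b', ha, hb, hsub⟩ := exists_Icc_of_isCompact hab h2 h3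
  have hd : ∀ t, HasDerivAt (fun t => ∫ s in a..t, ψ s) (ψ t) t := fun t =>
    h1.continuous.integral_hasStrictDerivAt a t |>.hasDerivAt
  have hder : deriv (fun t => ∫ s in a..t, ψ s) = ψ := funext fun t => (hd t).deriv
  have hz : ∀ t, t ∉ Icc a' b' → ψ t = 0 := fun t ht =>
    image_eq_zero_of_notMem_tsupport fun h => ht (hsub h)
  have hsupp : tsupport (fun t => ∫ s in a..t, ψ s) ⊆ Icc a' b' := by
    refine closure_minimal (fun t ht => ?_) isClosed_Icc
    by_contra hcon
    apply ht
    rcases lt_or_ge t a' with hta | hta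
    · refine (intervalIntegral.integral_congr (g := fun _ => 0) fun s hs => ?_).trans (by simp)
      refine hz s fun hs' => ?_
      have := (mem_uIcc.1 hs)
      rcases this with h | h <;> linarith [h.1, h.2, hs'.1]
    · have htb : b' < t := by
        by_contra hh
        exact hcon ⟨hta, not_lt.1 hh⟩
      have hsum := intervalIntegral.integral_add_adjacent_intervals
        (h1.continuous.intervalIntegrable (μ := volume) a t)
        (h1.continuous.intervalIntegrable t b)
      have h4 : ∫ s in t..b, ψ s = 0 := by
        refine (intervalIntegral.integral_congr (g := fun _ => 0) fun s hs => ?_).trans (by simp)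
        refine hz s fun hs' => ?_
        rcases mem_uIcc.1 hs with h | h <;> linarith [h.1, h.2, hs'.2]
      rw [h4, h0, add_zero] at hsum
      exact hsum
  refine ⟨fun t => ∫ s in a..t, ψ s, ?_, ?_, hsupp.trans (Icc_subset_Ioo ha hb), hder⟩
  · rw [contDiff_infty_iff_deriv, hder]
    exact ⟨fun t => (hd t).differentiableAt, h1⟩
  · exact isCompact_Icc.of_isClosed_subset (isClosed_tsupport _) hsupp

/-- There is a test function on `(a, b)` with integral one. -/
theorem exists_test_integral_one {a b : ℝ} (hab : a < b) :
    ∃ η : ℝ → ℝ, ContDiff ℝ (⊤ : ℕ∞) η ∧ HasCompactSupport η ∧ tsupport η ⊆ Ioo a b ∧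
      ∫ t in a..b, η t = 1 := by
  let B : ContDiffBump ((a + b) / 2) :=
    { rIn := (b - a) / 8, rOut := (b - a) / 4, rIn_pos := by linarith, rIn_lt_rOut := by linarith }
  have hs : tsupport (B.normed volume) ⊆ Ioo a b := by
    rw [B.tsupport_normed_eq, Real.closedBall_eq_Icc]
    refine Icc_subset_Ioo ?_ ?_ <;> simp only [B] <;> linarith
  refine ⟨B.normed volume, B.contDiff_normed, B.hasCompactSupport_normed, hs, ?_⟩
  rw [intervalIntegral.integral_of_le hab.le, integral_Ioc_eq_integral_Ioo, ← B.integral_normed (μ := volume)]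
  simpa using setIntegral_Ioo_eq_of_tsupport hs (fun _ => (1 : ℝ))

/-- The du Bois-Reymond lemma: a function with vanishing weak derivative is constant. -/
theorem ae_eq_const_of_isWeakDeriv_zero {a b : ℝ} {u : L2 a b n} (hu : IsWeakDeriv u 0) :
    ∃ x0 : Vec n, u =ᵐ[volume.restrict (Ioo a b)] fun _ => x0 := by
  by_cases hab : a < b
  swap
  · exact ⟨0, by simp [Ioo_eq_empty hab, EventuallyEq]⟩
  obtain ⟨η0, hη1, hη2, hη3, hη4⟩ := exists_test_integral_one hab
  have hu' : ∀ η : ℝ → ℝ, ContDiff ℝ (⊤ : ℕ∞) η → HasCompactSupport η → tsupport η ⊆ Ioo a b →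
      ∫ t in Ioo a b, deriv η t • u t = 0 := by
    intro η h1 h2 h3
    rw [hu η h1 h2 h3, neg_eq_zero, ← integral_zero ℝ (Vec n)]
    refine integral_congr_ae ?_
    filter_upwards [Lp.coeFn_zero (Vec n) 2 (volume.restrict (Ioo a b))] with t ht
    rw [ht, Pi.zero_apply, smul_zero]
  -- the constant is the mean of `u` with weight `η0`
  set x0 := ∫ t in Ioo a b, η0 t • u t with hx0
  refine ⟨x0, ?_⟩
  have key := isOpen_Ioo.ae_eq_zero_of_integral_contDiff_smul_eq_zero (μ := volume)
    (U := Ioo a b) (f := fun t => u t - x0) ?_ ?_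
  · rw [EventuallyEq, ae_restrict_iff' measurableSet_Ioo]
    filter_upwards [key] with t ht htt
    exact sub_eq_zero.1 (ht htt)
  · have : IntegrableOn (fun t => u t - x0) (Ioo a b) volume :=
      (L2_integrable u).sub (integrable_const x0)
    exact this.locallyIntegrableOn
  · intro ψ h1 h2 h3
    rw [← setIntegral_Ioo_eq_of_tsupport h3]
    set m := ∫ t in a..b, ψ t with hm
    have hmul : tsupport (fun t => m * η0 t) ⊆ tsupport η0 :=
      closure_mono fun t ht h => ht (by simp [h])
    have hcs : HasCompactSupport fun t => m * η0 t := hη2.mul_left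
    -- `ψ - m η0` has vanishing integral, hence is the derivative of a test function
    obtain ⟨η, e1, e2, e3, e4⟩ := exists_test_antiderivative hab
      (ψ := fun t => ψ t - m * η0 t) (h1.sub (contDiff_const.mul hη1)) (h2.sub hcs)
      ((tsupport_sub _ _).trans (union_subset h3 (hmul.trans hη3))) (by
        rw [intervalIntegral.integral_sub (h1.continuous.intervalIntegrable _ _)
          ((hη1.continuous.const_mul m).intervalIntegrable _ _),
          intervalIntegral.integral_const_mul, hη4, mul_one, sub_self])
    have h5 := hu' η e1 e2 e3
    rw [e4] at h5
    have i1 := integrable_smul_L2 u h1.continuous h2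
    have i2 := integrable_smul_L2 u hη1.continuous hη2
    have h6 : ∫ t in Ioo a b, (ψ t - m * η0 t) • u t =
        (∫ t in Ioo a b, ψ t • u t) - m • x0 := by
      rw [hx0, ← integral_smul]
      refine Eq.trans ?_ (integral_sub i1 (i2.smul m))
      simp [sub_smul, mul_smul]
    have h7 : ∫ t in Ioo a b, ψ t • (u t - x0) =
        (∫ t in Ioo a b, ψ t • u t) - m • x0 := by
      have i3 : Integrable (fun t => ψ t • x0) (volume.restrict (Ioo a b)) :=
        ((h1.continuous.integrable_of_hasCompactSupport h2).smul_const x0).restrict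
      simp only [smul_sub]
      rw [integral_sub i1 i3, integral_smul_const, hm, intervalIntegral.integral_of_le hab.le,
        integral_Ioc_eq_integral_Ioo]
    rw [h7, ← h6, h5]

/-- Weak derivatives are unique, also on a common subinterval of the domains. -/
theorem dot_ae_eq_of_val_ae_eq {a b a' b' c d : ℝ} {x : H1 a b n} {y : H1 a' b' n}
    (hac : a ≤ c) (hdb : d ≤ b) (hac' : a' ≤ c) (hdb' : d ≤ b')
    (h : H1.val x =ᵐ[volume.restrict (Ioo c d)] H1.val y) :
    H1.dot x =ᵐ[volume.restrict (Ioo c d)] H1.dot y := by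
  have hI : Ioo c d ⊆ Ioo a b := Ioo_subset_Ioo hac hdb
  have hI' : Ioo c d ⊆ Ioo a' b' := Ioo_subset_Ioo hac' hdb'
  have iX : IntegrableOn (H1.dot x) (Ioo c d) volume :=
    IntegrableOn.mono_set (L2_integrable x.1.snd) hI
  have iY : IntegrableOn (H1.dot y) (Ioo c d) volume :=
    IntegrableOn.mono_set (L2_integrable y.1.snd) hI'
  have key := isOpen_Ioo.ae_eq_zero_of_integral_contDiff_smul_eq_zero (μ := volume)
    (U := Ioo c d) (f := fun t => H1.dot x t - H1.dot y t) (iX.sub iY).locallyIntegrableOn ?_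
  · rw [EventuallyEq, ae_restrict_iff' measurableSet_Ioo]
    filter_upwards [key] with t ht htt
    exact sub_eq_zero.1 (ht htt)
  · intro ψ h1 h2 h3
    have hd3 : tsupport (deriv ψ) ⊆ Ioo c d := (tsupport_deriv_subset (f := ψ)).trans h3
    have ex := x.2 ψ h1 h2 (h3.trans hI)
    have ey := y.2 ψ h1 h2 (h3.trans hI')
    rw [setIntegral_Ioo_eq_of_tsupport (hd3.trans hI), ← setIntegral_Ioo_eq_of_tsupport hd3,
      setIntegral_Ioo_eq_of_tsupport (h3.trans hI)] at ex
    rw [setIntegral_Ioo_eq_of_tsupport (hd3.trans hI'), ← setIntegral_Ioo_eq_of_tsupport hd3,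
      setIntegral_Ioo_eq_of_tsupport (h3.trans hI')] at ey
    have e : ∫ t in Ioo c d, deriv ψ t • x.1.fst t = ∫ t in Ioo c d, deriv ψ t • y.1.fst t := by
      refine integral_congr_ae ?_
      filter_upwards [h] with t ht
      exact congrArg (deriv ψ t • ·) ht
    rw [ex, ey, neg_inj] at e
    rw [← setIntegral_Ioo_eq_of_tsupport h3] at e ⊢
    rw [← setIntegral_Ioo_eq_of_tsupport h3] at e
    obtain ⟨C, hC⟩ := h1.continuous.bounded_above_of_compact_support h2
    simp only [smul_sub]
    refine (integral_sub (iX.bdd_smul C h1.continuous.aestronglyMeasurable (Eventually.of_forall hC))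
      (iY.bdd_smul C h1.continuous.aestronglyMeasurable (Eventually.of_forall hC))).trans
      (sub_eq_zero.2 e)

/-- A Sobolev function is determined by its values. -/
theorem H1.ext_val {a b : ℝ} {x y : H1 a b n}
    (h : H1.val x =ᵐ[volume.restrict (Ioo a b)] H1.val y) : x = y :=
  H1.ext_ae h (dot_ae_eq_of_val_ae_eq le_rfl le_rfl le_rfl le_rfl h)

theorem val_sub_ae {a b : ℝ} (x y : H1 a b n) :
    H1.val (x - y) =ᵐ[volume.restrict (Ioo a b)] fun t => H1.val x t - H1.val y t :=
  Lp.coeFn_sub x.1.fst y.1.fst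

/-- Every Sobolev function is the primitive of its weak derivative. -/
theorem exists_eq_primH1 {a b : ℝ} (c : ℝ) (x : H1 a b n) :
    ∃ x0 : Vec n, x = primH1 a b c (x0, extZero a b x.1.snd) := by
  set y := primH1 a b c ((0 : Vec n), extZero a b x.1.snd) with hy
  have hsnd : (x - y).1.snd = 0 := by
    have : y.1.snd = x.1.snd :=
      Lp.ext ((primH1_dot_ae a b c _).trans (extZero_ae_restrict a b x.1.snd))
    change x.1.snd - y.1.snd = 0
    rw [this, sub_self]
  have hw : IsWeakDeriv (x - y).1.fst 0 := hsnd ▸ (x - y).2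
  obtain ⟨x0, hx0⟩ := ae_eq_const_of_isWeakDeriv_zero hw
  refine ⟨x0, H1.ext_val ?_⟩
  filter_upwards [hx0, val_sub_ae x y, primH1_val_ae a b c ((0 : Vec n), extZero a b x.1.snd),
    primH1_val_ae a b c (x0, extZero a b x.1.snd)] with t h1 h2 h3 h4
  have h5 : H1.val (x - y) t = x0 := h1
  rw [h2, h3, zero_add, sub_eq_iff_eq_add] at h5
  rw [h4, h5]

/-! ### The delay operators -/

/-- Translation by `τ` on `L²(ℝ; ℝⁿ)`. -/
def shiftL (τ : ℝ) : LR n →ₗᵢ[ℝ] LR n :=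
  Lp.compMeasurePreservingₗᵢ ℝ (fun t => t - τ) (measurePreserving_sub_right volume τ)

theorem shiftL_ae (τ : ℝ) (w : LR n) : shiftL τ w =ᵐ[volume] fun t => w (t - τ) :=
  Lp.coeFn_compMeasurePreserving w (measurePreserving_sub_right volume τ)

theorem continuous_shiftL (w : LR n) : Continuous fun τ : ℝ => shiftL τ w := by
  let G : ℝ → C(ℝ, ℝ) := fun τ => ⟨fun t => t - τ, by fun_prop⟩
  have hG : Continuous G := ContinuousMap.continuous_of_continuous_uncurry _ (by
    change Continuous fun p : ℝ × ℝ => p.2 - p.1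
    fun_prop)
  exact Continuous.compMeasurePreservingLp (continuous_const (y := w)) hG
    (fun τ => measurePreserving_sub_right volume τ) (by norm_num)

/-- The map `u ↦ u(· - τ)` from `L²(-b, T; ℝⁿ)` to `L²(0, T; ℝⁿ)`, meaningful for
`0 ≤ τ ≤ b`. -/
def delayL (b T τ : ℝ) : L2 (-b) T n →L[ℝ] L2 0 T n :=
  resL 0 T ∘L (shiftL τ).toContinuousLinearMap ∘L (extZero (-b) T).toContinuousLinearMap

theorem delayL_apply (b T τ : ℝ) (u : L2 (-b) T n) :
    delayL b T τ u = resL 0 T (shiftL τ (extZero (-b) T u)) := rfl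

theorem norm_delayL_le (b T τ : ℝ) (u : L2 (-b) T n) : ‖delayL b T τ u‖ ≤ ‖u‖ := by
  rw [delayL_apply]
  refine (norm_resL_le _ _ _).trans ?_
  rw [LinearIsometry.norm_map, LinearIsometry.norm_map]

theorem delayL_ae {b T τ : ℝ} (h0 : 0 ≤ τ) (hb : τ ≤ b) (u : L2 (-b) T n) :
    delayL b T τ u =ᵐ[volume.restrict (Ioo 0 T)] fun t => u (t - τ) := by
  have h1 := ae_Ioo_shift (c := 0) (d := T) (s := -τ) (extZero_ae_restrict (-b) T u)
    (by linarith) (by linarith)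
  filter_upwards [resL_ae 0 T (shiftL τ (extZero (-b) T u)),
    ae_restrict_of_ae (shiftL_ae τ (extZero (-b) T u)), h1] with t h2 h3 h4
  rw [delayL_apply, h2, h3, sub_eq_add_neg, h4]

theorem continuous_delayL (b T : ℝ) (u : L2 (-b) T n) : Continuous fun τ => delayL b T τ u :=
  (resL 0 T).continuous.comp (continuous_shiftL _)

/-- The Cauchy–Schwarz inequality for `∫ 1 · F`. -/
theorem sq_lintegral_le {μ : Measure ℝ} {F : ℝ → ENNReal} (hF : AEMeasurable F μ) :
    (∫⁻ s, F s ∂μ) ^ 2 ≤ μ univ * ∫⁻ s, F s ^ 2 ∂μ := by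
  have h := ENNReal.lintegral_mul_le_Lp_mul_Lq μ (p := 2) (q := 2) (by constructor <;> norm_num)
    (f := fun _ => 1) (g := F) aemeasurable_const hF
  simp only [Pi.mul_apply, one_mul, ENNReal.rpow_ofNat, one_pow, lintegral_one] at h
  calc (∫⁻ s, F s ∂μ) ^ 2 ≤ (μ univ ^ (1 / 2 : ℝ) * (∫⁻ s, F s ^ 2 ∂μ) ^ (1 / 2 : ℝ)) ^ 2 := by
        gcongr
    _ = μ univ * ∫⁻ s, F s ^ 2 ∂μ := by
        rw [mul_pow, ← ENNReal.rpow_natCast, ← ENNReal.rpow_mul, ← ENNReal.rpow_natCast,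
          ← ENNReal.rpow_mul]
        norm_num

theorem lintegral_enorm_sq {μ : Measure ℝ} (w : Lp (Vec n) 2 μ) :
    ∫⁻ t, ‖w t‖ₑ ^ 2 ∂μ = ‖w‖ₑ ^ 2 := by
  rw [Lp.enorm_def, eLpNorm_eq_lintegral_rpow_enorm_toReal (by norm_num) (by norm_num),
    ← ENNReal.rpow_natCast, ← ENNReal.rpow_mul]
  norm_num

/-- The error in the first order expansion of a primitive of `w` is controlled in the mean square
by the modulus of continuity of the translates of `w`. -/
theorem lintegral_primitive_expansion_le (w : LR n) {h : ℝ} {δ : ENNReal}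
    (hδ : ∀ s ∈ Set.uIoc 0 h, ‖shiftL s w - w‖ₑ ≤ δ) :
    ∫⁻ t, ‖(∫ s in t..(t - h), w s) + h • w t‖ₑ ^ 2 ≤ (‖h‖ₑ * δ) ^ 2 := by
  have hwm : Measurable (w : ℝ → Vec n) := (Lp.stronglyMeasurable w).measurable
  have hm : Measurable fun p : ℝ × ℝ => ‖w (p.1 - p.2) - w p.1‖ₑ :=
    ((hwm.comp (measurable_fst.sub measurable_snd)).sub (hwm.comp measurable_fst)).enorm
  have hpt : ∀ t, (∫ s in t..(t - h), w s) + h • w t = -∫ s in (0 : ℝ)..h, (w (t - s) - w t) := by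
    intro t
    have i1 : IntervalIntegrable (fun s => w (t - s)) volume 0 h := by
      simpa using (LR_intervalIntegrable w (t - 0) (t - h)).comp_sub_left t
    rw [intervalIntegral.integral_sub i1 intervalIntegrable_const,
      intervalIntegral.integral_comp_sub_left (fun s => w s) t, sub_zero,
      intervalIntegral.integral_const, sub_zero, neg_sub, intervalIntegral.integral_symm,
      sub_eq_add_neg, add_comm, sub_eq_add_neg (h • w t)]
  have hvol : (volume.restrict (Set.uIoc 0 h)) univ = ‖h‖ₑ := by
    rw [Measure.restrict_apply_univ, uIoc, Real.volume_Ioc, max_sub_min_eq_abs, sub_zero,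
      Real.enorm_eq_ofReal_abs]
  calc ∫⁻ t, ‖(∫ s in t..(t - h), w s) + h • w t‖ₑ ^ 2
      ≤ ∫⁻ t, ‖h‖ₑ * ∫⁻ s in Set.uIoc 0 h, ‖w (t - s) - w t‖ₑ ^ 2 := by
        refine lintegral_mono fun t => ?_
        rw [hpt t, enorm_neg]
        have e : ‖∫ s in (0 : ℝ)..h, (w (t - s) - w t)‖ₑ ≤
            ∫⁻ s in Set.uIoc 0 h, ‖w (t - s) - w t‖ₑ := by
          rw [← ofReal_norm, intervalIntegral.norm_intervalIntegral_eq, ofReal_norm]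
          exact enorm_integral_le_lintegral_enorm _
        refine (pow_le_pow_left' e 2).trans ?_
        refine (sq_lintegral_le (hm.comp measurable_prodMk_left).aemeasurable).trans ?_
        rw [hvol]
        rfl
    _ = ‖h‖ₑ * ∫⁻ s in Set.uIoc 0 h, ∫⁻ t, ‖w (t - s) - w t‖ₑ ^ 2 := by
        rw [lintegral_const_mul' _ _ enorm_ne_top]
        rw [lintegral_lintegral_swap]
        exact (hm.pow_const 2).aemeasurable
    _ ≤ ‖h‖ₑ * ∫⁻ s in Set.uIoc 0 h, δ ^ 2 := by
        gcongr ‖h‖ₑ * ?_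
        refine setLIntegral_mono measurable_const fun s hs => ?_
        have e : ∫⁻ t, ‖w (t - s) - w t‖ₑ ^ 2 = ‖shiftL s w - w‖ₑ ^ 2 := by
          rw [← lintegral_enorm_sq]
          refine lintegral_congr_ae ?_
          filter_upwards [shiftL_ae s w, Lp.coeFn_sub (shiftL s w) w] with t h1 h2
          rw [h2, Pi.sub_apply, h1]
        rw [e]
        exact pow_le_pow_left' (hδ s hs) 2
    _ = (‖h‖ₑ * δ) ^ 2 := by
        rw [lintegral_const, hvol]
        ring

/-- The function underlying a Sobolev function, as an element of `L²`. -/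
def fstL (a b : ℝ) : H1 a b n →L[ℝ] L2 a b n :=
  ContinuousLinearMap.fst ℝ (L2 a b n) (L2 a b n) ∘L
    (WithLp.prodContinuousLinearEquiv 2 ℝ (L2 a b n) (L2 a b n)).toContinuousLinearMap ∘L
      (H1 a b n).subtypeL

/-- The weak derivative of a Sobolev function, as an element of `L²`. -/
def sndL (a b : ℝ) : H1 a b n →L[ℝ] L2 a b n :=
  ContinuousLinearMap.snd ℝ (L2 a b n) (L2 a b n) ∘L
    (WithLp.prodContinuousLinearEquiv 2 ℝ (L2 a b n) (L2 a b n)).toContinuousLinearMap ∘L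
      (H1 a b n).subtypeL

theorem sndL_apply {a b : ℝ} (x : H1 a b n) : sndL a b x = x.1.snd := rfl

theorem norm_sndL_le {a b : ℝ} (x : H1 a b n) : ‖sndL a b x‖ ≤ ‖x‖ := by
  have h := WithLp.prod_norm_sq_eq_of_L2 x.1
  refine le_of_sq_le_sq ?_ (norm_nonneg _)
  rw [Submodule.coe_norm, h, sndL_apply]
  linarith [sq_nonneg ‖x.1.fst‖]

/-- The first order expansion in the delay of a delayed Sobolev function; the error is controlled by
the modulus of continuity of the translates of the weak derivative. -/
theorem delayL_fst_expansion {b T τ τ₀ : ℝ} (h0 : 0 ≤ τ) (hb : τ ≤ b) (h0' : 0 ≤ τ₀) (hb' : τ₀ ≤ b)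
    (x : H1 (-b) T n) {δ : ℝ} (hδ0 : 0 ≤ δ)
    (hδ : ∀ s ∈ Set.uIoc 0 (τ - τ₀),
      ‖shiftL s (extZero (-b) T (sndL (-b) T x)) - extZero (-b) T (sndL (-b) T x)‖ ≤ δ) :
    ‖delayL b T τ (fstL (-b) T x) - delayL b T τ₀ (fstL (-b) T x) +
      (τ - τ₀) • delayL b T τ₀ (sndL (-b) T x)‖ ≤ |τ - τ₀| * δ := by
  obtain ⟨x0, hx0⟩ := exists_eq_primH1 0 x
  set w := extZero (-b) T (sndL (-b) T x) with hw
  set z := delayL b T τ (fstL (-b) T x) - delayL b T τ₀ (fstL (-b) T x) +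
      (τ - τ₀) • delayL b T τ₀ (sndL (-b) T x) with hz
  have hval : H1.val x =ᵐ[volume.restrict (Ioo (-b) T)] fun t => x0 + ∫ s in (0 : ℝ)..t, w s := by
    have := primH1_val_ae (-b) T 0 (x0, extZero (-b) T x.1.snd)
    rw [← hx0] at this
    exact this
  have hdelay : ∀ σ, 0 ≤ σ → σ ≤ b → delayL b T σ (fstL (-b) T x)
      =ᵐ[volume.restrict (Ioo 0 T)] fun t => x0 + ∫ s in (0 : ℝ)..(t - σ), w s := by
    intro σ hσ hσb
    filter_upwards [delayL_ae hσ hσb (fstL (-b) T x), ae_Ioo_shift (c := 0) (d := T) (s := -σ)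
      hval (by linarith) (by linarith)] with t h1 h2
    rw [h1, sub_eq_add_neg, ← h2]
    rfl
  have hdot : delayL b T τ₀ (sndL (-b) T x) =ᵐ[volume.restrict (Ioo 0 T)] fun t => w (t - τ₀) := by
    filter_upwards [delayL_ae h0' hb' (sndL (-b) T x), ae_Ioo_shift (c := 0) (d := T) (s := -τ₀)
      (extZero_ae_restrict (-b) T (sndL (-b) T x)) (by linarith) (by linarith)] with t h1 h2
    rw [h1, sub_eq_add_neg, ← h2]
  have hzae : z =ᵐ[volume.restrict (Ioo 0 T)] fun t =>
      (∫ s in (t - τ₀)..(t - τ₀ - (τ - τ₀)), w s) + (τ - τ₀) • w (t - τ₀) := by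
    filter_upwards [Lp.coeFn_add (delayL b T τ (fstL (-b) T x) - delayL b T τ₀ (fstL (-b) T x))
      ((τ - τ₀) • delayL b T τ₀ (sndL (-b) T x)),
      Lp.coeFn_sub (delayL b T τ (fstL (-b) T x)) (delayL b T τ₀ (fstL (-b) T x)),
      Lp.coeFn_smul (τ - τ₀) (delayL b T τ₀ (sndL (-b) T x)), hdelay τ h0 hb, hdelay τ₀ h0' hb',
      hdot] with t h1 h2 h3 h4 h5 h6
    rw [hz, h1, Pi.add_apply, h2, Pi.sub_apply, h3, Pi.smul_apply, h4, h5, h6,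
      add_sub_add_left_eq_sub, sub_sub_sub_cancel_right,
      intervalIntegral.integral_interval_sub_left (LR_intervalIntegrable w _ _)
        (LR_intervalIntegrable w _ _)]
  have hsq : ‖z‖ₑ ^ 2 ≤ (‖τ - τ₀‖ₑ * ENNReal.ofReal δ) ^ 2 := by
    rw [← lintegral_enorm_sq]
    calc ∫⁻ t in Ioo 0 T, ‖z t‖ₑ ^ 2
        = ∫⁻ t in Ioo 0 T, ‖(∫ s in (t - τ₀)..(t - τ₀ - (τ - τ₀)), w s) +
            (τ - τ₀) • w (t - τ₀)‖ₑ ^ 2 := by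
          refine lintegral_congr_ae ?_
          filter_upwards [hzae] with t ht
          rw [ht]
      _ ≤ ∫⁻ t, ‖(∫ s in (t - τ₀)..(t - τ₀ - (τ - τ₀)), w s) +
            (τ - τ₀) • w (t - τ₀)‖ₑ ^ 2 := setLIntegral_le_lintegral _ _
      _ = ∫⁻ t, ‖(∫ s in t..(t - (τ - τ₀)), w s) + (τ - τ₀) • w t‖ₑ ^ 2 :=
          lintegral_sub_right_eq_self
            (fun t => ‖(∫ s in t..(t - (τ - τ₀)), w s) + (τ - τ₀) • w t‖ₑ ^ 2) τ₀
      _ ≤ _ := lintegral_primitive_expansion_le w fun s hs => by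
          rw [← ofReal_norm]
          exact ENNReal.ofReal_le_ofReal (hδ s hs)
  have hle : ‖z‖ₑ ≤ ‖τ - τ₀‖ₑ * ENNReal.ofReal δ :=
    (ENNReal.pow_le_pow_left_iff two_ne_zero).1 hsq
  rw [← ofReal_norm, ← ofReal_norm, ← ENNReal.ofReal_mul (norm_nonneg _)] at hle
  exact (ENNReal.ofReal_le_ofReal_iff (by positivity)).1 hle

/-- Delaying a Sobolev function is Lipschitz in the delay, as a map into `L²`. -/
theorem norm_delayL_sub_le {b T τ τ₀ : ℝ} (hτ : τ ∈ Ico 0 b) (hτ₀ : τ₀ ∈ Ico 0 b)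
    (x : H1 (-b) T n) :
    ‖delayL b T τ (fstL (-b) T x) - delayL b T τ₀ (fstL (-b) T x)‖ ≤ 3 * |τ - τ₀| * ‖x‖ := by
  -- translations are isometries, so `2 ‖x‖` is a trivial modulus of continuity
  have h := delayL_fst_expansion hτ.1 hτ.2.le hτ₀.1 hτ₀.2.le x (δ := 2 * ‖x‖) (by positivity)
    fun s _ => by
      refine (norm_sub_le _ _).trans ?_
      rw [LinearIsometry.norm_map, LinearIsometry.norm_map]
      linarith [norm_sndL_le x]
  have h2 : ‖(τ - τ₀) • delayL b T τ₀ (sndL (-b) T x)‖ ≤ |τ - τ₀| * ‖x‖ := by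
    rw [norm_smul, Real.norm_eq_abs]
    gcongr
    exact (norm_delayL_le _ _ _ _).trans (norm_sndL_le x)
  have h3 := norm_sub_le (delayL b T τ (fstL (-b) T x) - delayL b T τ₀ (fstL (-b) T x) +
      (τ - τ₀) • delayL b T τ₀ (sndL (-b) T x)) ((τ - τ₀) • delayL b T τ₀ (sndL (-b) T x))
  rw [add_sub_cancel_right] at h3
  linarith

/-- The derivative of the delayed Sobolev function `x(· - τ)` with respect to `τ`. -/
theorem hasDerivWithinAt_delayL {b T τ₀ : ℝ} (hτ₀ : τ₀ ∈ Ico 0 b) (x : H1 (-b) T n) :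
    HasDerivWithinAt (fun τ => delayL b T τ (fstL (-b) T x))
      (-delayL b T τ₀ (sndL (-b) T x)) (Ico 0 b) τ₀ := by
  rw [hasDerivWithinAt_iff_isLittleO, Asymptotics.isLittleO_iff]
  intro ε hε
  set w := extZero (-b) T (sndL (-b) T x)
  have hc : Tendsto (fun s => ‖shiftL s w - w‖) (𝓝 0) (𝓝 0) := by
    have h := ((continuous_shiftL w).sub (continuous_const (y := w))).norm.tendsto (0 : ℝ)
    have h0 : shiftL 0 w = w := Lp.ext ((shiftL_ae 0 w).trans (by simp))
    simpa [h0] using h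
  obtain ⟨r, hr, hrs⟩ := Metric.eventually_nhds_iff.1 (hc.eventually_le_const hε)
  filter_upwards [inter_mem_nhdsWithin _ (Metric.ball_mem_nhds τ₀ hr)] with τ hτ
  have h := delayL_fst_expansion hτ.1.1 hτ.1.2.le hτ₀.1 hτ₀.2.le x hε.le fun s hs => by
    refine hrs ?_
    have hd : |τ - τ₀| < r := by simpa [Real.dist_eq] using hτ.2
    rw [Real.dist_eq, sub_zero]
    rcases mem_uIoc.1 hs with h | h <;> rw [abs_lt] at hd ⊢ <;> constructor <;> linarith
  rw [smul_neg, sub_neg_eq_add, Real.norm_eq_abs, mul_comm]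
  exact h

/-! ### Composition operators on continuous functions -/

/-- The composition operator `x ↦ H ∘ x` on `C(K, W)`. -/
def compOp {K W F : Type*} [TopologicalSpace K] [TopologicalSpace W] [TopologicalSpace F]
    {H : W → F} (hH : Continuous H) (x : C(K, W)) : C(K, F) :=
  (⟨H, hH⟩ : C(W, F)).comp x

@[simp] theorem compOp_apply {K W F : Type*} [TopologicalSpace K] [TopologicalSpace W]
    [TopologicalSpace F] {H : W → F} (hH : Continuous H) (x : C(K, W)) (t : K) :
    compOp hH x t = H (x t) := rfl

theorem continuous_compOp {K W F : Type*} [TopologicalSpace K] [TopologicalSpace W]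
    [TopologicalSpace F] {H : W → F} (hH : Continuous H) :
    Continuous (compOp hH : C(K, W) → C(K, F)) :=
  ContinuousMap.continuous_postcomp _

section Composition

variable {K W F : Type*} [TopologicalSpace K] [CompactSpace K]
  [NormedAddCommGroup W] [NormedSpace ℝ W] [NormedAddCommGroup F] [NormedSpace ℝ F]

/-- Pointwise application of a continuous family of linear maps. -/
def pointwiseL (L : C(K, W →L[ℝ] F)) : C(K, W) →L[ℝ] C(K, F) :=
  LinearMap.mkContinuous
    { toFun z := ⟨fun t => L t (z t), by fun_prop⟩
      map_add' z z' := by ext t; simp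
      map_smul' c z := by ext t; simp }
    ‖L‖ fun z => by
      refine (ContinuousMap.norm_le _ (by positivity)).2 fun t => ?_
      exact ((L t).le_opNorm _).trans (mul_le_mul (L.norm_coe_le_norm t) (z.norm_coe_le_norm t)
        (norm_nonneg _) (norm_nonneg L))

/-- The derivative of the composition operator of a `C¹` function. -/
def compDeriv {H : W → F} (hH : ContDiff ℝ 1 H) (x : C(K, W)) : C(K, W) →L[ℝ] C(K, F) :=
  pointwiseL (compOp (hH.continuous_fderiv one_ne_zero) x)

@[simp] theorem compDeriv_apply {H : W → F} (hH : ContDiff ℝ 1 H) (x z : C(K, W)) (t : K) :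
    compDeriv hH x z t = fderiv ℝ H (x t) (z t) := rfl

theorem hasFDerivAt_compOp {H : W → F} (hH : ContDiff ℝ 1 H) (x : C(K, W)) :
    HasFDerivAt (compOp hH.continuous : C(K, W) → C(K, F)) (compDeriv hH x) x := by
  rw [hasFDerivAt_iff_isLittleO, Asymptotics.isLittleO_iff]
  intro ε hε
  have hcD := hH.continuous_fderiv one_ne_zero
  have hu := (isCompact_range x.continuous).uniformContinuousAt_of_continuousAt
    (fderiv ℝ H) (fun y _ => hcD.continuousAt) (Metric.dist_mem_uniformity hε)
  obtain ⟨δ, hδ, hsub⟩ := Metric.mem_uniformity_dist.1 hu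
  filter_upwards [Metric.ball_mem_nhds x hδ] with y hy
  refine (ContinuousMap.norm_le _ (by positivity)).2 fun t => ?_
  have hyt : y t ∈ Metric.ball (x t) δ :=
    (ContinuousMap.dist_apply_le_dist t).trans_lt hy
  have h := (convex_ball (x t) δ).norm_image_sub_le_of_norm_hasFDerivWithin_le'
    (f := H) (f' := fderiv ℝ H) (φ := fderiv ℝ H (x t)) (C := ε)
    (fun z _ => (hH.differentiable one_ne_zero z).hasFDerivAt.hasFDerivWithinAt)
    (fun z hz => by
      have := hsub (a := x t) (b := z) (by rw [dist_comm]; exact hz) (mem_range_self t)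
      have h2 : dist (fderiv ℝ H (x t)) (fderiv ℝ H z) < ε := this
      rw [dist_comm, dist_eq_norm] at h2
      exact h2.le) (Metric.mem_ball_self hδ) hyt
  refine h.trans ?_
  gcongr
  exact (y - x).norm_coe_le_norm t

end Composition

/-! ### Primitives as continuous functions -/

theorem integral_extZero_add {a b : ℝ} (u v : L2 a b n) (s t : ℝ) :
    ∫ r in s..t, extZero a b (u + v) r =
      (∫ r in s..t, extZero a b u r) + ∫ r in s..t, extZero a b v r := by
  rw [map_add, integral_LR_add]

theorem integral_extZero_smul {a b : ℝ} (c : ℝ) (u : L2 a b n) (s t : ℝ) :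
    ∫ r in s..t, extZero a b (c • u) r = c • ∫ r in s..t, extZero a b u r := by
  rw [map_smul, integral_LR_smul]

/-- The primitive `t ↦ ∫_0^t v` on `[0, T]`. -/
def primC (T : ℝ) : L2 0 T n →L[ℝ] C(Icc 0 T, Vec n) :=
  LinearMap.mkContinuous
    { toFun v := ⟨fun t => ∫ r in (0 : ℝ)..t, extZero 0 T v r,
        (continuous_primitive _ 0).comp continuous_subtype_val⟩
      map_add' u v := by ext1 t; exact integral_extZero_add u v 0 t
      map_smul' c v := by ext1 t; exact integral_extZero_smul c v 0 t }
    √T fun v => by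
      refine (ContinuousMap.norm_le _ (by positivity)).2 fun t => ?_
      refine (norm_integral_le _ _ _).trans ?_
      rw [LinearIsometry.norm_map]
      gcongr
      rw [sub_zero, abs_of_nonneg t.2.1]
      exact t.2.2

theorem primC_apply (T : ℝ) (v : L2 0 T n) (t : Icc 0 T) :
    primC T v t = ∫ r in (0 : ℝ)..t, extZero 0 T v r := rfl

/-- Time reversal `t ↦ T - t` of the interval `[0, T]`. -/
def revIcc (T : ℝ) : C(Icc 0 T, Icc 0 T) :=
  ⟨fun t => ⟨T - t, by linarith [t.2.2], by linarith [t.2.1]⟩, by fun_prop⟩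

/-- Composition with time reversal. -/
def revC (T : ℝ) : C(Icc 0 T, Vec n) →L[ℝ] C(Icc 0 T, Vec n) :=
  LinearMap.mkContinuous
    { toFun x := x.comp (revIcc T)
      map_add' x y := rfl
      map_smul' c x := rfl }
    1 fun x => by
      rw [one_mul]
      exact (ContinuousMap.norm_le _ (norm_nonneg _)).2 fun t => x.norm_coe_le_norm _

theorem revC_apply {T : ℝ} (x : C(Icc 0 T, Vec n)) (t : Icc 0 T) :
    revC T x t = x (revIcc T t) := rfl

/-- A continuous function on `[0, T]` as an element of `L²(0, T; ℝⁿ)`. -/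
def toL2 {T : ℝ} (hT : 0 ≤ T) : C(Icc 0 T, Vec n) →L[ℝ] L2 0 T n :=
  LinearMap.mkContinuousOfExistsBound
    { toFun x := MemLp.toLp (fun t => x (projIcc 0 T hT t))
        (MemLp.of_bound (x.continuous.comp continuous_projIcc).aestronglyMeasurable ‖x‖
          (Eventually.of_forall fun _ => x.norm_coe_le_norm _))
      map_add' x y := rfl
      map_smul' c x := rfl }
    ⟨_, fun x => by
      refine Lp.norm_le_of_ae_bound (norm_nonneg x) ?_
      filter_upwards [MemLp.coeFn_toLp
        (MemLp.of_bound (μ := volume.restrict (Ioo 0 T)) (p := 2)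
          (x.continuous.comp (continuous_projIcc (h := hT))).aestronglyMeasurable ‖x‖
          (Eventually.of_forall fun _ => x.norm_coe_le_norm _))] with t ht
      exact (congrArg norm ht).trans_le (x.norm_coe_le_norm _)⟩

theorem toL2_ae {T : ℝ} (hT : 0 ≤ T) (x : C(Icc 0 T, Vec n)) :
    toL2 hT x =ᵐ[volume.restrict (Ioo 0 T)] fun t => x (projIcc 0 T hT t) :=
  MemLp.coeFn_toLp (MemLp.of_bound (μ := volume.restrict (Ioo 0 T)) (p := 2)
          (x.continuous.comp (continuous_projIcc (h := hT))).aestronglyMeasurable ‖x‖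
          (Eventually.of_forall fun _ => x.norm_coe_le_norm _))

/-! ### Causal Lipschitz maps and their fixed points -/

/-- A map `Φ` of `L²(0, T; ℝⁿ)` is causal Lipschitz with constant `C` if an exponential bound for
the primitive of `v - w` yields the same bound, up to the factor `C`, for `Φ v - Φ w`. -/
def IsCausalLip (T C : ℝ) (Φ : L2 0 T n → L2 0 T n) : Prop :=
  ∀ (v w : L2 0 T n) (κ B : ℝ), 0 ≤ κ → 0 ≤ B →
    (∀ s : Icc 0 T, ‖primC T (v - w) s‖ ≤ B * Real.exp (κ * s)) →
    ∀ᵐ t ∂volume.restrict (Ioo 0 T), ‖Φ v t - Φ w t‖ ≤ C * (B * Real.exp (κ * t))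

theorem memLp_exp_smul {T : ℝ} (κ : ℝ) (v : L2 0 T n) :
    MemLp (fun t => Real.exp (κ * t) • v t) 2 (volume.restrict (Ioo 0 T)) := by
  refine MemLp.of_le_mul (c := Real.exp (|κ| * T)) (Lp.memLp v)
    ((by fun_prop : Continuous fun t => Real.exp (κ * t)).aestronglyMeasurable.smul
      (Lp.aestronglyMeasurable v)) ?_
  filter_upwards [ae_restrict_mem measurableSet_Ioo] with t ht
  rw [norm_smul, Real.norm_eq_abs, Real.abs_exp]
  refine mul_le_mul_of_nonneg_right (Real.exp_le_exp.2 ?_) (norm_nonneg _)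
  exact (mul_le_mul_of_nonneg_right (le_abs_self κ) ht.1.le).trans
    (mul_le_mul_of_nonneg_left ht.2.le (abs_nonneg κ))

/-- Multiplication by `t ↦ exp (κ t)` on `L²(0, T; ℝⁿ)`. -/
def expMul (T κ : ℝ) : L2 0 T n →ₗ[ℝ] L2 0 T n where
  toFun v := MemLp.toLp _ (memLp_exp_smul κ v)
  map_add' u v := by
    rw [← MemLp.toLp_add, MemLp.toLp_eq_toLp_iff]
    filter_upwards [Lp.coeFn_add u v] with t ht
    rw [ht, Pi.add_apply, Pi.add_apply, smul_add]
  map_smul' c v := by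
    rw [← MemLp.toLp_const_smul, MemLp.toLp_eq_toLp_iff, RingHom.id_apply]
    filter_upwards [Lp.coeFn_smul c v] with t ht
    rw [ht, Pi.smul_apply, Pi.smul_apply, smul_comm]

theorem expMul_ae (T κ : ℝ) (v : L2 0 T n) :
    expMul T κ v =ᵐ[volume.restrict (Ioo 0 T)] fun t => Real.exp (κ * t) • v t :=
  MemLp.coeFn_toLp (memLp_exp_smul κ v)

theorem expMul_expMul (T κ : ℝ) (v : L2 0 T n) : expMul T κ (expMul T (-κ) v) = v := by
  ext1
  filter_upwards [expMul_ae T κ (expMul T (-κ) v), expMul_ae T (-κ) v] with t h1 h2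
  rw [h1, h2, smul_smul, ← Real.exp_add]
  simp

theorem norm_expMul_le {T κ C : ℝ} (v : L2 0 T n)
    (hC : ∀ t ∈ Ioo 0 T, Real.exp (κ * t) ≤ C) : ‖expMul T κ v‖ ≤ C * ‖v‖ := by
  refine Lp.norm_le_mul_norm_of_ae_le_mul ?_
  filter_upwards [ae_restrict_mem measurableSet_Ioo, expMul_ae T κ v] with t ht h
  rw [h, norm_smul, Real.norm_eq_abs, Real.abs_exp]
  gcongr
  exact hC t ht

/-- A bound of `v` in the weighted norm yields an exponential bound for its primitive, with a small
constant if the exponent is large. -/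
theorem norm_primC_le_exp {T κ : ℝ} (hκ : 0 < κ) (v : L2 0 T n) (s : Icc 0 T) :
    ‖primC T v s‖ ≤ ‖expMul T (-κ) v‖ / √(2 * κ) * Real.exp (κ * s) := by
  have h := norm_integral_smul_le (extZero 0 T (expMul T (-κ) v)) (ρ := fun r => Real.exp (κ * r))
    (by fun_prop) s.2.1
  have e : ∫ r in (0 : ℝ)..s, Real.exp (κ * r) • extZero 0 T (expMul T (-κ) v) r =
      primC T v s := by
    refine intervalIntegral.integral_congr_ae ?_
    have h2 := (ae_restrict_iff' measurableSet_Ioo).1 (expMul_ae T (-κ) v)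
    filter_upwards [h2, extZero_ae 0 T (expMul T (-κ) v), extZero_ae 0 T v] with t ht h3 h4 _
    rw [h3, h4]
    by_cases htt : t ∈ Ioo 0 T
    · rw [indicator_of_mem htt, indicator_of_mem htt, ht htt, smul_smul, ← Real.exp_add]
      simp
    · rw [indicator_of_notMem htt, indicator_of_notMem htt, smul_zero]
  rw [e, LinearIsometry.norm_map] at h
  have hint : ∫ r in (0 : ℝ)..s, Real.exp (κ * r) ^ 2 ≤ Real.exp (κ * s) ^ 2 / (2 * κ) := by
    have : ∀ r, Real.exp (κ * r) ^ 2 = Real.exp ((2 * κ) * r) := fun r => by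
      rw [← Real.exp_nat_mul]; congr 1; push_cast; ring
    simp only [this]
    rw [intervalIntegral.integral_comp_mul_left (fun r => Real.exp r) (by positivity),
      integral_exp, smul_eq_mul, mul_zero, Real.exp_zero, inv_mul_eq_div]
    gcongr
    linarith
  calc ‖primC T v s‖ ≤ _ := h
    _ ≤ √(Real.exp (κ * s) ^ 2 / (2 * κ)) * ‖expMul T (-κ) v‖ := by gcongr
    _ = _ := by
        rw [Real.sqrt_div (sq_nonneg _), Real.sqrt_sq (Real.exp_pos _).le]
        ring

/-- Causal Lipschitz maps are contractions in an exponentially weighted norm. Hence they have a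
fixed point, and `v - Φ v` controls `v`, with a constant depending on `T` and `C` only. -/
theorem exists_causal_bound (n : ℕ) (T C : ℝ) :
    ∃ M : ℝ, 0 ≤ M ∧ ∀ Φ : L2 0 T n → L2 0 T n, IsCausalLip T C Φ →
      (∃ v, Φ v = v) ∧ ∀ v w, ‖v - w‖ ≤ M * ‖(v - Φ v) - (w - Φ w)‖ := by
  -- `m` is the norm of the embedding of bounded functions into `L²(0, T)`
  set m : ℝ := (measureUnivNNReal (volume.restrict (Ioo 0 T)) : ℝ) ^ (2 : ENNReal).toReal⁻¹ with hm
  have hm0 : 0 ≤ m := by positivity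
  -- the exponent makes the contraction factor `m C / √(2 κ)` at most `1 / 2`
  set κ : ℝ := 2 * (m * C) ^ 2 + 1 with hκ
  have hκ0 : 0 < κ := by positivity
  have hκ2 : m * (C / √(2 * κ)) ≤ 1 / 2 := by
    rw [← mul_div_assoc, div_le_iff₀ (by positivity)]
    have : 2 * (m * C) ≤ √(2 * κ) := by
      refine Real.le_sqrt_of_sq_le ?_
      rw [hκ]; nlinarith [sq_nonneg (m * C)]
    linarith
  have hcontr : ∀ Φ : L2 0 T n → L2 0 T n, IsCausalLip T C Φ → ∀ v w,
      ‖expMul T (-κ) (Φ v - Φ w)‖ ≤ 1 / 2 * ‖expMul T (-κ) (v - w)‖ := by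
    intro Φ hΦ v w
    set B := ‖expMul T (-κ) (v - w)‖ / √(2 * κ) with hB
    have hB0 : 0 ≤ B := by positivity
    have h := hΦ v w κ B hκ0.le hB0 (fun s => norm_primC_le_exp hκ0 (v - w) s)
    by_cases hC : 0 ≤ C
    · calc ‖expMul T (-κ) (Φ v - Φ w)‖ ≤ m * (C * B) := by
            refine Lp.norm_le_of_ae_bound (by positivity) ?_
            filter_upwards [h, expMul_ae T (-κ) (Φ v - Φ w), Lp.coeFn_sub (Φ v) (Φ w)]
              with t h1 h2 h3
            rw [h2, h3, Pi.sub_apply, norm_smul, Real.norm_eq_abs, Real.abs_exp]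
            calc Real.exp (-κ * t) * ‖Φ v t - Φ w t‖
                ≤ Real.exp (-κ * t) * (C * (B * Real.exp (κ * t))) := by gcongr
              _ = C * B * (Real.exp (-κ * t) * Real.exp (κ * t)) := by ring
              _ = C * B := by rw [← Real.exp_add]; simp
        _ = m * (C / √(2 * κ)) * ‖expMul T (-κ) (v - w)‖ := by rw [hB]; ring
        _ ≤ _ := by gcongr
    -- a negative constant is only possible if `Φ` is constant
    · have hz : expMul T (-κ) (Φ v - Φ w) = 0 := by
        have hd : Φ v - Φ w = 0 := by
          ext1
          filter_upwards [h, Lp.coeFn_sub (Φ v) (Φ w),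
            Lp.coeFn_zero (Vec n) 2 (volume.restrict (Ioo 0 T))] with t h1 h3 h4
          rw [h4, h3, Pi.sub_apply, Pi.zero_apply]
          refine norm_le_zero_iff.1 (h1.trans ?_)
          exact mul_nonpos_of_nonpos_of_nonneg (not_le.1 hC).le (by positivity)
        rw [hd, map_zero]
      rw [hz, norm_zero]
      positivity
  refine ⟨2 * Real.exp (κ * T), by positivity, fun Φ hΦ => ⟨?_, fun v w => ?_⟩⟩
  · have hc : ContractingWith (1 / 2) fun u => expMul T (-κ) (Φ (expMul T κ u)) := by
      refine ⟨by norm_num, LipschitzWith.of_dist_le_mul fun u u' => ?_⟩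
      rw [dist_eq_norm, dist_eq_norm, ← map_sub]
      refine (hcontr Φ hΦ _ _).trans (le_of_eq ?_)
      rw [← map_sub]
      have := expMul_expMul T (-κ) (u - u')
      rw [neg_neg] at this
      rw [this]
      norm_num
    refine ⟨expMul T κ hc.fixedPoint, ?_⟩
    have h := hc.fixedPoint_isFixedPt
    have h2 : expMul T (-κ) (Φ (expMul T κ hc.fixedPoint)) = hc.fixedPoint := h
    conv_rhs => rw [← h2]
    rw [expMul_expMul]
  · set r := (v - Φ v) - (w - Φ w) with hr
    have h1 : expMul T (-κ) (v - w) = expMul T (-κ) r + expMul T (-κ) (Φ v - Φ w) := by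
      rw [← map_add]; congr 1; rw [hr]; abel
    have h2 := norm_add_le (expMul T (-κ) r) (expMul T (-κ) (Φ v - Φ w))
    rw [← h1] at h2
    have h3 := hcontr Φ hΦ v w
    have h4 : ‖expMul T (-κ) r‖ ≤ 1 * ‖r‖ := norm_expMul_le r fun t ht => by
      rw [Real.exp_le_one_iff]; nlinarith [ht.1]
    have h5 : ‖v - w‖ ≤ Real.exp (κ * T) * ‖expMul T (-κ) (v - w)‖ := by
      conv_lhs => rw [← expMul_expMul T κ (v - w)]
      refine norm_expMul_le _ fun t ht => ?_
      gcongr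
      exact ht.2.le
    calc ‖v - w‖ ≤ _ := h5
      _ ≤ Real.exp (κ * T) * (2 * ‖r‖) := by gcongr; linarith
      _ = _ := by ring

/-! ### Semilinear delay equations depending on a parameter -/

/-- The pairing `C(K, W) × C(K, F) → C(K, W × F)`. -/
def pairC (K W F : Type*) [TopologicalSpace K] [CompactSpace K]
    [NormedAddCommGroup W] [NormedSpace ℝ W] [NormedAddCommGroup F] [NormedSpace ℝ F] :
    C(K, W) × C(K, F) →L[ℝ] C(K, W × F) :=
  LinearMap.mkContinuous
    { toFun p := p.1.prodMk p.2
      map_add' p q := rfl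
      map_smul' c p := rfl }
    1 fun p => by
      rw [one_mul]
      refine (ContinuousMap.norm_le _ (norm_nonneg _)).2 fun t => ?_
      exact max_le_max (p.1.norm_coe_le_norm t) (p.2.norm_coe_le_norm t)

@[simp] theorem pairC_apply {K W F : Type*} [TopologicalSpace K] [CompactSpace K]
    [NormedAddCommGroup W] [NormedSpace ℝ W] [NormedAddCommGroup F] [NormedSpace ℝ F]
    (p : C(K, W) × C(K, F)) (t : K) : pairC K W F p t = (p.1 t, p.2 t) := rfl

theorem continuous_compDeriv {K W F : Type*} [TopologicalSpace K] [CompactSpace K]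
    [NormedAddCommGroup W] [NormedSpace ℝ W] [NormedAddCommGroup F] [NormedSpace ℝ F]
    {H : W → F} (hH : ContDiff ℝ 1 H) :
    Continuous fun p : C(K, W) × C(K, W) => compDeriv hH p.1 p.2 := by
  have hc : Continuous fun q : W × W => fderiv ℝ H q.1 q.2 :=
    ((hH.continuous_fderiv one_ne_zero).comp continuous_fst).clm_apply continuous_snd
  exact (continuous_compOp hc).comp (pairC K W W).continuous

/-- The Sobolev function on `(-b, T)` that vanishes before `0` and has derivative `v` after `0`. -/
def liftH1 (b T : ℝ) : L2 0 T n →L[ℝ] H1 (-b) T n :=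
  primH1 (-b) T 0 ∘L ContinuousLinearMap.inr ℝ (Vec n) (LR n) ∘L
    (extZero 0 T).toContinuousLinearMap

/-- The Sobolev function on `(-b, T)` with value `c` on `(0, T)` and derivative `ψ` on
`(-b, 0)`. -/
def histH1 (b T : ℝ) (c : Vec n) (ψ : L2 (-b) 0 n) : H1 (-b) T n :=
  primH1 (-b) T 0 (c, extZero (-b) 0 ψ)

theorem liftH1_val_ae (b T : ℝ) (v : L2 0 T n) :
    H1.val (liftH1 b T v) =ᵐ[volume.restrict (Ioo (-b) T)]
      fun t => ∫ s in (0 : ℝ)..t, extZero 0 T v s := by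
  filter_upwards [primH1_val_ae (-b) T 0 ((0 : Vec n), extZero 0 T v)] with t ht
  exact ht.trans (zero_add _)

theorem integral_extZero_of_nonpos {T s : ℝ} (hs : s ≤ 0) (v : L2 0 T n) :
    ∫ r in (0 : ℝ)..s, extZero 0 T v r = 0 := by
  refine intervalIntegral.integral_zero_ae ?_
  filter_upwards [extZero_ae 0 T v] with r hr hrs
  rw [hr, indicator_of_notMem]
  intro h
  rw [uIoc_of_ge hs] at hrs
  linarith [hrs.2, h.1]

theorem toL2_ae_mem {T : ℝ} (hT : 0 ≤ T) (x : C(Icc 0 T, Vec n)) :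
    ∀ᵐ t ∂volume.restrict (Ioo 0 T), ∀ ht : t ∈ Icc 0 T, toL2 hT x t = x ⟨t, ht⟩ := by
  filter_upwards [toL2_ae hT x] with t h ht
  rw [h, projIcc_of_mem hT ht]

/-- The delay term is causal: for `τ ≥ 0` it evaluates the trajectory at the earlier time `t - τ`. -/
theorem isCausalLip_delay {b T τ : ℝ} (h0 : 0 ≤ τ) (hb : τ ≤ b) (A : Vec n →L[ℝ] Vec n) :
    IsCausalLip T ‖A‖ fun v : L2 0 T n =>
      A.compLpL 2 _ (delayL b T τ (fstL (-b) T (liftH1 b T v))) := by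
  intro v w κ B hκ hB h
  set D := fun u : L2 0 T n => A.compLpL 2 _ (delayL b T τ (fstL (-b) T (liftH1 b T u)))
  have hsub : D v - D w = D (v - w) := by simp only [D, map_sub]
  have h2 := ae_Ioo_shift (c := 0) (d := T) (s := -τ) (liftH1_val_ae b T (v - w))
    (by linarith) (by linarith)
  filter_upwards [Lp.coeFn_sub (D v) (D w), ae_restrict_mem measurableSet_Ioo,
    A.coeFn_compLpL (delayL b T τ (fstL (-b) T (liftH1 b T (v - w)))),
    delayL_ae h0 hb (fstL (-b) T (liftH1 b T (v - w))), h2] with t h3 ht h4 h5 h6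
  have e : D v t - D w t = A (∫ s in (0 : ℝ)..(t - τ), extZero 0 T (v - w) s) := by
    rw [← Pi.sub_apply, ← h3, hsub]
    refine h4.trans (congrArg A (h5.trans ?_))
    rw [sub_eq_add_neg t τ]
    exact h6
  rw [e]
  refine (A.le_opNorm _).trans (mul_le_mul_of_nonneg_left ?_ (norm_nonneg _))
  rcases le_or_gt (t - τ) 0 with hs | hs
  · rw [integral_extZero_of_nonpos hs, norm_zero]
    positivity
  · refine (h ⟨t - τ, hs.le, by linarith [ht.2]⟩).trans ?_
    gcongr
    exact sub_le_self t h0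

theorem isCausalLip_toL2 {T Λ : ℝ} (hT : 0 ≤ T) (hΛ : 0 ≤ Λ) {N : L2 0 T n → C(Icc 0 T, Vec n)}
    (hN : ∀ v w t, ‖N v t - N w t‖ ≤ Λ * ‖primC T (v - w) t‖) :
    IsCausalLip T Λ fun v => toL2 hT (N v) := by
  intro v w κ B hκ hB h
  filter_upwards [toL2_ae_mem hT (N v), toL2_ae_mem hT (N w), ae_restrict_mem measurableSet_Ioo]
    with t h1 h2 ht
  have ht' : t ∈ Icc 0 T := Ioo_subset_Icc_self ht
  rw [h1 ht', h2 ht']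
  exact (hN v w _).trans (mul_le_mul_of_nonneg_left (h ⟨t, ht'⟩) hΛ)

theorem IsCausalLip.const_sub_add {T C C' : ℝ} {Φ Ψ : L2 0 T n → L2 0 T n}
    (hΦ : IsCausalLip T C Φ) (hΨ : IsCausalLip T C' Ψ) (r : L2 0 T n) :
    IsCausalLip T (C + C') fun v => r - Φ v + Ψ v := by
  intro v w κ B hκ hB h
  filter_upwards [hΦ v w κ B hκ hB h, hΨ v w κ B hκ hB h, Lp.coeFn_add (r - Φ v) (Ψ v),
    Lp.coeFn_add (r - Φ w) (Ψ w), Lp.coeFn_sub r (Φ v), Lp.coeFn_sub r (Φ w)]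
    with t h1 h2 h3 h4 h5 h6
  rw [h3, h4, Pi.add_apply, Pi.add_apply, h5, h6, Pi.sub_apply, Pi.sub_apply]
  have e : r t - Φ v t + Ψ v t - (r t - Φ w t + Ψ w t) =
      (Ψ v t - Ψ w t) - (Φ v t - Φ w t) := by abel
  rw [e, add_mul]
  refine (norm_sub_le _ _).trans ?_
  linarith

/-- The data of a semilinear delay equation
`ẏ(t) + F(ξ(t), y(t)) = A y(t - τ) + r(t)` in `(0, T)`, with `y(0) = c` and with `ẏ = ψ` on
`(-b, 0)`. The nonlinearity `F` depends on a parameter function `ξ` with values in `G`. -/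
structure DelayProblem (n : ℕ) (G : Type*) [NormedAddCommGroup G] [NormedSpace ℝ G] (b T : ℝ) where
  /-- the length of the time interval is nonnegative -/
  hT : 0 ≤ T
  /-- the nonlinearity -/
  F : G × Vec n → Vec n
  /-- the nonlinearity is continuously differentiable -/
  hF : ContDiff ℝ 1 F
  /-- a Lipschitz constant of the nonlinearity in the state variable -/
  Λ : ℝ
  /-- the Lipschitz constant is nonnegative -/
  hΛ : 0 ≤ Λ
  /-- the nonlinearity is Lipschitz in the state variable -/
  lip : ∀ ξ y z, ‖F (ξ, y) - F (ξ, z)‖ ≤ Λ * ‖y - z‖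
  /-- the operator applied to the delayed state -/
  A : Vec n →L[ℝ] Vec n
  /-- the initial value -/
  c : Vec n
  /-- the derivative of the history -/
  ψ : L2 (-b) 0 n
  /-- the inhomogeneity -/
  r : L2 0 T n

namespace DelayProblem

variable {G : Type*} [NormedAddCommGroup G] [NormedSpace ℝ G] {b T : ℝ} (P : DelayProblem n G b T)

/-- The function with the prescribed history and with derivative `v` on `(0, T)`. -/
def traj (v : L2 0 T n) : H1 (-b) T n := histH1 b T P.c P.ψ + liftH1 b T v

/-- The restriction of the trajectory to `[0, T]`. -/
def trajC (v : L2 0 T n) : C(Icc 0 T, Vec n) := ContinuousMap.const _ P.c + primC T v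

/-- The delay term `A y(· - τ)`. -/
def delay (τ : ℝ) : H1 (-b) T n →L[ℝ] L2 0 T n :=
  P.A.compLpL 2 _ ∘L delayL b T τ ∘L fstL (-b) T

/-- The term `A ẏ(· - τ)`. -/
def delayDot (τ : ℝ) : H1 (-b) T n →L[ℝ] L2 0 T n :=
  P.A.compLpL 2 _ ∘L delayL b T τ ∘L sndL (-b) T

/-- The right-hand side of the delay equation, as a map on derivatives: solutions of the equation
correspond to the fixed points of this map. -/
def rhs (ξ : C(Icc 0 T, G)) (τ : ℝ) (v : L2 0 T n) : L2 0 T n :=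
  P.r - toL2 P.hT (compOp P.hF.continuous (pairC _ _ _ (ξ, P.trajC v))) + P.delay τ (P.traj v)

/-- The right-hand side of the equation linearized at `(ξ, v)`, in the direction `η` of the
parameter and with inhomogeneity `e`. -/
def lin (ξ : C(Icc 0 T, G)) (v : L2 0 T n) (η : C(Icc 0 T, G)) (e : L2 0 T n) (τ : ℝ)
    (w : L2 0 T n) : L2 0 T n :=
  e - toL2 P.hT (compDeriv P.hF (pairC _ _ _ (ξ, P.trajC v)) (pairC _ _ _ (η, primC T w))) +
    P.delay τ (liftH1 b T w)

theorem trajC_sub (v w : L2 0 T n) : P.trajC v - P.trajC w = primC T (v - w) := by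
  rw [trajC, trajC, add_sub_add_left_eq_sub, map_sub]

theorem norm_fderiv_le (ξ : G) (y z : Vec n) : ‖fderiv ℝ P.F (ξ, y) (0, z)‖ ≤ P.Λ * ‖z‖ := by
  have hd : HasFDerivAt (fun u => P.F (ξ, u))
      (fderiv ℝ P.F (ξ, y) ∘L ContinuousLinearMap.inr ℝ G (Vec n)) y :=
    (P.hF.differentiable one_ne_zero (ξ, y)).hasFDerivAt.comp y (hasFDerivAt_prodMk_right ξ y)
  have hl : LipschitzWith ⟨P.Λ, P.hΛ⟩ fun u => P.F (ξ, u) :=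
    LipschitzWith.of_dist_le_mul fun u u' => by
      rw [dist_eq_norm, dist_eq_norm]
      exact P.lip ξ u u'
  have h := hd.le_of_lipschitz hl
  exact (ContinuousLinearMap.le_opNorm _ z).trans (mul_le_mul_of_nonneg_right h (norm_nonneg _))

theorem isCausalLip_delay_lift {τ : ℝ} (hτ : τ ∈ Ico 0 b) :
    IsCausalLip T ‖P.A‖ fun v : L2 0 T n => P.delay τ (liftH1 b T v) :=
  DelayAdjoint.isCausalLip_delay hτ.1 hτ.2.le P.A

theorem isCausalLip_rhs (ξ : C(Icc 0 T, G)) {τ : ℝ} (hτ : τ ∈ Ico 0 b) :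
    IsCausalLip T (P.Λ + ‖P.A‖) (P.rhs ξ τ) := by
  have h := (isCausalLip_toL2 P.hT P.hΛ
    (N := fun v => compOp P.hF.continuous (pairC _ _ _ (ξ, P.trajC v))) fun v w t => by
      rw [← P.trajC_sub]
      exact P.lip _ _ _).const_sub_add (P.isCausalLip_delay_lift hτ)
      (P.r + P.delay τ (histH1 b T P.c P.ψ))
  convert h using 2 with v
  rw [rhs, traj, map_add]
  abel

theorem isCausalLip_lin (ξ : C(Icc 0 T, G)) (v : L2 0 T n) (η : C(Icc 0 T, G)) (e : L2 0 T n)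
    {τ : ℝ} (hτ : τ ∈ Ico 0 b) : IsCausalLip T (P.Λ + ‖P.A‖) (P.lin ξ v η e τ) := by
  refine (isCausalLip_toL2 P.hT P.hΛ fun w z t => ?_).const_sub_add
    (P.isCausalLip_delay_lift hτ) e
  rw [compDeriv_apply, compDeriv_apply, ← map_sub, pairC_apply, pairC_apply, pairC_apply,
    Prod.mk_sub_mk, sub_self, map_sub]
  exact P.norm_fderiv_le _ _ _

/-- The delay term is jointly differentiable in the delay and the delayed function. -/
theorem hasFDerivWithinAt_delay {τ₀ : ℝ} (hτ₀ : τ₀ ∈ Ico 0 b) (x₀ : H1 (-b) T n) :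
    HasFDerivWithinAt (fun p : ℝ × H1 (-b) T n => P.delay p.1 p.2)
      (P.delay τ₀ ∘L ContinuousLinearMap.snd ℝ ℝ (H1 (-b) T n) -
        (ContinuousLinearMap.fst ℝ ℝ (H1 (-b) T n)).smulRight (P.delayDot τ₀ x₀))
      (Ico 0 b ×ˢ univ) (τ₀, x₀) := by
  have key : HasFDerivWithinAt (fun p : ℝ × H1 (-b) T n => delayL b T p.1 (fstL (-b) T p.2))
      ((delayL b T τ₀ ∘L fstL (-b) T) ∘L ContinuousLinearMap.snd ℝ ℝ (H1 (-b) T n) -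
        (ContinuousLinearMap.fst ℝ ℝ (H1 (-b) T n)).smulRight (delayL b T τ₀ (sndL (-b) T x₀)))
      (Ico 0 b ×ˢ univ) (τ₀, x₀) := by
    rw [hasFDerivWithinAt_iff_isLittleO, Asymptotics.isLittleO_iff]
    intro ε hε
    have h1 := hasDerivWithinAt_iff_isLittleO.1 (hasDerivWithinAt_delayL hτ₀ x₀)
    have hfst : Tendsto (Prod.fst : ℝ × H1 (-b) T n → ℝ) (𝓝[Ico 0 b ×ˢ univ] (τ₀, x₀))
        (𝓝[Ico 0 b] τ₀) := by
      refine tendsto_nhdsWithin_iff.2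
        ⟨(continuous_fst.tendsto _).mono_left nhdsWithin_le_nhds, ?_⟩
      filter_upwards [self_mem_nhdsWithin] with p hp using hp.1
    have h2 := hfst.eventually (Asymptotics.isLittleO_iff.1 h1 (half_pos hε))
    have h3 : ∀ᶠ p : ℝ × H1 (-b) T n in 𝓝[Ico 0 b ×ˢ univ] (τ₀, x₀),
        3 * |p.1 - τ₀| ≤ ε / 2 := by
      have hc : Continuous fun p : ℝ × H1 (-b) T n => 3 * |p.1 - τ₀| := by fun_prop
      have := hc.tendsto (τ₀, x₀)
      simp only [sub_self, abs_zero, mul_zero] at this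
      exact (this.mono_left nhdsWithin_le_nhds).eventually_le_const (half_pos hε)
    filter_upwards [h2, h3, self_mem_nhdsWithin] with p hp2 hp3 hp
    have e : delayL b T p.1 (fstL (-b) T p.2) - delayL b T (τ₀, x₀).1 (fstL (-b) T (τ₀, x₀).2) -
        ((delayL b T τ₀ ∘L fstL (-b) T) ∘L ContinuousLinearMap.snd ℝ ℝ (H1 (-b) T n) -
        (ContinuousLinearMap.fst ℝ ℝ (H1 (-b) T n)).smulRight (delayL b T τ₀ (sndL (-b) T x₀)))
          (p - (τ₀, x₀)) =
        (delayL b T p.1 (fstL (-b) T (p.2 - x₀)) - delayL b T τ₀ (fstL (-b) T (p.2 - x₀))) +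
        (delayL b T p.1 (fstL (-b) T x₀) - delayL b T τ₀ (fstL (-b) T x₀) -
          (p.1 - τ₀) • -delayL b T τ₀ (sndL (-b) T x₀)) := by
      change _ - _ - (delayL b T τ₀ (fstL (-b) T (p.2 - x₀)) -
        (p.1 - τ₀) • delayL b T τ₀ (sndL (-b) T x₀)) = _
      simp only [map_sub, smul_neg]
      abel
    rw [e]
    have b1 := norm_delayL_sub_le hp.1 hτ₀ (p.2 - x₀)
    have b2 : ‖p.1 - τ₀‖ ≤ ‖p - (τ₀, x₀)‖ := norm_fst_le (p - (τ₀, x₀))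
    have b3 : ‖p.2 - x₀‖ ≤ ‖p - (τ₀, x₀)‖ := norm_snd_le (p - (τ₀, x₀))
    calc _ ≤ _ := norm_add_le _ _
      _ ≤ 3 * |p.1 - τ₀| * ‖p.2 - x₀‖ + ε / 2 * ‖p.1 - τ₀‖ := add_le_add b1 hp2
      _ ≤ ε / 2 * ‖p - (τ₀, x₀)‖ + ε / 2 * ‖p - (τ₀, x₀)‖ := by gcongr
      _ = ε * ‖p - (τ₀, x₀)‖ := by ring
  have h := (P.A.compLpL 2 (volume.restrict (Ioo 0 T))).hasFDerivAt.comp_hasFDerivWithinAt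
    (τ₀, x₀) key
  refine h.congr_fderiv (ContinuousLinearMap.ext fun p => ?_)
  change P.A.compLpL 2 _ (delayL b T τ₀ (fstL (-b) T p.2) -
    p.1 • delayL b T τ₀ (sndL (-b) T x₀)) = P.delay τ₀ p.2 - p.1 • P.delayDot τ₀ x₀
  rw [map_sub, map_smul]
  rfl

/-- The right-hand side is differentiable jointly in the delay and in the unknown. The derivative `L`
is described by its values on `(1, w)` and `(0, w)`, which determine it. -/
theorem hasFDerivWithinAt_rhs {ξ : ℝ → C(Icc 0 T, G)} {η : C(Icc 0 T, G)} {τ₀ : ℝ}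
    (hτ₀ : τ₀ ∈ Ico 0 b) (hξ : HasDerivWithinAt ξ η (Ico 0 b) τ₀) (v₀ : L2 0 T n) :
    ∃ L : ℝ × L2 0 T n →L[ℝ] L2 0 T n,
      HasFDerivWithinAt (fun p : ℝ × L2 0 T n => P.rhs (ξ p.1) p.1 p.2) L
        (Ico 0 b ×ˢ univ) (τ₀, v₀) ∧
      (∀ w, L (1, w) = P.lin (ξ τ₀) v₀ η (-P.delayDot τ₀ (P.traj v₀)) τ₀ w) ∧
      ∀ w, L (0, w) = P.lin (ξ τ₀) v₀ 0 0 τ₀ w := by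
  have hm : MapsTo (Prod.fst : ℝ × L2 0 T n → ℝ) (Ico 0 b ×ˢ univ) (Ico 0 b) := fun p hp => hp.1
  have hξ' : HasFDerivWithinAt (fun p : ℝ × L2 0 T n => ξ p.1)
      (((1 : ℝ →L[ℝ] ℝ).smulRight η) ∘L ContinuousLinearMap.fst ℝ ℝ (L2 0 T n))
      (Ico 0 b ×ˢ univ) (τ₀, v₀) :=
    HasFDerivWithinAt.comp (τ₀, v₀) hξ.hasFDerivWithinAt hasFDerivWithinAt_fst hm
  have hy : HasFDerivWithinAt (fun p : ℝ × L2 0 T n => P.trajC p.2)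
      (primC T ∘L ContinuousLinearMap.snd ℝ ℝ (L2 0 T n)) (Ico 0 b ×ˢ univ) (τ₀, v₀) :=
    ((primC T ∘L ContinuousLinearMap.snd ℝ ℝ (L2 0 T n)).hasFDerivWithinAt).const_add _
  have hx : HasFDerivWithinAt (fun p : ℝ × L2 0 T n => (p.1, P.traj p.2))
      ((ContinuousLinearMap.fst ℝ ℝ (L2 0 T n)).prod
        (liftH1 b T ∘L ContinuousLinearMap.snd ℝ ℝ (L2 0 T n))) (Ico 0 b ×ˢ univ) (τ₀, v₀) :=
    hasFDerivWithinAt_fst.prodMk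
      (((liftH1 b T ∘L ContinuousLinearMap.snd ℝ ℝ (L2 0 T n)).hasFDerivWithinAt).const_add _)
  have hm2 : MapsTo (fun p : ℝ × L2 0 T n => (p.1, P.traj p.2)) (Ico 0 b ×ˢ univ)
      (Ico 0 b ×ˢ univ) := fun p hp => ⟨hp.1, mem_univ _⟩
  have hD := HasFDerivWithinAt.comp (τ₀, v₀) (P.hasFDerivWithinAt_delay hτ₀ (P.traj v₀)) hx hm2
  have hN := (toL2 P.hT).hasFDerivAt.comp_hasFDerivWithinAt (τ₀, v₀)
    ((hasFDerivAt_compOp P.hF (pairC _ _ _ (ξ τ₀, P.trajC v₀))).comp_hasFDerivWithinAt (τ₀, v₀)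
      ((pairC _ _ _).hasFDerivAt.comp_hasFDerivWithinAt (τ₀, v₀) (hξ'.prodMk hy)))
  refine ⟨_, (hN.const_sub P.r).add hD, fun w => ?_, fun w => ?_⟩
  · simp [lin]
    abel
  · simp [lin]

/-- Differentiability of the fixed points, by the argument of the implicit function theorem: the
causal bounds replace the invertibility of the linearization. -/
theorem hasDerivWithinAt_solution {ξ : ℝ → C(Icc 0 T, G)} {η : C(Icc 0 T, G)} {τ₀ : ℝ}
    (hτ₀ : τ₀ ∈ Ico 0 b) (hξ : HasDerivWithinAt ξ η (Ico 0 b) τ₀) {v : ℝ → L2 0 T n}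
    (hv : ∀ τ ∈ Ico 0 b, P.rhs (ξ τ) τ (v τ) = v τ) {w : L2 0 T n}
    (hw : P.lin (ξ τ₀) (v τ₀) η (-P.delayDot τ₀ (P.traj (v τ₀))) τ₀ w = w) :
    HasDerivWithinAt v w (Ico 0 b) τ₀ := by
  obtain ⟨M, hM0, hM⟩ := exists_causal_bound n T (P.Λ + ‖P.A‖)
  obtain ⟨L, hL, hL1, hL0⟩ := P.hasFDerivWithinAt_rhs hτ₀ hξ (v τ₀)
  -- the solution is Lipschitz at `τ₀`, as the residual of `v τ₀` at the delay `τ` is `O(τ - τ₀)`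
  have hO : (fun τ => v τ - v τ₀) =O[𝓝[Ico 0 b] τ₀] fun τ => τ - τ₀ := by
    have hpart : HasFDerivWithinAt (fun τ => P.rhs (ξ τ) τ (v τ₀))
        (L ∘L ContinuousLinearMap.inl ℝ ℝ (L2 0 T n)) (Ico 0 b) τ₀ :=
      HasFDerivWithinAt.comp (g := fun p : ℝ × L2 0 T n => P.rhs (ξ p.1) p.1 p.2)
        (f := fun τ => (τ, v τ₀)) τ₀ hL (hasFDerivAt_prodMk_left τ₀ (v τ₀)).hasFDerivWithinAt
        (fun τ hτ => ⟨hτ, mem_univ _⟩)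
    refine Asymptotics.IsBigO.trans ?_ hpart.isBigO_sub
    refine Asymptotics.IsBigO.of_bound M ?_
    filter_upwards [self_mem_nhdsWithin] with τ hτ
    have h := (hM _ (P.isCausalLip_rhs (ξ τ) hτ)).2 (v τ) (v τ₀)
    rw [hv τ hτ, sub_self, zero_sub, neg_sub] at h
    rwa [hv τ₀ hτ₀]
  have hcont : Tendsto v (𝓝[Ico 0 b] τ₀) (𝓝 (v τ₀)) := by
    have h1 : Tendsto (fun τ => τ - τ₀) (𝓝[Ico 0 b] τ₀) (𝓝 0) := by
      have : Tendsto (fun τ => τ - τ₀) (𝓝 τ₀) (𝓝 (τ₀ - τ₀)) :=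
        (continuous_id.sub continuous_const).tendsto τ₀
      rw [sub_self] at this
      exact this.mono_left nhdsWithin_le_nhds
    exact tendsto_sub_nhds_zero_iff.1 (hO.trans_tendsto h1)
  have htend : Tendsto (fun τ => (τ, v τ)) (𝓝[Ico 0 b] τ₀)
      (𝓝[Ico 0 b ×ˢ univ] (τ₀, v τ₀)) := by
    refine tendsto_nhdsWithin_iff.2 ⟨(tendsto_id.mono_left nhdsWithin_le_nhds).prodMk_nhds hcont,
      ?_⟩
    filter_upwards [self_mem_nhdsWithin] with τ hτ using ⟨hτ, mem_univ _⟩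
  have ho := (hasFDerivWithinAt_iff_isLittleO.1 hL).comp_tendsto htend
  have hO2 : (fun τ => (τ, v τ) - (τ₀, v τ₀)) =O[𝓝[Ico 0 b] τ₀] fun τ => τ - τ₀ :=
    (Asymptotics.isBigO_refl _ _).prod_left hO
  have ho2 := ho.trans_isBigO hO2
  rw [hasDerivWithinAt_iff_isLittleO]
  refine Asymptotics.IsBigO.trans_isLittleO (Asymptotics.IsBigO.of_bound M ?_) ho2
  filter_upwards [self_mem_nhdsWithin] with τ hτ
  have h := (hM _ (P.isCausalLip_lin (ξ τ₀) (v τ₀) 0 0 hτ₀)).2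
    (v τ - v τ₀ - (τ - τ₀) • w) 0
  rw [← hL0, ← hL0, show ((0 : ℝ), (0 : L2 0 T n)) = 0 from rfl, map_zero, sub_zero, sub_zero,
    sub_zero] at h
  refine h.trans (le_of_eq ?_)
  congr 2
  -- the increment splits into the direction of the claimed derivative and the remainder
  have hsplit : ((τ, v τ) - (τ₀, v τ₀) : ℝ × L2 0 T n) =
      (τ - τ₀) • ((1 : ℝ), w) + (0, v τ - v τ₀ - (τ - τ₀) • w) := by
    ext1
    · simp
    · simp
  simp only [Function.comp_apply]
  rw [hsplit, map_add, map_smul, hL1, hw, hv τ hτ, hv τ₀ hτ₀]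
  abel

/-- The delay operators on `L²` are only strongly continuous in the delay; as their norms are at most
one, this gives continuity in the delay and the delayed function jointly. -/
theorem continuousWithinAt_delayDot {v : ℝ → L2 0 T n} {s : Set ℝ} {τ₀ : ℝ}
    (hv : ContinuousWithinAt v s τ₀) :
    ContinuousWithinAt (fun τ => P.delayDot τ (P.traj (v τ))) s τ₀ := by
  have hy : ContinuousWithinAt (fun τ => sndL (-b) T (P.traj (v τ))) s τ₀ :=
    (sndL (-b) T).continuous.continuousAt.comp_continuousWithinAt
      (continuousWithinAt_const.add
        ((liftH1 b T).continuous.continuousAt.comp_continuousWithinAt hv))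
  have hd : ContinuousWithinAt (fun τ => delayL b T τ (sndL (-b) T (P.traj (v τ)))) s τ₀ := by
    have e : ∀ τ, delayL b T τ (sndL (-b) T (P.traj (v τ)) - sndL (-b) T (P.traj (v τ₀))) +
        delayL b T τ (sndL (-b) T (P.traj (v τ₀))) =
        delayL b T τ (sndL (-b) T (P.traj (v τ))) := fun τ => by
      rw [map_sub, sub_add_cancel]
    have h1 : Tendsto (fun τ => delayL b T τ
        (sndL (-b) T (P.traj (v τ)) - sndL (-b) T (P.traj (v τ₀)))) (𝓝[s] τ₀) (𝓝 0) :=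
      squeeze_zero_norm (fun τ => norm_delayL_le b T τ _)
        (tendsto_zero_iff_norm_tendsto_zero.1 (tendsto_sub_nhds_zero_iff.2 hy.tendsto))
    have h3 := h1.add ((continuous_delayL b T (sndL (-b) T (P.traj (v τ₀)))).tendsto τ₀
      |>.mono_left (nhdsWithin_le_nhds (s := s)))
    rw [zero_add] at h3
    exact h3.congr e
  exact (P.A.compLpL 2 _).continuous.continuousAt.comp_continuousWithinAt hd

theorem continuousWithinAt_lin {ξ ξ' : ℝ → C(Icc 0 T, G)} {v : ℝ → L2 0 T n} {τ₀ : ℝ}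
    (hτ₀ : τ₀ ∈ Ico 0 b) (hξ : ContinuousWithinAt ξ (Ico 0 b) τ₀)
    (hξ' : ContinuousWithinAt ξ' (Ico 0 b) τ₀) (hv : ContinuousWithinAt v (Ico 0 b) τ₀)
    (w : L2 0 T n) :
    ContinuousWithinAt (fun τ => P.lin (ξ τ) (v τ) (ξ' τ) (-P.delayDot τ (P.traj (v τ))) τ w)
      (Ico 0 b) τ₀ := by
  have htr : ContinuousWithinAt (fun τ => P.trajC (v τ)) (Ico 0 b) τ₀ :=
    continuousWithinAt_const.add
      ((primC T).continuous.continuousAt.comp_continuousWithinAt hv)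
  have h1 : ContinuousWithinAt (fun τ => pairC (Icc 0 T) G (Vec n) (ξ τ, P.trajC (v τ)))
      (Ico 0 b) τ₀ :=
    (pairC (Icc 0 T) G (Vec n)).continuous.continuousAt.comp_continuousWithinAt (hξ.prodMk htr)
  have h2 : ContinuousWithinAt (fun τ => pairC (Icc 0 T) G (Vec n) (ξ' τ, primC T w))
      (Ico 0 b) τ₀ :=
    (pairC (Icc 0 T) G (Vec n)).continuous.continuousAt.comp_continuousWithinAt
      (hξ'.prodMk continuousWithinAt_const)
  have h3 : ContinuousWithinAt (fun τ => compDeriv P.hF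
      (pairC (Icc 0 T) G (Vec n) (ξ τ, P.trajC (v τ)))
      (pairC (Icc 0 T) G (Vec n) (ξ' τ, primC T w))) (Ico 0 b) τ₀ :=
    (continuous_compDeriv P.hF).continuousAt.comp_continuousWithinAt
      (f := fun τ => (pairC (Icc 0 T) G (Vec n) (ξ τ, P.trajC (v τ)),
        pairC (Icc 0 T) G (Vec n) (ξ' τ, primC T w))) (h1.prodMk h2)
  have h4 : ContinuousWithinAt (fun τ => P.delay τ (liftH1 b T w)) (Ico 0 b) τ₀ :=
    (P.A.compLpL 2 _).continuous.continuousAt.comp_continuousWithinAt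
      (hasDerivWithinAt_delayL hτ₀ (liftH1 b T w)).continuousWithinAt
  exact ((P.continuousWithinAt_delayDot hv).neg.sub
    ((toL2 P.hT).continuous.continuousAt.comp_continuousWithinAt h3)).add h4

/-- The solution of a parametrized semilinear delay equation exists, is unique and depends
differentiably on the delay; the derivative solves the linearized equation. Everything is expressed
through the derivatives of the solutions on `(0, T)`. -/
theorem exists_solution {ξ ξ' : ℝ → C(Icc 0 T, G)}
    (hξ : ∀ τ ∈ Ico 0 b, HasDerivWithinAt ξ (ξ' τ) (Ico 0 b) τ)
    (hξ' : ContinuousOn ξ' (Ico 0 b)) :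
    ∃ v v' : ℝ → L2 0 T n,
      (∀ τ ∈ Ico 0 b, P.rhs (ξ τ) τ (v τ) = v τ ∧ ∀ w, P.rhs (ξ τ) τ w = w → w = v τ) ∧
      (∀ τ ∈ Ico 0 b, HasDerivWithinAt v (v' τ) (Ico 0 b) τ) ∧
      ContinuousOn v' (Ico 0 b) ∧
      ∀ τ ∈ Ico 0 b,
        P.lin (ξ τ) (v τ) (ξ' τ) (-P.delayDot τ (P.traj (v τ))) τ (v' τ) = v' τ ∧
        ∀ w, P.lin (ξ τ) (v τ) (ξ' τ) (-P.delayDot τ (P.traj (v τ))) τ w = w → w = v' τ := by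
  obtain ⟨M, hM0, hM⟩ := exists_causal_bound n T (P.Λ + ‖P.A‖)
  have hv : ∀ τ, ∃ v, τ ∈ Ico 0 b → P.rhs (ξ τ) τ v = v := fun τ => by
    by_cases hτ : τ ∈ Ico 0 b
    · obtain ⟨v, hv⟩ := (hM _ (P.isCausalLip_rhs (ξ τ) hτ)).1
      exact ⟨v, fun _ => hv⟩
    · exact ⟨0, fun h => absurd h hτ⟩
  choose v hv using hv
  have hv' : ∀ τ, ∃ w, τ ∈ Ico 0 b →
      P.lin (ξ τ) (v τ) (ξ' τ) (-P.delayDot τ (P.traj (v τ))) τ w = w := fun τ => by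
    by_cases hτ : τ ∈ Ico 0 b
    · obtain ⟨w, hw⟩ := (hM _ (P.isCausalLip_lin (ξ τ) (v τ) (ξ' τ)
        (-P.delayDot τ (P.traj (v τ))) hτ)).1
      exact ⟨w, fun _ => hw⟩
    · exact ⟨0, fun h => absurd h hτ⟩
  choose v' hv' using hv'
  have huniq : ∀ Φ : L2 0 T n → L2 0 T n, IsCausalLip T (P.Λ + ‖P.A‖) Φ → ∀ w z, Φ w = w →
      Φ z = z → w = z := by
    intro Φ hΦ w z hw hz
    have h := (hM Φ hΦ).2 w z
    rw [hw, hz, sub_self, sub_self, sub_self, norm_zero, mul_zero] at h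
    exact sub_eq_zero.1 (norm_le_zero_iff.1 h)
  have hderiv : ∀ τ ∈ Ico 0 b, HasDerivWithinAt v (v' τ) (Ico 0 b) τ := fun τ hτ =>
    P.hasDerivWithinAt_solution hτ (hξ τ hτ) hv (hv' τ hτ)
  refine ⟨v, v', fun τ hτ => ⟨hv τ hτ, fun w hw => huniq _ (P.isCausalLip_rhs (ξ τ) hτ) _ _ hw
    (hv τ hτ)⟩, hderiv, fun τ₀ hτ₀ => ?_, fun τ hτ => ⟨hv' τ hτ, fun w hw => huniq _
      (P.isCausalLip_lin (ξ τ) (v τ) (ξ' τ) _ hτ) _ _ hw (hv' τ hτ)⟩⟩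
  have hlin := P.continuousWithinAt_lin hτ₀ (hξ τ₀ hτ₀).continuousWithinAt (hξ' τ₀ hτ₀)
    (hderiv τ₀ hτ₀).continuousWithinAt (v' τ₀)
  rw [ContinuousWithinAt, ← tendsto_sub_nhds_zero_iff]
  have hlim : Tendsto (fun τ => M * ‖P.lin (ξ τ) (v τ) (ξ' τ)
      (-P.delayDot τ (P.traj (v τ))) τ (v' τ₀) - v' τ₀‖) (𝓝[Ico 0 b] τ₀) (𝓝 0) := by
    have h := (hlin.tendsto.sub_const (v' τ₀)).norm.const_mul M
    rw [hv' τ₀ hτ₀, sub_self, norm_zero, mul_zero] at h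
    exact h
  refine squeeze_zero_norm' ?_ hlim
  filter_upwards [self_mem_nhdsWithin] with τ hτ
  have h := (hM _ (P.isCausalLip_lin (ξ τ) (v τ) (ξ' τ)
    (-P.delayDot τ (P.traj (v τ))) hτ)).2 (v' τ) (v' τ₀)
  rwa [hv' τ hτ, sub_self, zero_sub, neg_sub] at h

end DelayProblem

/-! ### The Jacobian matrix and one-sided bounds -/

theorem act_apply (M : Matrix (Fin n) (Fin n) ℝ) (v : Vec n) (i : Fin n) :
    act M v i = ∑ j, M i j * v j := by
  simp [act, Matrix.toLpLin_apply, Matrix.mulVec, dotProduct]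

/-- The action of a matrix as a continuous linear map. -/
def actL (M : Matrix (Fin n) (Fin n) ℝ) : Vec n →L[ℝ] Vec n :=
  (Matrix.toEuclideanLin M).toContinuousLinearMap

theorem actL_apply (M : Matrix (Fin n) (Fin n) ℝ) (v : Vec n) : actL M v = act M v := rfl

theorem inner_act_transpose (M : Matrix (Fin n) (Fin n) ℝ) (v w : Vec n) :
    inner ℝ (act M.transpose v) w = inner ℝ v (act M w) := by
  simp only [PiLp.inner_apply, act_apply, Matrix.transpose_apply, RCLike.inner_apply, conj_trivial,
    Finset.mul_sum, Finset.sum_mul]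
  rw [Finset.sum_comm]
  refine Finset.sum_congr rfl fun i _ => Finset.sum_congr rfl fun j _ => ?_
  ring

theorem norm_act_transpose_le {M : Matrix (Fin n) (Fin n) ℝ} {C : ℝ}
    (hM : ∀ v, ‖act M v‖ ≤ C * ‖v‖) (v : Vec n) : ‖act M.transpose v‖ ≤ C * ‖v‖ := by
  rcases (norm_nonneg (act M.transpose v)).eq_or_lt with h | h
  · rw [← h]
    exact (norm_nonneg _).trans (hM v)
  · have h1 : ‖act M.transpose v‖ * ‖act M.transpose v‖ ≤ C * ‖v‖ * ‖act M.transpose v‖ := by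
      rw [← real_inner_self_eq_norm_mul_norm, inner_act_transpose]
      refine (real_inner_le_norm _ _).trans ?_
      refine (mul_le_mul_of_nonneg_left (hM _) (norm_nonneg _)).trans (le_of_eq ?_)
      ring
    exact le_of_mul_le_mul_right h1 h

theorem sum_fderiv_single {E : Type*} [NormedAddCommGroup E] [NormedSpace ℝ E]
    (L : Vec n →L[ℝ] E) (v : Vec n) : ∑ j, v j • L (EuclideanSpace.single j 1) = L v := by
  conv_rhs => rw [← (EuclideanSpace.basisFun (Fin n) ℝ).sum_repr v]
  simp

theorem act_jacobian {f : Vec n → Vec n} {y : Vec n} (hf : DifferentiableAt ℝ f y) (v : Vec n) :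
    act (jacobian f y) v = fderiv ℝ f y v := by
  ext i
  have h : HasFDerivAt (fun z => f z i) ((EuclideanSpace.proj i : Vec n →L[ℝ] ℝ) ∘L fderiv ℝ f y)
      y := (EuclideanSpace.proj i : Vec n →L[ℝ] ℝ).hasFDerivAt.comp y hf.hasFDerivAt
  rw [act_apply]
  simp only [jacobian, partialD, Matrix.of_apply, h.fderiv]
  rw [← PiLp.proj_apply (𝕜 := ℝ) 2 (fun _ : Fin n => ℝ) i (fderiv ℝ f y v)]
  have := sum_fderiv_single ((EuclideanSpace.proj i : Vec n →L[ℝ] ℝ) ∘L fderiv ℝ f y) v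
  simp only [smul_eq_mul] at this
  simp only [mul_comm _ (v _)]
  exact this

theorem jacobian_congr {f g : Vec n → Vec n} {y : Vec n} (h : f =ᶠ[𝓝 y] g) :
    jacobian f y = jacobian g y := by
  ext i j
  have hi : (fun z => f z i) =ᶠ[𝓝 y] fun z => g z i := h.mono fun z hz => by
    change f z i = g z i
    rw [hz]
  simp only [jacobian, partialD, Matrix.of_apply, hi.fderiv_eq]

theorem secondTerm_congr {f g : Vec n → Vec n} {y : Vec n} (h : f =ᶠ[𝓝 y] g) (q p : Vec n) :
    secondTerm f y q p = secondTerm g y q p := by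
  ext i
  simp only [secondTerm]
  refine Finset.sum_congr rfl fun j _ => Finset.sum_congr rfl fun k _ => ?_
  have hj : (fun z => f z j) =ᶠ[𝓝 y] fun z => g z j := h.mono fun z hz => by
    change f z j = g z j
    rw [hz]
  have hp : partialD i (fun z => f z j) =ᶠ[𝓝 y] partialD i fun z => g z j :=
    hj.eventuallyEq_nhds.mono fun z hz => by simp only [partialD, hz.fderiv_eq]
  have : partialD k (partialD i fun z => f z j) y = partialD k (partialD i fun z => g z j) y := by
    rw [partialD, partialD, hp.fderiv_eq]
  rw [this]

/-- Positive semidefiniteness of `Df + λ I` yields a one-sided growth bound on `f`. -/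
theorem inner_lower_bound {f : Vec n → Vec n} (hf : Differentiable ℝ f) {lam : ℝ}
    (hmon : ∀ y v : Vec n,
      0 ≤ inner ℝ (act (jacobian f y + lam • (1 : Matrix (Fin n) (Fin n) ℝ)) v) v) (y : Vec n) :
    -(lam * ‖y‖ ^ 2) - ‖f 0‖ * ‖y‖ ≤ inner ℝ (f y) y := by
  have hact : ∀ z v : Vec n, act (jacobian f z + lam • (1 : Matrix (Fin n) (Fin n) ℝ)) v =
      fderiv ℝ f z v + lam • v := fun z v => by
    rw [← act_jacobian (hf z)]
    simp [act, map_add]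
  have hd : ∀ s : ℝ, HasDerivAt (fun s : ℝ => inner ℝ (f (s • y)) y + lam * ‖y‖ ^ 2 * s)
      (inner ℝ (fderiv ℝ f (s • y) y) y + lam * ‖y‖ ^ 2) s := by
    intro s
    have h1 : HasDerivAt (fun s : ℝ => s • y) y s := by
      simpa using (hasDerivAt_id s).smul_const y
    have h2 : HasDerivAt (fun s : ℝ => f (s • y)) (fderiv ℝ f (s • y) y) s :=
      (hf (s • y)).hasFDerivAt.comp_hasDerivAt s h1
    have h3 := h2.inner ℝ (hasDerivAt_const s y)
    have h4 := (hasDerivAt_id s).const_mul (lam * ‖y‖ ^ 2)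
    refine (h3.add h4).congr_deriv ?_
    simp
  have hmono : Monotone fun s : ℝ => inner ℝ (f (s • y)) y + lam * ‖y‖ ^ 2 * s := by
    refine monotone_of_deriv_nonneg (fun s => (hd s).differentiableAt) fun s => ?_
    rw [(hd s).deriv]
    have h := hmon (s • y) y
    rw [hact, inner_add_left, real_inner_smul_left, real_inner_self_eq_norm_sq] at h
    exact h
  have h := hmono (zero_le_one (α := ℝ))
  simp only [zero_smul, mul_zero, add_zero, one_smul, mul_one] at h
  have h2 := abs_le.1 (abs_real_inner_le_norm (f 0) y)
  linarith [h2.1]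

/-- A `C²` function can be modified outside a ball to have compact support, by a cutoff with values
in `[0, 1]`. -/
theorem exists_truncation {f : Vec n → Vec n} (hf : ContDiff ℝ 2 f) {R : ℝ} (hR : 0 < R) :
    ∃ h : Vec n → Vec n, ContDiff ℝ 2 h ∧ HasCompactSupport h ∧
      (∀ y, ‖y‖ < R → h =ᶠ[𝓝 y] f) ∧ ∀ y, ∃ χ : ℝ, 0 ≤ χ ∧ χ ≤ 1 ∧ h y = χ • f y := by
  let B : ContDiffBump (0 : Vec n) :=
    { rIn := R, rOut := R + 1, rIn_pos := hR, rIn_lt_rOut := by linarith }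
  refine ⟨fun y => B y • f y, B.contDiff.smul hf, B.hasCompactSupport.smul_right, fun y hy => ?_,
    fun y => ⟨B y, B.nonneg, B.le_one, rfl⟩⟩
  have hmem : Metric.ball (0 : Vec n) R ∈ 𝓝 y :=
    Metric.isOpen_ball.mem_nhds (by simpa using hy)
  filter_upwards [hmem] with z hz
  rw [B.one_of_mem_closedBall (Metric.ball_subset_closedBall hz), one_smul]

/-! ### The energy estimate -/

/-- The fundamental theorem of calculus for `ρ x²`, where `x` is a primitive of an integrable function. -/
theorem weighted_sq_eq_scalar {w ρ : ℝ → ℝ} (hw : ∀ s t, IntervalIntegrable w volume s t)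
    (hρ : ContDiff ℝ 1 ρ) (c t : ℝ) :
    ρ t * (c + ∫ s in (0 : ℝ)..t, w s) ^ 2 = ρ 0 * c ^ 2 +
      ∫ r in (0 : ℝ)..t, (deriv ρ r * (c + ∫ s in (0 : ℝ)..r, w s) ^ 2 +
        ρ r * (2 * ((c + ∫ s in (0 : ℝ)..r, w s) * w r))) := by
  have hAρ : AbsolutelyContinuousOnInterval ρ 0 t :=
    hρ.contDiffOn.absolutelyContinuousOnInterval
  have hAc : AbsolutelyContinuousOnInterval (fun _ : ℝ => c) 0 t :=
    contDiff_const.contDiffOn.absolutelyContinuousOnInterval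
  have hAX : AbsolutelyContinuousOnInterval (fun r => c + ∫ s in (0 : ℝ)..r, w s) 0 t :=
    hAc.fun_add ((hw 0 t).absolutelyContinuousOnInterval_intervalIntegral left_mem_uIcc)
  have h := (hAρ.fun_mul (hAX.fun_mul hAX)).integral_deriv_eq_sub
  rw [intervalIntegral.integral_same, add_zero] at h
  have e : ∫ r in (0 : ℝ)..t, (deriv ρ r * (c + ∫ s in (0 : ℝ)..r, w s) ^ 2 +
        ρ r * (2 * ((c + ∫ s in (0 : ℝ)..r, w s) * w r))) =
      ∫ r in (0 : ℝ)..t, deriv (fun r => ρ r * ((c + ∫ s in (0 : ℝ)..r, w s) *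
        (c + ∫ s in (0 : ℝ)..r, w s))) r := by
    refine intervalIntegral.integral_congr_ae ?_
    filter_upwards [(hw 0 t).ae_hasDerivAt_integral] with r hr hrt
    have h1 : HasDerivAt (fun r => c + ∫ s in (0 : ℝ)..r, w s) (w r) r :=
      (hr (uIoc_subset_uIcc hrt) 0 left_mem_uIcc).const_add c
    have h2 : HasDerivAt ρ (deriv ρ r) r := (hρ.differentiable one_ne_zero r).hasDerivAt
    refine Eq.trans ?_ (h2.mul (h1.mul h1)).deriv.symm
    simp only [Pi.mul_apply]
    ring
  rw [e, h]
  ring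

/-- The energy identity for `ρ ‖x‖²`, where `x` is a primitive of a square integrable function. -/
theorem weighted_norm_sq_eq (w : LR n) {ρ : ℝ → ℝ} (hρ : ContDiff ℝ 1 ρ) (c : Vec n) (t : ℝ) :
    ρ t * ‖c + ∫ s in (0 : ℝ)..t, w s‖ ^ 2 = ρ 0 * ‖c‖ ^ 2 +
      ∫ r in (0 : ℝ)..t, (deriv ρ r * ‖c + ∫ s in (0 : ℝ)..r, w s‖ ^ 2 +
        ρ r * (2 * inner ℝ (c + ∫ s in (0 : ℝ)..r, w s) (w r))) := by
  have hw : ∀ i s t, IntervalIntegrable (fun r => w r i) volume s t := fun i s t =>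
    ⟨(EuclideanSpace.proj (𝕜 := ℝ) i).integrable_comp (LR_intervalIntegrable w s t).1,
      (EuclideanSpace.proj (𝕜 := ℝ) i).integrable_comp (LR_intervalIntegrable w s t).2⟩
  have e3 : ∀ i t, (∫ s in (0 : ℝ)..t, w s) i = ∫ s in (0 : ℝ)..t, w s i := fun i t =>
    ((EuclideanSpace.proj (𝕜 := ℝ) i).intervalIntegral_comp_comm
      (LR_intervalIntegrable w 0 t)).symm
  have hc : ∀ i, Continuous fun r => c i + ∫ s in (0 : ℝ)..r, w s i := fun i =>
    continuous_const.add (intervalIntegral.continuous_primitive (fun _ _ => hw i _ _) 0)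
  simp only [EuclideanSpace.real_norm_sq_eq, PiLp.inner_apply, PiLp.add_apply, e3,
    RCLike.inner_apply, conj_trivial, Finset.mul_sum, weighted_sq_eq_scalar (hw _) hρ,
    ← Finset.sum_add_distrib]
  rw [intervalIntegral.integral_finsetSum, ← Finset.sum_add_distrib]
  · refine Finset.sum_congr rfl fun i _ => ?_
    simp only [mul_comm (w _ i)]
  · intro i _
    refine (((hρ.continuous_deriv le_rfl).mul ((hc i).pow 2)).intervalIntegrable _ _).add ?_
    have h := ((hw i 0 t).mul_continuousOn (hc i).continuousOn).continuousOn_mul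
      (hρ.continuous.const_mul (2 : ℝ)).continuousOn
    exact h.congr fun r _ => by ring

theorem integral_extZero_of_nonneg {b s : ℝ} (hs : 0 ≤ s) (v : L2 (-b) 0 n) :
    ∫ r in (0 : ℝ)..s, extZero (-b) 0 v r = 0 := by
  refine intervalIntegral.integral_zero_ae ?_
  filter_upwards [extZero_ae (-b) 0 v] with r hr hrs
  rw [hr, indicator_of_notMem]
  intro h
  rw [uIoc_of_le hs] at hrs
  linarith [hrs.1, h.2]

/-- The trajectory with initial value `c`, with derivative `ψ` before `0` and `v` after `0`. -/
def trajFun {b T : ℝ} (c : Vec n) (ψ : L2 (-b) 0 n) (v : L2 0 T n) (t : ℝ) : Vec n :=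
  c + ∫ s in (0 : ℝ)..t, (extZero (-b) 0 ψ + extZero 0 T v : LR n) s

theorem continuous_trajFun {b T : ℝ} (c : Vec n) (ψ : L2 (-b) 0 n) (v : L2 0 T n) :
    Continuous (trajFun c ψ v) := continuous_const.add (continuous_primitive _ 0)

theorem trajFun_of_nonneg {b T t : ℝ} (ht : 0 ≤ t) (c : Vec n) (ψ : L2 (-b) 0 n) (v : L2 0 T n) :
    trajFun c ψ v t = c + ∫ s in (0 : ℝ)..t, extZero 0 T v s := by
  rw [trajFun, integral_LR_add, integral_extZero_of_nonneg ht, zero_add]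

theorem trajFun_of_nonpos {b T t : ℝ} (ht : t ≤ 0) (c : Vec n) (ψ : L2 (-b) 0 n) (v : L2 0 T n) :
    trajFun c ψ v t = c + ∫ s in (0 : ℝ)..t, extZero (-b) 0 ψ s := by
  rw [trajFun, integral_LR_add, integral_extZero_of_nonpos ht, add_zero]

/-- A priori bound for solutions of the delay equation, uniform in the delay and in all
nonlinearities with the same one-sided growth bound. In the weighted energy `exp (-2 κ t) ‖x(t)‖²`
the integral of the delayed term is absorbed by the weight, up to a contribution of the history. -/
theorem exists_apriori_bound {b T lam m : ℝ} (hlam : 0 ≤ lam)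
    (A : Vec n →L[ℝ] Vec n) (c : Vec n) (ψ : L2 (-b) 0 n) (g : L2 0 T n) :
    ∃ M : ℝ, ∀ (h : Vec n → Vec n), (∀ y, -(lam * ‖y‖ ^ 2) - m * ‖y‖ ≤ inner ℝ (h y) y) →
      ∀ τ ∈ Ico 0 b, ∀ v : L2 0 T n,
        (∀ᵐ t ∂volume.restrict (Ioo 0 T),
          v t = g t - h (trajFun c ψ v t) + A (trajFun c ψ v (t - τ))) →
        ∀ t ∈ Icc 0 T, ‖trajFun c ψ v t‖ ≤ M := by
  set a := ‖A‖ with ha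
  -- `lam` compensates the growth bound, `1` the terms with `m` and `g`, and `a` the delay term
  set κ := lam + 1 + a with hκ
  have ha0 : 0 ≤ a := norm_nonneg A
  have hκ0 : 0 ≤ κ := by positivity
  set Y0 := fun s => Real.exp (-2 * κ * s) * ‖c + ∫ r in (0 : ℝ)..s, extZero (-b) 0 ψ r‖ ^ 2
    with hY0
  set M2 := ‖c‖ ^ 2 + a * (∫ s in (-b)..0, Y0 s) + (m ^ 2 * T + ‖g‖ ^ 2) with hM2
  refine ⟨√(Real.exp (2 * κ * T) * M2), fun h hh τ hτ v hv t ht => ?_⟩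
  set X := trajFun c ψ v with hX
  have hXc : Continuous X := continuous_trajFun c ψ v
  set ρ := fun s : ℝ => Real.exp (-2 * κ * s) with hρ
  have hρd : ContDiff ℝ 1 ρ := by fun_prop
  have hρ' : ∀ s, deriv ρ s = -2 * κ * ρ s := fun s => by
    have : HasDerivAt ρ (Real.exp (-2 * κ * s) * (-2 * κ * 1)) s :=
      ((hasDerivAt_id s).const_mul (-2 * κ)).exp
    rw [this.deriv]; simp only [hρ]; ring
  have hρ0 : ∀ s, 0 < ρ s := fun s => Real.exp_pos _
  set Y := fun s => ρ s * ‖X s‖ ^ 2 with hY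
  have hYc : Continuous Y := hρd.continuous.mul (hXc.norm.pow 2)
  have hYn : ∀ s, 0 ≤ Y s := fun s => by positivity
  have hid := weighted_norm_sq_eq (extZero (-b) 0 ψ + extZero 0 T v : LR n) hρd c t
  change Y t = ρ 0 * ‖c‖ ^ 2 + ∫ r in (0 : ℝ)..t, (deriv ρ r * ‖X r‖ ^ 2 +
    ρ r * (2 * inner ℝ (X r) ((extZero (-b) 0 ψ + extZero 0 T v : LR n) r))) at hid
  have hgi : ∀ s t, IntervalIntegrable (fun r => ‖extZero 0 T g r‖ ^ 2) volume s t := fun s t =>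
    (integrable_norm_sq (extZero 0 T g)).intervalIntegrable
  have hYτ : Continuous fun r => Y (r - τ) := hYc.comp (continuous_id.sub continuous_const)
  -- pointwise bound of the energy production
  have hmono : ∫ r in (0 : ℝ)..t, (deriv ρ r * ‖X r‖ ^ 2 +
      ρ r * (2 * inner ℝ (X r) ((extZero (-b) 0 ψ + extZero 0 T v : LR n) r))) ≤
      ∫ r in (0 : ℝ)..t, (-(a * Y r) + a * Y (r - τ) + (m ^ 2 + ‖extZero 0 T g r‖ ^ 2)) := by
    refine intervalIntegral.integral_mono_ae_restrict ht.1 ?_ ?_ ?_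
    · refine ((hρd.continuous_deriv le_rfl).mul (hXc.norm.pow 2)).intervalIntegrable _ _ |>.add ?_
      have hb : IntervalIntegrable (fun r => 2 * ρ r * ‖X r‖ *
          ‖(extZero (-b) 0 ψ + extZero 0 T v : LR n) r‖) volume 0 t :=
        (LR_intervalIntegrable _ 0 t).norm.continuousOn_mul
          (((hρd.continuous.const_mul 2).mul hXc.norm).continuousOn)
      refine hb.mono_fun' ?_ (Eventually.of_forall fun r => ?_)
      · exact hρd.continuous.aestronglyMeasurable.mul
          ((hXc.aestronglyMeasurable.inner
            ((Lp.aestronglyMeasurable _).mono_measure Measure.restrict_le_self)).const_mul 2)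
      · change ‖_‖ ≤ _
        rw [norm_mul, norm_mul, Real.norm_of_nonneg (hρ0 r).le, Real.norm_ofNat]
        have := norm_inner_le_norm (𝕜 := ℝ) (X r)
          ((extZero (-b) 0 ψ + extZero 0 T v : LR n) r)
        nlinarith [hρ0 r]
    · exact ((((hYc.const_mul a).neg).add (hYτ.const_mul a)).intervalIntegrable _ _).add
        (intervalIntegrable_const.add (hgi _ _))
    · rw [← restrict_Ioo_eq_restrict_Icc]
      have hv' := (ae_restrict_iff' measurableSet_Ioo).1 hv
      filter_upwards [ae_restrict_mem measurableSet_Ioo, ae_restrict_of_ae hv',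
        ae_restrict_of_ae (extZero_ae (-b) 0 ψ), ae_restrict_of_ae (extZero_ae 0 T v),
        ae_restrict_of_ae (extZero_ae 0 T g),
        ae_restrict_of_ae (Lp.coeFn_add (extZero (-b) 0 ψ) (extZero 0 T v))]
        with r hr e1 e2 e3 e4 e5
      have hrT : r ∈ Ioo 0 T := ⟨hr.1, hr.2.trans_le ht.2⟩
      rw [e5, Pi.add_apply, e2, e3, e4, indicator_of_notMem (fun h => by linarith [h.2, hr.1]),
        indicator_of_mem hrT, indicator_of_mem hrT, zero_add, e1 hrT, hρ', inner_add_right,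
        inner_sub_right]
      have b1 := real_inner_le_norm (X r) (g r)
      have b2 := hh (X r)
      rw [real_inner_comm] at b2
      have b3 : inner ℝ (X r) (A (X (r - τ))) ≤ ‖X r‖ * (a * ‖X (r - τ)‖) :=
        (real_inner_le_norm _ _).trans
          (mul_le_mul_of_nonneg_left (A.le_opNorm _) (norm_nonneg _))
      have b4 : ρ r ≤ ρ (r - τ) := Real.exp_le_exp.2 (by nlinarith [hτ.1])
      have b5 : ρ r ≤ 1 := Real.exp_le_one_iff.2 (by nlinarith [hr.1])
      have b6 : 2 * (inner ℝ (X r) (g r) - inner ℝ (X r) (h (X r)) +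
          inner ℝ (X r) (A (X (r - τ)))) ≤ (2 * κ - a) * ‖X r‖ ^ 2 + a * ‖X (r - τ)‖ ^ 2 +
            (m ^ 2 + ‖g r‖ ^ 2) := by
        have c1 := sq_nonneg (‖X r‖ - ‖g r‖)
        have c2 := sq_nonneg (‖X r‖ - m)
        have c3 := mul_nonneg ha0 (sq_nonneg (‖X r‖ - ‖X (r - τ)‖))
        rw [hκ]
        nlinarith
      have b7 := mul_le_mul_of_nonneg_left b6 (hρ0 r).le
      have b8 : ρ r * (a * ‖X (r - τ)‖ ^ 2) ≤ ρ (r - τ) * (a * ‖X (r - τ)‖ ^ 2) :=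
        mul_le_mul_of_nonneg_right b4 (by positivity)
      have b9 : ρ r * (m ^ 2 + ‖g r‖ ^ 2) ≤ 1 * (m ^ 2 + ‖g r‖ ^ 2) :=
        mul_le_mul_of_nonneg_right b5 (by positivity)
      simp only [hY]
      linarith
  have hi1 : ∫ r in (0 : ℝ)..t, (-(a * Y r) + a * Y (r - τ) + (m ^ 2 + ‖extZero 0 T g r‖ ^ 2)) =
      -(a * ∫ r in (0 : ℝ)..t, Y r) + a * (∫ r in (0 : ℝ)..t, Y (r - τ)) +
        (m ^ 2 * t + ∫ r in (0 : ℝ)..t, ‖extZero 0 T g r‖ ^ 2) := by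
    rw [intervalIntegral.integral_add, intervalIntegral.integral_add, intervalIntegral.integral_neg,
      intervalIntegral.integral_const_mul, intervalIntegral.integral_const_mul,
      intervalIntegral.integral_add intervalIntegrable_const (hgi _ _),
      intervalIntegral.integral_const, smul_eq_mul, sub_zero, mul_comm t]
    · exact (hYc.const_mul a).neg.intervalIntegrable _ _
    · exact (hYτ.const_mul a).intervalIntegrable _ _
    · exact ((hYc.const_mul a).neg.add (hYτ.const_mul a)).intervalIntegrable _ _
    · exact intervalIntegrable_const.add (hgi _ _)
  have hi2 : ∫ r in (0 : ℝ)..t, Y (r - τ) ≤ (∫ s in (-b)..0, Y0 s) + ∫ r in (0 : ℝ)..t, Y r := by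
    have e0 : ∫ s in (-b)..0, Y0 s = ∫ s in (-b)..0, Y s := by
      refine intervalIntegral.integral_congr fun s hs => ?_
      rw [uIcc_of_le (by linarith [hτ.1, hτ.2])] at hs
      simp only [hY0, hY, hX, hρ, trajFun_of_nonpos hs.2]
    rw [e0, intervalIntegral.integral_add_adjacent_intervals (hYc.intervalIntegrable _ _)
      (hYc.intervalIntegrable _ _), intervalIntegral.integral_comp_sub_right]
    exact intervalIntegral.integral_mono_interval (by linarith [hτ.2]) (by linarith [ht.1])
      (by linarith [hτ.1]) (Eventually.of_forall hYn) (hYc.intervalIntegrable _ _)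
  have hi3 : ∫ r in (0 : ℝ)..t, ‖extZero 0 T g r‖ ^ 2 ≤ ‖g‖ ^ 2 := by
    rw [← LinearIsometry.norm_map (extZero 0 T) g, norm_sq_eq_integral,
      intervalIntegral.integral_of_le ht.1]
    exact setIntegral_le_integral (integrable_norm_sq _)
      (Eventually.of_forall fun r => by positivity)
  have hY_le : Y t ≤ M2 := by
    have e1 : ρ 0 = 1 := by simp [hρ]
    rw [hid, e1, one_mul, hM2]
    have h1 : m ^ 2 * t ≤ m ^ 2 * T := by gcongr; exact ht.2
    have h2 := mul_le_mul_of_nonneg_left hi2 ha0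
    rw [hi1] at hmono
    linarith
  refine Real.le_sqrt_of_sq_le ?_
  have e : ‖X t‖ ^ 2 = Real.exp (2 * κ * t) * Y t := by
    simp only [hY, hρ]
    rw [← mul_assoc, ← Real.exp_add]
    ring_nf
    simp
  rw [e]
  have h5 := ht.2
  exact mul_le_mul (Real.exp_le_exp.2 (by gcongr)) hY_le (hYn t) (Real.exp_pos _).le

/-! ### Time reversal of Sobolev functions -/

/-- The map `u ↦ u(s - ·)` on `L²(ℝ; ℝⁿ)`. -/
def reflLR (s : ℝ) : LR n →ₗᵢ[ℝ] LR n :=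
  Lp.compMeasurePreservingₗᵢ ℝ (fun t => s - t) (Measure.measurePreserving_sub_left volume s)

theorem reflLR_ae (s : ℝ) (w : LR n) : reflLR s w =ᵐ[volume] fun t => w (s - t) :=
  Lp.coeFn_compMeasurePreserving w (Measure.measurePreserving_sub_left volume s)

/-- The map `u ↦ u(s - ·)` from `L²(a, b; ℝⁿ)` to `L²(a', b'; ℝⁿ)`, meaningful if `t ↦ s - t` maps
`(a', b')` into `(a, b)`. -/
def reflL (a b a' b' s : ℝ) : L2 a b n →L[ℝ] L2 a' b' n :=
  resL a' b' ∘L (reflLR s).toContinuousLinearMap ∘L (extZero a b).toContinuousLinearMap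

theorem reflL_ae {a b a' b' s : ℝ} (h1 : a ≤ s - b') (h2 : s - a' ≤ b) (u : L2 a b n) :
    reflL a b a' b' s u =ᵐ[volume.restrict (Ioo a' b')] fun t => u (s - t) := by
  filter_upwards [resL_ae a' b' (reflLR s (extZero a b u)),
    ae_restrict_of_ae (reflLR_ae s (extZero a b u)),
    ae_Ioo_reflect (extZero_ae_restrict a b u) h1 h2] with t e1 e2 e3
  exact e1.trans (e2.trans e3)

theorem isWeakDeriv_reflL {a b a' b' s : ℝ} (h1 : a ≤ s - b') (h2 : s - a' ≤ b)
    {u v : L2 a b n} (huv : IsWeakDeriv u v) :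
    IsWeakDeriv (reflL a b a' b' s u) (-reflL a b a' b' s v) := by
  intro η e1 e2 e3
  have hd3 : tsupport (deriv η) ⊆ Ioo a' b' := (tsupport_deriv_subset (f := η)).trans e3
  have hζ1 : ContDiff ℝ (⊤ : ℕ∞) fun t => η (s - t) := e1.comp (contDiff_const.sub contDiff_id)
  have hζ2 : HasCompactSupport fun t => η (s - t) :=
    e2.comp_homeomorph (Homeomorph.subLeft s)
  have hζ3 : tsupport (fun t => η (s - t)) ⊆ Ioo a b := fun t ht => by
    have := e3 (tsupport_comp_subset_preimage η (continuous_const.sub continuous_id)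
      (f := fun t => s - t) ht)
    exact ⟨by linarith [this.2], by linarith [this.1]⟩
  have hζd : ∀ t, deriv (fun t => η (s - t)) t = -deriv η (s - t) := fun t =>
    deriv_comp_const_sub η s t
  have hζd3 : tsupport (fun t => deriv η (s - t)) ⊆ Ioo a b := by
    have h := (tsupport_deriv_subset (f := fun t => η (s - t))).trans hζ3
    have e : tsupport (deriv fun t => η (s - t)) = tsupport fun t => deriv η (s - t) := by
      have : (deriv fun t => η (s - t)) = fun t => -deriv η (s - t) := funext hζd
      rw [this]
      exact congrArg closure (Function.support_neg (fun t => deriv η (s - t)))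
    rwa [e] at h
  have key := huv _ hζ1 hζ2 hζ3
  simp only [hζd, neg_smul, integral_neg, neg_inj] at key
  rw [setIntegral_Ioo_eq_of_tsupport hζd3, setIntegral_Ioo_eq_of_tsupport hζ3] at key
  have l1 : ∫ t in Ioo a' b', deriv η t • reflL a b a' b' s u t =
      ∫ t, deriv η (s - t) • u t := by
    rw [← integral_sub_left_eq_self (fun t => deriv η (s - t) • u t) volume s]
    simp only [sub_sub_cancel]
    rw [← setIntegral_Ioo_eq_of_tsupport hd3]
    refine integral_congr_ae ?_
    filter_upwards [reflL_ae h1 h2 u] with t ht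
    rw [ht]
  have l2 : ∫ t in Ioo a' b', η t • (-reflL a b a' b' s v : L2 a' b' n) t =
      -∫ t, η (s - t) • v t := by
    rw [← integral_sub_left_eq_self (fun t => η (s - t) • v t) volume s]
    simp only [sub_sub_cancel]
    rw [← setIntegral_Ioo_eq_of_tsupport e3, ← integral_neg]
    refine integral_congr_ae ?_
    filter_upwards [reflL_ae h1 h2 v, Lp.coeFn_neg (reflL a b a' b' s v)] with t ht ht'
    rw [ht', Pi.neg_apply, ht, smul_neg]
  rw [l1, l2, neg_neg, key]

/-- Time reversal `x ↦ x(s - ·)` of Sobolev functions. -/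
def reflH1 {a b a' b' s : ℝ} (h1 : a ≤ s - b') (h2 : s - a' ≤ b) : H1 a b n →L[ℝ] H1 a' b' n :=
  (((WithLp.prodContinuousLinearEquiv 2 ℝ (L2 a' b' n) (L2 a' b' n)).symm :
      L2 a' b' n × L2 a' b' n →L[ℝ] WithLp 2 (L2 a' b' n × L2 a' b' n)) ∘L
    ((reflL a b a' b' s ∘L fstL a b).prod (-(reflL a b a' b' s ∘L sndL a b)))).codRestrict
      (H1 a' b' n) fun x => isWeakDeriv_reflL h1 h2 x.2

theorem reflH1_val_ae {a b a' b' s : ℝ} (h1 : a ≤ s - b') (h2 : s - a' ≤ b) (x : H1 a b n) :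
    H1.val (reflH1 h1 h2 x) =ᵐ[volume.restrict (Ioo a' b')] fun t => H1.val x (s - t) :=
  reflL_ae h1 h2 x.1.fst

theorem reflH1_dot_ae {a b a' b' s : ℝ} (h1 : a ≤ s - b') (h2 : s - a' ≤ b) (x : H1 a b n) :
    H1.dot (reflH1 h1 h2 x) =ᵐ[volume.restrict (Ioo a' b')] fun t => -H1.dot x (s - t) := by
  filter_upwards [reflL_ae h1 h2 x.1.snd, Lp.coeFn_neg (reflL a b a' b' s x.1.snd)] with t e1 e2
  exact e2.trans (congrArg Neg.neg e1)

theorem reflH1_reflH1 {a b a' b' s : ℝ} (h1 : a ≤ s - b') (h2 : s - a' ≤ b) (h3 : a' ≤ s - b)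
    (h4 : s - a ≤ b') (x : H1 a b n) : reflH1 h3 h4 (reflH1 h1 h2 x) = x := by
  refine H1.ext_val ?_
  filter_upwards [reflH1_val_ae h3 h4 (reflH1 h1 h2 x),
    ae_Ioo_reflect (reflH1_val_ae h1 h2 x) h3 h4] with t e1 e2
  rw [e1, e2, sub_sub_cancel]

/-! ### Solutions in the Sobolev space and fixed points -/

theorem traj_eq_primH1 (b T : ℝ) (c : Vec n) (ψ : L2 (-b) 0 n) (v : L2 0 T n) :
    histH1 b T c ψ + liftH1 b T v =
      primH1 (-b) T 0 (c, extZero (-b) 0 ψ + extZero 0 T v) := by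
  change primH1 (-b) T 0 (c, extZero (-b) 0 ψ) + primH1 (-b) T 0 (0, extZero 0 T v) = _
  rw [← map_add, Prod.mk_add_mk, add_zero]

theorem trajFun_zero {b T : ℝ} (v : L2 0 T n) (t : ℝ) :
    trajFun (0 : Vec n) (0 : L2 (-b) 0 n) v t = ∫ s in (0 : ℝ)..t, extZero 0 T v s := by
  rw [trajFun, map_zero, zero_add, zero_add]

namespace DelayProblem

variable {G : Type*} [NormedAddCommGroup G] [NormedSpace ℝ G] {b T : ℝ} (P : DelayProblem n G b T)

theorem traj_val_ae (v : L2 0 T n) :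
    H1.val (P.traj v) =ᵐ[volume.restrict (Ioo (-b) T)] trajFun P.c P.ψ v := by
  rw [traj, traj_eq_primH1]
  exact primH1_val_ae (-b) T 0 _

theorem traj_dot_ae (hb : 0 ≤ b) (v : L2 0 T n) :
    H1.dot (P.traj v) =ᵐ[volume.restrict (Ioo 0 T)] v := by
  rw [traj, traj_eq_primH1]
  filter_upwards [ae_Ioo_mono (primH1_dot_ae (-b) T 0
    (P.c, extZero (-b) 0 P.ψ + extZero 0 T v)) (neg_nonpos.2 hb) le_rfl,
    ae_restrict_of_ae (Lp.coeFn_add (extZero (-b) 0 P.ψ) (extZero 0 T v)),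
    ae_restrict_of_ae (extZero_ae (-b) 0 P.ψ), extZero_ae_restrict 0 T v,
    ae_restrict_mem measurableSet_Ioo] with t e1 e2 e3 e4 ht
  rw [e1, e2, Pi.add_apply, e3, e4, indicator_of_notMem (fun h => by linarith [h.2, ht.1]),
    zero_add]

theorem traj_val_ae_history {φ : H1 (-b) 0 n}
    (hφ : φ = primH1 (-b) 0 0 (P.c, extZero (-b) 0 P.ψ)) (v : L2 0 T n) :
    H1.val (P.traj v) =ᵐ[volume.restrict (Ioo (-b) 0)] H1.val φ := by
  rw [hφ]
  filter_upwards [ae_Ioo_mono (P.traj_val_ae v) le_rfl P.hT, primH1_val_ae (-b) 0 0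
    (P.c, extZero (-b) 0 P.ψ), ae_restrict_mem measurableSet_Ioo] with t e1 e2 ht
  rw [e1, e2, trajFun_of_nonpos ht.2.le]

/-- A Sobolev function with the prescribed history is a trajectory. -/
theorem exists_eq_traj (hb : 0 < b) {φ : H1 (-b) 0 n}
    (hφ : φ = primH1 (-b) 0 0 (P.c, extZero (-b) 0 P.ψ)) {y : H1 (-b) T n}
    (hy : H1.val y =ᵐ[volume.restrict (Ioo (-b) 0)] H1.val φ) : ∃ v, y = P.traj v := by
  obtain ⟨x0, hx0⟩ := exists_eq_primH1 0 y
  set v := resL 0 T (extZero (-b) T y.1.snd)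
  have hdot := dot_ae_eq_of_val_ae_eq le_rfl P.hT le_rfl le_rfl hy
  have hw : extZero (-b) T y.1.snd = extZero (-b) 0 P.ψ + extZero 0 T v := by
    ext1
    have hφd : H1.dot φ =ᵐ[volume.restrict (Ioo (-b) 0)] extZero (-b) 0 P.ψ := by
      rw [hφ]
      exact primH1_dot_ae (-b) 0 0 _
    filter_upwards [extZero_ae (-b) T y.1.snd,
      Lp.coeFn_add (extZero (-b) 0 P.ψ) (extZero 0 T v), extZero_ae (-b) 0 P.ψ, extZero_ae 0 T v,
      (ae_restrict_iff' measurableSet_Ioo).1 (resL_ae 0 T (extZero (-b) T y.1.snd)),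
      (ae_restrict_iff' measurableSet_Ioo).1 hφd, (ae_restrict_iff' measurableSet_Ioo).1 hdot,
      compl_mem_ae_iff.2 (measure_singleton (0 : ℝ))] with t e1 e2 e3 e4 e5 e6 e7 e8
    rw [e2, Pi.add_apply]
    rcases lt_trichotomy t 0 with ht | ht | ht
    · rw [e4, indicator_of_notMem (fun h => by linarith [h.1] : t ∉ Ioo 0 T), add_zero]
      by_cases htb : t ∈ Ioo (-b) 0
      · have htT : t ∈ Ioo (-b) T := ⟨htb.1, ht.trans_le P.hT⟩
        rw [e1, indicator_of_mem htT, ← e6 htb, ← e7 htb]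
        rfl
      · rw [e1, e3, indicator_of_notMem htb, indicator_of_notMem]
        exact fun h => htb ⟨h.1, ht⟩
    · exact absurd ht e8
    · rw [e3, indicator_of_notMem (fun h => by linarith [h.2] : t ∉ Ioo (-b) 0), zero_add]
      by_cases htT : t ∈ Ioo 0 T
      · rw [e4, indicator_of_mem htT, e5 htT]
      · rw [e1, e4, indicator_of_notMem htT, indicator_of_notMem]
        exact fun h => htT ⟨ht, h.2⟩
  have hc : x0 = P.c := by
    have : (ae (volume.restrict (Ioo (-b) 0))).NeBot := by
      rw [ae_restrict_neBot, Real.volume_Ioo]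
      simpa using hb
    have hyv : H1.val y =ᵐ[volume.restrict (Ioo (-b) T)]
        fun t => x0 + ∫ s in (0 : ℝ)..t, extZero (-b) T y.1.snd s := by
      have h := primH1_val_ae (-b) T 0 (x0, extZero (-b) T y.1.snd)
      rw [← hx0] at h
      exact h
    have hφv := primH1_val_ae (-b) 0 0 (P.c, extZero (-b) 0 P.ψ)
    rw [← hφ] at hφv
    obtain ⟨t, e1, e2, e3, ht⟩ := (hy.and ((ae_Ioo_mono hyv le_rfl P.hT).and (hφv.and
      (ae_restrict_mem measurableSet_Ioo)))).exists
    have e4 := trajFun_of_nonpos ht.2.le P.c P.ψ v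
    rw [trajFun, ← hw] at e4
    rw [e1, e3] at e2
    simp only at e2
    rw [← add_left_cancel e4] at e2
    exact (add_right_cancel e2).symm
  refine ⟨v, ?_⟩
  rw [traj, traj_eq_primH1, ← hw, ← hc]
  exact hx0

theorem trajC_apply (v : L2 0 T n) (t : Icc 0 T) : P.trajC v t = trajFun P.c P.ψ v t := by
  rw [trajFun_of_nonneg t.2.1]
  rfl

theorem delay_ae {τ : ℝ} (hτ : τ ∈ Ico 0 b) {y : H1 (-b) T n} {Y : ℝ → Vec n}
    (hy : H1.val y =ᵐ[volume.restrict (Ioo (-b) T)] Y) :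
    P.delay τ y =ᵐ[volume.restrict (Ioo 0 T)] fun t => P.A (Y (t - τ)) := by
  filter_upwards [P.A.coeFn_compLpL (p := 2) (delayL b T τ (fstL (-b) T y)),
    delayL_ae hτ.1 hτ.2.le (fstL (-b) T y),
    ae_Ioo_shift (c := 0) (d := T) (s := -τ) hy (by linarith [hτ.2]) (by linarith [hτ.1])]
    with t e1 e2 e3
  refine e1.trans (congrArg P.A (e2.trans ?_))
  rw [sub_eq_add_neg]
  exact e3

theorem delayDot_ae {τ : ℝ} (hτ : τ ∈ Ico 0 b) (y : H1 (-b) T n) :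
    P.delayDot τ y =ᵐ[volume.restrict (Ioo 0 T)] fun t => P.A (H1.dot y (t - τ)) := by
  filter_upwards [P.A.coeFn_compLpL (p := 2) (delayL b T τ (sndL (-b) T y)),
    delayL_ae hτ.1 hτ.2.le (sndL (-b) T y)] with t e1 e2
  exact e1.trans (congrArg P.A e2)

theorem rhs_ae (ξ : C(Icc 0 T, G)) {τ : ℝ} (hτ : τ ∈ Ico 0 b) (v : L2 0 T n) :
    P.rhs ξ τ v =ᵐ[volume.restrict (Ioo 0 T)] fun t =>
      P.r t - P.F (ξ (projIcc 0 T P.hT t), trajFun P.c P.ψ v t) +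
        P.A (trajFun P.c P.ψ v (t - τ)) := by
  set N := toL2 P.hT (compOp P.hF.continuous (pairC _ _ _ (ξ, P.trajC v)))
  filter_upwards [Lp.coeFn_add (P.r - N) (P.delay τ (P.traj v)), Lp.coeFn_sub P.r N,
    toL2_ae P.hT (compOp P.hF.continuous (pairC _ _ _ (ξ, P.trajC v))),
    P.delay_ae hτ (P.traj_val_ae v), ae_restrict_mem measurableSet_Ioo] with t e1 e2 e3 e4 ht
  refine e1.trans ?_
  rw [Pi.add_apply, e2, Pi.sub_apply, e3, e4, compOp_apply, pairC_apply, trajC_apply,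
    projIcc_of_mem P.hT (Ioo_subset_Icc_self ht)]

theorem rhs_eq_iff (ξ : C(Icc 0 T, G)) {τ : ℝ} (hτ : τ ∈ Ico 0 b) (v : L2 0 T n) :
    P.rhs ξ τ v = v ↔ ∀ᵐ t ∂volume.restrict (Ioo 0 T), v t =
      P.r t - P.F (ξ (projIcc 0 T P.hT t), trajFun P.c P.ψ v t) +
        P.A (trajFun P.c P.ψ v (t - τ)) := by
  constructor
  · intro h
    have h2 := P.rhs_ae ξ hτ v
    rw [h] at h2
    exact h2
  · intro h
    ext1
    filter_upwards [P.rhs_ae ξ hτ v, h] with t e1 e2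
    rw [e1, ← e2]

theorem lin_eq_iff (ξ : C(Icc 0 T, G)) (η : C(Icc 0 T, G)) {τ : ℝ} (hτ : τ ∈ Ico 0 b)
    (v w : L2 0 T n) :
    P.lin ξ v η (-P.delayDot τ (P.traj v)) τ w = w ↔ ∀ᵐ t ∂volume.restrict (Ioo 0 T), w t =
      -P.A (H1.dot (P.traj v) (t - τ)) -
        fderiv ℝ P.F (ξ (projIcc 0 T P.hT t), trajFun P.c P.ψ v t)
          (η (projIcc 0 T P.hT t), ∫ s in (0 : ℝ)..t, extZero 0 T w s) +
        P.A (∫ s in (0 : ℝ)..(t - τ), extZero 0 T w s) := by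
  set N := toL2 P.hT (compDeriv P.hF (pairC _ _ _ (ξ, P.trajC v)) (pairC _ _ _ (η, primC T w)))
    with hN
  have hlin : P.lin ξ v η (-P.delayDot τ (P.traj v)) τ w =ᵐ[volume.restrict (Ioo 0 T)] fun t =>
      -P.A (H1.dot (P.traj v) (t - τ)) -
        fderiv ℝ P.F (ξ (projIcc 0 T P.hT t), trajFun P.c P.ψ v t)
          (η (projIcc 0 T P.hT t), ∫ s in (0 : ℝ)..t, extZero 0 T w s) +
        P.A (∫ s in (0 : ℝ)..(t - τ), extZero 0 T w s) := by
    filter_upwards [Lp.coeFn_add (-P.delayDot τ (P.traj v) - N) (P.delay τ (liftH1 b T w)),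
      Lp.coeFn_sub (-P.delayDot τ (P.traj v)) N, Lp.coeFn_neg (P.delayDot τ (P.traj v)),
      P.delayDot_ae hτ (P.traj v),
      toL2_ae P.hT (compDeriv P.hF (pairC _ _ _ (ξ, P.trajC v)) (pairC _ _ _ (η, primC T w))),
      P.delay_ae hτ (liftH1_val_ae b T w), ae_restrict_mem measurableSet_Ioo]
      with t e1 e2 e3 e4 e5 e6 ht
    refine e1.trans ?_
    rw [Pi.add_apply, e2, Pi.sub_apply, e3, Pi.neg_apply, e4, hN, e5, e6, compDeriv_apply,
      pairC_apply, pairC_apply, trajC_apply, primC_apply,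
      projIcc_of_mem P.hT (Ioo_subset_Icc_self ht)]
  constructor
  · intro h
    rw [h] at hlin
    exact hlin
  · intro h
    ext1
    filter_upwards [hlin, h] with t e1 e2
    rw [e1, ← e2]

end DelayProblem

/-! ### The adjoint nonlinearity -/

/-- The nonlinearity `(y, q) ↦ Df(y)ᵀ q - y` of the adjoint equation. -/
def adjointField (f : Vec n → Vec n) (z : Vec n × Vec n) : Vec n :=
  act (jacobian f z.1).transpose z.2 - z.1

theorem adjointField_apply (f : Vec n → Vec n) (z : Vec n × Vec n) (i : Fin n) :
    adjointField f z i = (∑ j, partialD i (fun y => f y j) z.1 * z.2 j) - z.1 i := by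
  rw [adjointField, PiLp.sub_apply, act_apply]
  rfl

theorem contDiff_partialD {f : Vec n → Vec n} (hf : ContDiff ℝ 2 f) (i j : Fin n) :
    ContDiff ℝ 1 (partialD i fun y => f y j) :=
  ((contDiff_euclidean.1 hf j).fderiv_right (m := 1) (by norm_num)).clm_apply contDiff_const

theorem contDiff_adjointField {f : Vec n → Vec n} (hf : ContDiff ℝ 2 f) :
    ContDiff ℝ 1 (adjointField f) := by
  refine contDiff_euclidean.2 fun i => ?_
  simp only [adjointField_apply]
  refine (ContDiff.sum fun j _ => ?_).sub ?_
  · exact ((contDiff_partialD hf i j).comp contDiff_fst).mul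
      ((contDiff_euclidean.1 contDiff_id j).comp contDiff_snd)
  · exact (contDiff_euclidean.1 contDiff_id i).comp contDiff_fst

theorem fderiv_adjointField {f : Vec n → Vec n} (hf : ContDiff ℝ 2 f) (y q η w : Vec n) :
    fderiv ℝ (adjointField f) (y, q) (η, w) =
      secondTerm f y η q + act (jacobian f y).transpose w - η := by
  ext i
  let π : Fin n → Vec n →L[ℝ] ℝ := fun i => EuclideanSpace.proj i
  have hA : HasFDerivAt (adjointField f) (fderiv ℝ (adjointField f) (y, q)) (y, q) :=
    ((contDiff_adjointField hf).differentiable one_ne_zero (y, q)).hasFDerivAt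
  have h1 : HasFDerivAt (fun z => adjointField f z i)
      (π i ∘L fderiv ℝ (adjointField f) (y, q)) (y, q) := (π i).hasFDerivAt.comp (y, q) hA
  have hj : ∀ j, HasFDerivAt (fun z : Vec n × Vec n => partialD i (fun y => f y j) z.1 * z.2 j)
      (partialD i (fun y => f y j) y • (π j ∘L ContinuousLinearMap.snd ℝ (Vec n) (Vec n)) +
        q j • (fderiv ℝ (partialD i fun y => f y j) y ∘L
          ContinuousLinearMap.fst ℝ (Vec n) (Vec n))) (y, q) := fun j => by
    have e1 : HasFDerivAt (fun z : Vec n × Vec n => partialD i (fun y => f y j) z.1)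
        (fderiv ℝ (partialD i fun y => f y j) y ∘L ContinuousLinearMap.fst ℝ (Vec n) (Vec n))
        (y, q) :=
      HasFDerivAt.comp (g := partialD i fun y => f y j) (f := Prod.fst) (y, q)
        ((contDiff_partialD hf i j).differentiable one_ne_zero y).hasFDerivAt
        (hasFDerivAt_fst (E := Vec n) (F := Vec n))
    exact e1.mul (π j ∘L ContinuousLinearMap.snd ℝ (Vec n) (Vec n)).hasFDerivAt
  have h2 := ((HasFDerivAt.fun_sum (u := Finset.univ) fun j _ => hj j).sub
    (π i ∘L ContinuousLinearMap.fst ℝ (Vec n) (Vec n)).hasFDerivAt).congr_of_eventuallyEq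
      (Eventually.of_forall fun z => adjointField_apply f z i)
  have h3 := congrArg (fun L => L (η, w)) (h1.unique h2)
  change (fderiv ℝ (adjointField f) (y, q) (η, w)) i = _ at h3
  rw [h3, PiLp.sub_apply, PiLp.add_apply, act_apply]
  have hs : secondTerm f y η q i =
      ∑ j, q j * fderiv ℝ (partialD i fun y => f y j) y η := by
    simp only [secondTerm]
    refine Finset.sum_congr rfl fun j _ => ?_
    rw [← sum_fderiv_single (fderiv ℝ (partialD i fun y => f y j) y) η, Finset.mul_sum]
    refine Finset.sum_congr rfl fun k _ => ?_
    simp only [smul_eq_mul, partialD]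
    ring
  rw [hs, ← Finset.sum_add_distrib]
  simp only [sub_apply, sum_apply, add_apply, smul_apply, smul_eq_mul]
  congr 1
  refine Finset.sum_congr rfl fun j _ => ?_
  rw [add_comm]
  rfl

theorem exists_adjointField_lipschitz {f : Vec n → Vec n} (hf : ContDiff ℝ 2 f)
    (hc : HasCompactSupport f) :
    ∃ Λ : ℝ, 0 ≤ Λ ∧ ∀ y q r, ‖adjointField f (y, q) - adjointField f (y, r)‖ ≤ Λ * ‖q - r‖ := by
  obtain ⟨C, hC⟩ := hf.lipschitzWith_of_hasCompactSupport hc (by norm_num)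
  refine ⟨C, C.2, fun y q r => ?_⟩
  have e : adjointField f (y, q) - adjointField f (y, r) =
      act (jacobian f y).transpose (q - r) := by
    simp only [adjointField, act, map_sub]
    abel
  rw [e]
  refine norm_act_transpose_le (fun v => ?_) _
  rw [act_jacobian (hf.differentiable two_ne_zero y)]
  exact ((fderiv ℝ f y).le_opNorm v).trans
    (mul_le_mul_of_nonneg_right (norm_fderiv_le_of_lipschitz ℝ hC) (norm_nonneg _))

/-! ### The state equation -/

/-- A trajectory solves the state equation if and only if its derivative satisfies the equation
pointwise; here `f` need not be the nonlinearity of `P`. -/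
theorem DelayProblem.isState_traj_iff {G : Type*} [NormedAddCommGroup G] [NormedSpace ℝ G]
    {b T : ℝ} (P : DelayProblem n G b T) {A : Matrix (Fin n) (Fin n) ℝ} (hA : P.A = actL A)
    {φ : H1 (-b) 0 n} (hφ : φ = primH1 (-b) 0 0 (P.c, extZero (-b) 0 P.ψ)) (f : Vec n → Vec n)
    {τ : ℝ} (hτ : τ ∈ Ico 0 b) (v : L2 0 T n) :
    IsState f A P.r φ τ (P.traj v) ↔ ∀ᵐ t ∂volume.restrict (Ioo 0 T), v t =
      P.r t - f (trajFun P.c P.ψ v t) + P.A (trajFun P.c P.ψ v (t - τ)) := by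
  have hb : 0 ≤ b := hτ.1.trans hτ.2.le
  refine (and_iff_left (P.traj_val_ae_history hφ v)).trans (eventually_congr ?_)
  filter_upwards [P.traj_dot_ae hb v, ae_Ioo_mono (P.traj_val_ae v) (neg_nonpos.2 hb) le_rfl,
    ae_Ioo_shift (c := 0) (d := T) (s := -τ) (P.traj_val_ae v) (by linarith [hτ.2])
      (by linarith [hτ.1])] with t e1 e2 e3
  rw [← sub_eq_add_neg] at e3
  rw [e1, e2, e3, hA, actL_apply, ← eq_sub_iff_add_eq]
  refine Eq.congr_right ?_
  abel

/-- Solvability of the state equation and differentiability in the delay. Near the values of every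
solution the nonlinearity agrees with some compactly supported `h`; the functions `ξ` and `ξ'` are
the continuous representatives of the solutions and of their derivatives on `[0, T]`. -/
theorem exists_state {b T : ℝ} (hb : 0 < b) (hT : 0 ≤ T) {f : Vec n → Vec n} (hf : ContDiff ℝ 2 f)
    {lam : ℝ} (hlam : 0 ≤ lam) (hmon : ∀ y v : Vec n,
      0 ≤ inner ℝ (act (jacobian f y + lam • (1 : Matrix (Fin n) (Fin n) ℝ)) v) v)
    (A : Matrix (Fin n) (Fin n) ℝ) (g : L2 0 T n) (φ : H1 (-b) 0 n) :
    ∃ (h : Vec n → Vec n) (x x' : ℝ → H1 (-b) T n) (ξ ξ' : ℝ → C(Icc 0 T, Vec n)),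
      ContDiff ℝ 2 h ∧ HasCompactSupport h ∧
      (∀ τ ∈ Ico 0 b, IsState f A g φ τ (x τ) ∧ ∀ y, IsState f A g φ τ y → y = x τ) ∧
      (∀ τ ∈ Ico 0 b, HasDerivWithinAt x (x' τ) (Ico 0 b) τ) ∧
      (∀ τ ∈ Ico 0 b, HasDerivWithinAt ξ (ξ' τ) (Ico 0 b) τ) ∧
      ContinuousOn ξ' (Ico 0 b) ∧
      (∀ τ ∈ Ico 0 b, ∀ t, h =ᶠ[𝓝 (ξ τ t)] f) ∧
      ∀ τ, (∀ᵐ t ∂volume.restrict (Ioo 0 T), H1.val (x τ) t = ξ τ (projIcc 0 T hT t)) ∧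
        ∀ᵐ t ∂volume.restrict (Ioo 0 T), H1.val (x' τ) t = ξ' τ (projIcc 0 T hT t) := by
  obtain ⟨φ0, hφ0⟩ := exists_eq_primH1 0 φ
  set ψ : L2 (-b) 0 n := φ.1.snd
  obtain ⟨M, hM⟩ := exists_apriori_bound (b := b) (m := ‖f 0‖) hlam (actL A) φ0 ψ g
  have hMR : M < |M| + 1 := (le_abs_self M).trans_lt (lt_add_one _)
  obtain ⟨h, hh, hhc, hhf, hχ⟩ := exists_truncation hf (R := |M| + 1) (by positivity)
  have hfb := inner_lower_bound (hf.differentiable two_ne_zero) hmon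
  have hhb : ∀ y, -(lam * ‖y‖ ^ 2) - ‖f 0‖ * ‖y‖ ≤ inner ℝ (h y) y := fun y => by
    obtain ⟨χ, h0, h1, e⟩ := hχ y
    rw [e, real_inner_smul_left]
    have hneg : 0 ≤ lam * ‖y‖ ^ 2 + ‖f 0‖ * ‖y‖ := by positivity
    nlinarith [mul_le_mul_of_nonneg_left (hfb y) h0, mul_le_mul_of_nonneg_right h1 hneg]
  obtain ⟨Λ, hΛ⟩ := hh.lipschitzWith_of_hasCompactSupport hhc (by norm_num)
  let P : DelayProblem n (Vec n) b T :=
    { hT := hT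
      F := fun z => h z.2
      hF := (hh.of_le one_le_two).comp contDiff_snd
      Λ := Λ
      hΛ := Λ.2
      lip := fun _ y z => by
        simpa only [dist_eq_norm] using hΛ.dist_le_mul y z
      A := actL A
      c := φ0
      ψ := ψ
      r := g }
  obtain ⟨v, v', hv, hv', hvc, -⟩ := P.exists_solution (ξ := fun _ => 0) (ξ' := fun _ => 0)
    (fun τ _ => hasDerivWithinAt_const τ _ _) continuousOn_const
  -- the a priori bound applies to `f` and to `h`, which agree on the ball in question
  have hiff : ∀ τ ∈ Ico 0 b, ∀ w, IsState f A g φ τ (P.traj w) ↔ P.rhs 0 τ w = w :=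
    fun τ hτ w => by
      refine (P.isState_traj_iff rfl hφ0 f hτ w).trans (Iff.trans ?_ (P.rhs_eq_iff 0 hτ w).symm)
      constructor
      · intro hw
        have hB := hM f hfb τ hτ w hw
        filter_upwards [hw, ae_restrict_mem measurableSet_Ioo] with t e ht
        have hlt := (hB t (Ioo_subset_Icc_self ht)).trans_lt hMR
        rw [e]
        exact congrArg (fun z => g t - z + _) (hhf _ hlt).eq_of_nhds.symm
      · intro hw
        have hB := hM h hhb τ hτ w hw
        filter_upwards [hw, ae_restrict_mem measurableSet_Ioo] with t e ht
        have hlt := (hB t (Ioo_subset_Icc_self ht)).trans_lt hMR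
        rw [e]
        exact congrArg (fun z => g t - z + _) (hhf _ hlt).eq_of_nhds
  refine ⟨h, fun τ => P.traj (v τ), fun τ => liftH1 b T (v' τ), fun τ => P.trajC (v τ),
    fun τ => primC T (v' τ), hh, hhc, fun τ hτ => ⟨(hiff τ hτ _).2 (hv τ hτ).1, fun y hy => ?_⟩,
    fun τ hτ => ?_, fun τ hτ => ?_, (primC T).continuous.comp_continuousOn hvc,
    fun τ hτ t => ?_, fun τ => ⟨?_, ?_⟩⟩
  · obtain ⟨w, rfl⟩ := P.exists_eq_traj hb hφ0 hy.2
    rw [(hv τ hτ).2 w ((hiff τ hτ w).1 hy)]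
  · exact ((liftH1 b T).hasFDerivAt.comp_hasDerivWithinAt τ (hv' τ hτ)).const_add _
  · exact ((primC T).hasFDerivAt.comp_hasDerivWithinAt τ (hv' τ hτ)).const_add _
  · refine hhf _ (lt_of_le_of_lt ?_ hMR)
    rw [P.trajC_apply]
    exact hM h hhb τ hτ (v τ) ((P.rhs_eq_iff 0 hτ (v τ)).1 (hv τ hτ).1) t t.2
  · filter_upwards [ae_Ioo_mono (P.traj_val_ae (v τ)) (neg_nonpos.2 hb.le) le_rfl,
      ae_restrict_mem measurableSet_Ioo] with t e ht
    rw [e, P.trajC_apply, projIcc_of_mem hT (Ioo_subset_Icc_self ht)]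
  · filter_upwards [ae_Ioo_mono (liftH1_val_ae b T (v' τ)) (neg_nonpos.2 hb.le) le_rfl,
      ae_restrict_mem measurableSet_Ioo] with t e ht
    rw [e, primC_apply, projIcc_of_mem hT (Ioo_subset_Icc_self ht)]

/-! ### The adjoint equation -/

theorem ae_Ioo_reflect_iff {T : ℝ} {P : ℝ → Prop} :
    (∀ᵐ t ∂volume.restrict (Ioo 0 T), P t) ↔ ∀ᵐ t ∂volume.restrict (Ioo 0 T), P (T - t) := by
  refine ⟨fun h => ae_Ioo_reflect h (sub_self T).ge (sub_zero T).le, fun h => ?_⟩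
  filter_upwards [ae_Ioo_reflect (c := 0) (d := T) h (sub_self T).ge (sub_zero T).le] with t ht
  rwa [sub_sub_cancel] at ht

/-- The Sobolev function `q` on `(0, T + b)` that vanishes after `T` and satisfies
`q̇(t) = -v(T - t)` before `T`. -/
def revLift (b T : ℝ) : L2 0 T n →L[ℝ] H1 0 (T + b) n :=
  reflH1 (s := T) (by linarith) (by linarith) ∘L liftH1 b T

theorem revLift_val_ae (b T : ℝ) (v : L2 0 T n) :
    H1.val (revLift b T v) =ᵐ[volume.restrict (Ioo 0 (T + b))]
      fun t => ∫ s in (0 : ℝ)..(T - t), extZero 0 T v s := by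
  filter_upwards [reflH1_val_ae (s := T) (a' := 0) (b' := T + b) (by linarith) (by linarith)
    (liftH1 b T v), ae_Ioo_reflect (s := T) (c := 0) (d := T + b) (liftH1_val_ae b T v)
    (by linarith) (by linarith)] with t e1 e2
  exact e1.trans e2

theorem revLift_dot_ae (b T : ℝ) (v : L2 0 T n) :
    H1.dot (revLift b T v) =ᵐ[volume.restrict (Ioo 0 (T + b))]
      fun t => -H1.dot (liftH1 b T v) (T - t) :=
  reflH1_dot_ae (by linarith) (by linarith) _

theorem revLift_val_ae_eq_zero {b T : ℝ} (hT : 0 ≤ T) (v : L2 0 T n) :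
    ∀ᵐ t ∂volume.restrict (Ioo T (T + b)), H1.val (revLift b T v) t = 0 := by
  filter_upwards [ae_Ioo_mono (revLift_val_ae b T v) hT le_rfl,
    ae_restrict_mem measurableSet_Ioo] with t e ht
  rw [e, integral_extZero_of_nonpos (by linarith [ht.1])]

namespace DelayProblem

variable {G : Type*} [NormedAddCommGroup G] [NormedSpace ℝ G] {b T : ℝ} (P : DelayProblem n G b T)

theorem traj_of_zero (hc : P.c = 0) (hψ : P.ψ = 0) (v : L2 0 T n) : P.traj v = liftH1 b T v := by
  rw [traj, hc, hψ, histH1, map_zero, ← Prod.zero_eq_mk, map_zero, zero_add]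

theorem revLift_dot_ae_Ioo (hc : P.c = 0) (hψ : P.ψ = 0) (hb : 0 ≤ b) (v : L2 0 T n) :
    H1.dot (revLift b T v) =ᵐ[volume.restrict (Ioo 0 T)] fun t => -v (T - t) := by
  filter_upwards [ae_Ioo_mono (revLift_dot_ae b T v) le_rfl (le_add_of_nonneg_right hb),
    ae_Ioo_reflect (s := T) (c := 0) (d := T) (P.traj_dot_ae hb v) (sub_self T).ge
      (sub_zero T).le] with t e1 e2
  rw [e1, ← e2, P.traj_of_zero hc hψ]

theorem exists_eq_revLift (hc : P.c = 0) (hψ : P.ψ = 0) (hb : 0 < b) {q : H1 0 (T + b) n}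
    (hq : ∀ᵐ t ∂volume.restrict (Ioo T (T + b)), H1.val q t = 0) : ∃ v, q = revLift b T v := by
  have hφ : (0 : H1 (-b) 0 n) = primH1 (-b) 0 0 (P.c, extZero (-b) 0 P.ψ) := by
    rw [hc, hψ, map_zero, ← Prod.zero_eq_mk, map_zero]
  have h1 : (0 : ℝ) ≤ T - T := (sub_self T).ge
  have h2 : T - -b ≤ T + b := (sub_neg_eq_add T b).le
  obtain ⟨v, hv⟩ := P.exists_eq_traj hb hφ (y := reflH1 (s := T) h1 h2 q) (by
    filter_upwards [ae_Ioo_mono (reflH1_val_ae (s := T) h1 h2 q) le_rfl P.hT,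
      ae_Ioo_reflect (s := T) (c := -b) (d := 0) hq (by linarith) (by linarith),
      Lp.coeFn_zero (Vec n) 2 (volume.restrict (Ioo (-b) 0))] with t e1 e2 e3
    exact (e1.trans e2).trans e3.symm)
  refine ⟨v, ?_⟩
  rw [P.traj_of_zero hc hψ] at hv
  rw [revLift, ContinuousLinearMap.comp_apply, ← hv, reflH1_reflH1]

end DelayProblem

theorem revC_projIcc {T : ℝ} (hT : 0 ≤ T) (ξ : C(Icc 0 T, Vec n)) {t : ℝ} (ht : t ∈ Ioo 0 T) :
    revC T ξ (projIcc 0 T hT (T - t)) = ξ (projIcc 0 T hT t) := by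
  have ht' : T - t ∈ Icc 0 T := ⟨by linarith [ht.2], by linarith [ht.1]⟩
  rw [projIcc_of_mem hT ht', projIcc_of_mem hT (Ioo_subset_Icc_self ht), revC_apply]
  exact congrArg ξ (Subtype.ext (sub_sub_cancel T t))

/-- Solvability of the adjoint equation and continuous differentiability in the delay. After the
time reversal `t ↦ T - t` the adjoint equation is a delay equation with vanishing history in which
the state enters as a parameter. -/
theorem exists_adjoint {b T : ℝ} (hb : 0 < b) (hT : 0 ≤ T) {f h : Vec n → Vec n}
    (hh : ContDiff ℝ 2 h) (hhc : HasCompactSupport h) (A : Matrix (Fin n) (Fin n) ℝ)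
    (xd : L2 0 T n) {x x' : ℝ → H1 (-b) T n} {ξ ξ' : ℝ → C(Icc 0 T, Vec n)}
    (hξ : ∀ τ ∈ Ico 0 b, HasDerivWithinAt ξ (ξ' τ) (Ico 0 b) τ)
    (hξ' : ContinuousOn ξ' (Ico 0 b))
    (hfh : ∀ τ ∈ Ico 0 b, ∀ t, h =ᶠ[𝓝 (ξ τ t)] f)
    (hx : ∀ τ, ∀ᵐ t ∂volume.restrict (Ioo 0 T), H1.val (x τ) t = ξ τ (projIcc 0 T hT t))
    (hx' : ∀ τ, ∀ᵐ t ∂volume.restrict (Ioo 0 T), H1.val (x' τ) t = ξ' τ (projIcc 0 T hT t)) :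
    ∃ p p' : ℝ → H1 0 (T + b) n,
      (∀ τ ∈ Ico 0 b, IsAdjoint f A xd τ (x τ) (p τ) ∧
        ∀ q, IsAdjoint f A xd τ (x τ) q → q = p τ) ∧
      (∀ τ ∈ Ico 0 b, HasDerivWithinAt p (p' τ) (Ico 0 b) τ) ∧
      ContinuousOn p' (Ico 0 b) ∧
      ∀ τ ∈ Ico 0 b, IsAdjointDeriv f A τ (x τ) (x' τ) (p τ) (p' τ) ∧
        ∀ w, IsAdjointDeriv f A τ (x τ) (x' τ) (p τ) w → w = p' τ := by
  obtain ⟨Λ, hΛ, hlip⟩ := exists_adjointField_lipschitz hh hhc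
  let P : DelayProblem n (Vec n) b T :=
    { hT := hT
      F := adjointField h
      hF := contDiff_adjointField hh
      Λ := Λ
      hΛ := hΛ
      lip := hlip
      A := actL A.transpose
      c := 0
      ψ := 0
      r := -reflL 0 T 0 T T xd }
  have hr : ∀ᵐ t ∂volume.restrict (Ioo 0 T), P.r (T - t) = -xd t := by
    refine (ae_Ioo_reflect_iff (P := fun t => P.r t = -xd (T - t))).1 ?_ |>.mono fun t e => ?_
    · filter_upwards [reflL_ae (s := T) (sub_self T).ge (sub_zero T).le xd,
        Lp.coeFn_neg (reflL 0 T 0 T T xd)] with t e1 e2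
      exact e2.trans (congrArg Neg.neg e1)
    · rwa [sub_sub_cancel] at e
  obtain ⟨v, v', hv, hv', hvc, hlin⟩ := P.exists_solution (ξ := fun τ => revC T (ξ τ))
    (ξ' := fun τ => revC T (ξ' τ))
    (fun τ hτ => (revC T).hasFDerivAt.comp_hasDerivWithinAt τ (hξ τ hτ))
    ((revC T).continuous.comp_continuousOn hξ')
  have hdelay : ∀ τ ∈ Ico 0 b, ∀ w : L2 0 T n, ∀ᵐ t ∂volume.restrict (Ioo 0 T),
      H1.val (revLift b T w) (t + τ) = ∫ s in (0 : ℝ)..(T - t - τ), extZero 0 T w s :=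
    fun τ hτ w => by
      filter_upwards [ae_Ioo_shift (c := 0) (d := T) (s := τ) (revLift_val_ae b T w)
        (by linarith [hτ.1]) (by linarith [hτ.2])] with t e
      rw [e, sub_sub]
  -- the fixed point equation is the time-reversed adjoint equation
  have hiff : ∀ τ ∈ Ico 0 b, ∀ w, IsAdjoint f A xd τ (x τ) (revLift b T w) ↔
      P.rhs (revC T (ξ τ)) τ w = w := fun τ hτ w => by
    refine (and_iff_left (revLift_val_ae_eq_zero hT w)).trans
      (Iff.trans (eventually_congr ?_) ((P.rhs_eq_iff _ hτ w).trans ae_Ioo_reflect_iff).symm)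
    filter_upwards [P.revLift_dot_ae_Ioo rfl rfl hb.le w, hdelay τ hτ w, hr, hx τ,
      ae_Ioo_mono (revLift_val_ae b T w) le_rfl (le_add_of_nonneg_right hb.le),
      ae_restrict_mem measurableSet_Ioo] with t e1 e2 e3 e4 e5 ht
    change _ ↔ w (T - t) = P.r (T - t) - adjointField h (_, trajFun 0 0 w (T - t)) +
      act A.transpose (trajFun 0 0 w (T - t - τ))
    rw [e1, e2, e3, e4, e5, trajFun_zero, trajFun_zero, revC_projIcc hT (ξ τ) ht, adjointField,
      jacobian_congr (hfh τ hτ _), neg_neg, ← eq_sub_iff_add_eq]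
    refine Eq.congr_right ?_
    abel
  -- the linearized fixed point equation is the time-reversed differentiated adjoint equation
  have hiff' : ∀ τ ∈ Ico 0 b, ∀ w,
      IsAdjointDeriv f A τ (x τ) (x' τ) (revLift b T (v τ)) (revLift b T w) ↔
        P.lin (revC T (ξ τ)) (v τ) (revC T (ξ' τ)) (-P.delayDot τ (P.traj (v τ))) τ w = w :=
    fun τ hτ w => by
      refine (and_iff_left (revLift_val_ae_eq_zero hT w)).trans
        (Iff.trans (eventually_congr ?_) ((P.lin_eq_iff _ _ hτ _ w).trans ae_Ioo_reflect_iff).symm)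
      filter_upwards [P.revLift_dot_ae_Ioo rfl rfl hb.le w, hdelay τ hτ w, hx τ, hx' τ,
        ae_Ioo_mono (revLift_val_ae b T w) le_rfl (le_add_of_nonneg_right hb.le),
        ae_Ioo_mono (revLift_val_ae b T (v τ)) le_rfl (le_add_of_nonneg_right hb.le),
        ae_Ioo_shift (c := 0) (d := T) (s := τ) (revLift_dot_ae b T (v τ))
          (by linarith [hτ.1]) (by linarith [hτ.2]),
        ae_restrict_mem measurableSet_Ioo] with t e1 e2 e3 e4 e5 e6 e7 ht
      change _ ↔ w (T - t) = -actL A.transpose (H1.dot (P.traj (v τ)) (T - t - τ)) -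
        fderiv ℝ (adjointField h) (_, trajFun 0 0 (v τ) (T - t)) (_, _) + act A.transpose _
      rw [e1, e2, e3, e4, e5, e6, e7, P.traj_of_zero rfl rfl, trajFun_zero,
        revC_projIcc hT (ξ τ) ht, revC_projIcc hT (ξ' τ) ht, fderiv_adjointField hh,
        jacobian_congr (hfh τ hτ _), secondTerm_congr (hfh τ hτ _), neg_neg, ← actL_apply A.transpose
        (-_), map_neg, ← sub_sub T t τ, sub_eq_iff_eq_add, ← eq_sub_iff_add_eq]
      refine Eq.congr_right ?_
      abel
  refine ⟨fun τ => revLift b T (v τ), fun τ => revLift b T (v' τ),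
    fun τ hτ => ⟨(hiff τ hτ _).2 (hv τ hτ).1, fun q hq => ?_⟩,
    fun τ hτ => (revLift b T).hasFDerivAt.comp_hasDerivWithinAt τ (hv' τ hτ),
    (revLift b T).continuous.comp_continuousOn hvc,
    fun τ hτ => ⟨(hiff' τ hτ _).2 (hlin τ hτ).1, fun q hq => ?_⟩⟩
  · obtain ⟨w, rfl⟩ := P.exists_eq_revLift rfl rfl hb hq.2
    rw [(hv τ hτ).2 w ((hiff τ hτ w).1 hq)]
  · obtain ⟨w, rfl⟩ := P.exists_eq_revLift rfl rfl hb hq.2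
    rw [(hlin τ hτ).2 w ((hiff' τ hτ w).1 hq)]

end DelayAdjoint

end

theorem proposition4p1 {n : ℕ} (b T : ℝ) (hb : 0 < b) (hT : 0 < T)
    (f : Vec n → Vec n) (hf : ContDiff ℝ 2 f)
    (hmon : ∃ lam : ℝ, 0 < lam ∧ ∀ y v : Vec n,
      0 ≤ inner ℝ (act (jacobian f y + lam • (1 : Matrix (Fin n) (Fin n) ℝ)) v) v)
    (A : Matrix (Fin n) (Fin n) ℝ)
    (g : L2 0 T n) (φ : H1 (-b) 0 n) (xd : L2 0 T n) :
    ∃ (x x' : ℝ → H1 (-b) T n) (p p' : ℝ → H1 0 (T + b) n),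
      -- `x[τ]` is the unique solution of the delay equation
      (∀ τ ∈ Set.Ico 0 b, IsState f A g φ τ (x τ) ∧ ∀ y, IsState f A g φ τ y → y = x τ) ∧
      -- `p[τ]` is the unique solution of the adjoint equation
      (∀ τ ∈ Set.Ico 0 b, IsAdjoint f A xd τ (x τ) (p τ) ∧
        ∀ q, IsAdjoint f A xd τ (x τ) q → q = p τ) ∧
      -- `x'[τ]` is the derivative of the state with respect to the delay
      (∀ τ ∈ Set.Ico 0 b, HasDerivWithinAt x (x' τ) (Set.Ico 0 b) τ) ∧
      -- `τ ↦ p[τ]` is continuously differentiable with derivative `p'[τ]`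
      (∀ τ ∈ Set.Ico 0 b, HasDerivWithinAt p (p' τ) (Set.Ico 0 b) τ) ∧
      ContinuousOn p' (Set.Ico 0 b) ∧
      -- `p'[τ]` is the unique solution of the differentiated adjoint equation
      (∀ τ ∈ Set.Ico 0 b, IsAdjointDeriv f A τ (x τ) (x' τ) (p τ) (p' τ) ∧
        ∀ w, IsAdjointDeriv f A τ (x τ) (x' τ) (p τ) w → w = p' τ) := by
  obtain ⟨lam, hlam, hmon⟩ := hmon
  obtain ⟨h, x, x', ξ, ξ', hh, hhc, hst, hx', hξ, hξ', hfh, hval⟩ :=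
    exists_state hb hT.le hf hlam.le hmon A g φ
  obtain ⟨p, p', hp, hp', hpc, hlin⟩ := exists_adjoint hb hT.le hh hhc A xd hξ hξ' hfh
    (fun τ => (hval τ).1) fun τ => (hval τ).2
  exact ⟨x, x', p, p', hst, hp, hx', hp', hpc, hlin⟩
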